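/- A finite dynamical system (FDS) is a function $A:S_A\to S_A$ on a finite set $S_A$ of states; its size is $|A|=|S_A|$, and FDSs are considered up to isomorphism of their graphs (one arrow $x\to A(x)$ for each state $x$). The product $AB$ of two FDSs is the FDS on $S_A\times S_B$ given by $(a,b)\mapsto(A(a),B(b))$. A dendron is an FDS that has a connected graph and a fixpoint. Theorem. There is an algorithm (a random access program whose arithmetic operations are addition and truncated subtraction of natural numbers, each at unit cost) which, given any two dendrons $A$ and $B$ by the tables of their values on $\{0,\dots,|A|-1\}$ and $\{0,\dots,|B|-1\}$, halts after a number of steps bounded by a polynomial in $|A|+|B|$ and - if there is a dendron $C$ with $A=BC$, returns the table of such a dendron $C$, which is unique up to isomorphism; - otherwise, reports that no dendron $C$ with $A=BC$ exists. -/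

import Mathlib

/-! ### Finite dynamical systems and dendrons -/

/-- A finite dynamical system: a function from a finite set to itself. -/
structure FDS where
  State : Type
  [finite : Finite State]
  step : State → State

namespace FDS

/-- Isomorphism of finite dynamical systems (they are considered up to isomorphism of their graphs):
a bijection between the states which commutes with the dynamics. -/
def Iso (A B : FDS) : Prop :=
  ∃ e : A.State ≃ B.State, ∀ x, e (A.step x) = B.step (e x)

/-- The product: the two systems evolve in parallel. -/
instance : Mul FDS where
  mul A B :=
    { State := A.State × B.State
      finite := haveI := A.finite; haveI := B.finite; inferInstance
      step := fun x => (A.step x.1, B.step x.2) }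

/-- The underlying undirected graph (without loops) of the graph with an arrow from each `x` to
`A.step x`. -/
def graph (A : FDS) : SimpleGraph A.State :=
  SimpleGraph.fromRel fun x y => y = A.step x

/-- A dendron: a connected finite dynamical system with a fixpoint. -/
def IsDendron (A : FDS) : Prop :=
  A.graph.Connected ∧ ∃ x, A.step x = x

/-- The system on the states `0, …, n - 1` whose table of values is `f`.  Every finite dynamical
system with `n` states is isomorphic to one of this form. -/
def ofTable {n : ℕ} (f : Fin n → Fin n) : FDS where
  State := Fin n
  step := f

end FDS

/-! ### Random access programs with a step count

Programs over finitely many variables and arrays with entries in `ℕ`.  The arithmetic operations are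
addition and truncated subtraction only, so that each step lengthens the numbers in memory by at most
a constant number of bits; therefore the number of steps is polynomially related to the running time
on a Turing machine. -/

namespace RAM

/-- The contents of the memory: `var i` is the value of variable `i`, and `arr a i` is entry `i` of
array `a`. -/
structure Mem where
  var : ℕ → ℕ
  arr : ℕ → ℕ → ℕ

/-- Write `v` into variable `i`. -/
def Mem.setVar (s : Mem) (i v : ℕ) : Mem :=
  { s with var := Function.update s.var i v }

/-- Write `v` into entry `j` of array `a`. -/
def Mem.setArr (s : Mem) (a j v : ℕ) : Mem :=
  { s with arr := Function.update s.arr a (Function.update (s.arr a) j v) }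

/-- Arithmetic expressions. -/
inductive Expr : Type
  | const (c : ℕ) : Expr
  | var (i : ℕ) : Expr
  | get (a : ℕ) (e : Expr) : Expr
  | add (e₁ e₂ : Expr) : Expr
  | sub (e₁ e₂ : Expr) : Expr

/-- The value of an expression. -/
def Expr.eval (s : Mem) : Expr → ℕ
  | .const c => c
  | .var i => s.var i
  | .get a e => s.arr a (e.eval s)
  | .add e₁ e₂ => e₁.eval s + e₂.eval s
  | .sub e₁ e₂ => e₁.eval s - e₂.eval s

/-- The number of steps needed to evaluate an expression: one for each operation. -/
def Expr.cost : Expr → ℕ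
  | .const _ => 1
  | .var _ => 1
  | .get _ e => e.cost + 1
  | .add e₁ e₂ => e₁.cost + e₂.cost + 1
  | .sub e₁ e₂ => e₁.cost + e₂.cost + 1

/-- Programs.  A condition `e` holds if its value is not zero. -/
inductive Prog : Type
  | skip : Prog
  | assign (i : ℕ) (e : Expr) : Prog
  | store (a : ℕ) (j e : Expr) : Prog
  | seq (P Q : Prog) : Prog
  | ite (e : Expr) (P Q : Prog) : Prog
  | loop (e : Expr) (P : Prog) : Prog

/-- `Exec P s t s'`: the program `P`, started on the memory `s`, halts after exactly `t` steps with
memory `s'`. -/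
inductive Exec : Prog → Mem → ℕ → Mem → Prop
  | skip (s : Mem) : Exec .skip s 1 s
  | assign (i : ℕ) (e : Expr) (s : Mem) :
      Exec (.assign i e) s (e.cost + 1) (s.setVar i (e.eval s))
  | store (a : ℕ) (j e : Expr) (s : Mem) :
      Exec (.store a j e) s (j.cost + e.cost + 1) (s.setArr a (j.eval s) (e.eval s))
  | seq {P Q : Prog} {s₁ s₂ s₃ : Mem} {t₁ t₂ : ℕ} :
      Exec P s₁ t₁ s₂ → Exec Q s₂ t₂ s₃ → Exec (.seq P Q) s₁ (t₁ + t₂) s₃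
  | ite_true {e : Expr} {P Q : Prog} {s s' : Mem} {t : ℕ} :
      e.eval s ≠ 0 → Exec P s t s' → Exec (.ite e P Q) s (e.cost + 1 + t) s'
  | ite_false {e : Expr} {P Q : Prog} {s s' : Mem} {t : ℕ} :
      e.eval s = 0 → Exec Q s t s' → Exec (.ite e P Q) s (e.cost + 1 + t) s'
  | loop_stop {e : Expr} {P : Prog} {s : Mem} :
      e.eval s = 0 → Exec (.loop e P) s (e.cost + 1) s
  | loop_step {e : Expr} {P : Prog} {s₁ s₂ s₃ : Mem} {t₁ t₂ : ℕ} :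
      e.eval s₁ ≠ 0 → Exec P s₁ t₁ s₂ → Exec (.loop e P) s₂ t₂ s₃ →
        Exec (.loop e P) s₁ (e.cost + 1 + t₁ + t₂) s₃

/-- The array that holds the table `f`, followed by zeros. -/
def table {n : ℕ} (f : Fin n → Fin n) (i : ℕ) : ℕ :=
  if h : i < n then (f ⟨i, h⟩ : ℕ) else 0

/-- The initial memory for the input `(f, g)`: the sizes `n` and `m` are in the variables `0` and `1`,
the tables `f` and `g` are in the arrays `0` and `1`, and everything else is zero. -/
def input {n m : ℕ} (f : Fin n → Fin n) (g : Fin m → Fin m) : Mem where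
  var := fun i => if i = 0 then n else if i = 1 then m else 0
  arr := fun a => if a = 0 then table f else if a = 1 then table g else fun _ => 0

/-- The memory `s` reports failure: variable `0` holds `0`. -/
def Mem.ReportsNone (s : Mem) : Prop :=
  s.var 0 = 0

/-- The memory `s` returns the table `h` of size `l`: variable `0` holds `1`, variable `1` holds `l`,
and the first `l` entries of array `0` are the values of `h`. -/
def Mem.Returns (s : Mem) {l : ℕ} (h : Fin l → Fin l) : Prop :=
  s.var 0 = 1 ∧ s.var 1 = l ∧ ∀ i : Fin l, s.arr 0 i = h i

end RAM

/-! Unroll a dendron backwards from its fixpoint to depth `N`. The result is a tree, in which the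
loop contributes a shallower copy of the whole tree as a branch at the root. `val` records this tree
up to isomorphism as an iterated multiset: the value of a node at level `k + 1` is the multiset of
the values of its preimages at level `k`. For `N` at least the number of states, the root's value
determines the dendron (`FDS.iso_of_val_eq`). Children of a pair are pairs of children, so values
multiply (`val_prod`).

Each level is ordered linearly by comparing multisets from the greatest element downwards. The key
fact is `val_prod_lt`: multiplication by a node at least as high as the greater factor is strictly
monotone. Because of its loop, the root of a dendron has chains of preimages of every length, so
multiplication by the root of `B` preserves and reflects the order (`val_prod_le_iff`). This gives
cancellation, hence uniqueness of `C`. It also allows any tree `T'` to be compared with the unknown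
tree `T` of `C`: `T' ≤ T` if and only if `B T' ≤ A`.

With this test `T` is found greedily. List its nodes in depth-first order, siblings by decreasing
value. An initial segment together with the right next node is part of `T`, hence at most `T`.
Attached to a later node of depth less than `N`, or to any such node once `T` is complete, a new
node makes the tree greater than `T` (`IsDFS.val_lt_extend`). So the right parent is the last one
that passes the test. The size of `T` is at most `|C| (N + 1)` (`FDS.sum_treeSize_le`). The test is
partition refinement in a table that contains both `A` and `B T'`: ranks at level `k + 1` come from
those at level `k` (`rank_succ`).

The branch of `T` that comes from the loop is the highest and so is listed first; cutting it off
leaves `C` (`IsDFS.iso_cutFirst`). A last comparison of sizes and values verifies the result, which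
detects that no quotient exists.

The program is written in a language in which every loop runs `var 2` times; it compiles to random
access programs of polynomial running time (`SProg.exec`). -/

namespace RAM

/-! ### A structured language with polynomial running time -/

/-- Arithmetic expressions with bounded sums: `sum i e` is the sum of `e` where variable `i` runs
over all numbers less than the value of variable `2`. -/
inductive SExpr : Type
  | const (c : ℕ) : SExpr
  | var (i : ℕ) : SExpr
  | get (a : ℕ) (e : SExpr) : SExpr
  | add (e₁ e₂ : SExpr) : SExpr
  | sub (e₁ e₂ : SExpr) : SExpr
  | sum (i : ℕ) (e : SExpr) : SExpr

/-- The value of an expression with bounded sums. -/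
def SExpr.eval : SExpr → Mem → ℕ
  | .const c, _ => c
  | .var i, s => s.var i
  | .get a e, s => s.arr a (e.eval s)
  | .add e₁ e₂, s => e₁.eval s + e₂.eval s
  | .sub e₁ e₂, s => e₁.eval s - e₂.eval s
  | .sum i e, s => ∑ j ∈ Finset.range (s.var 2), e.eval (s.setVar i j)

/-- All variables are less than `k`, and variable `2` is never bound. -/
def SExpr.ok (k : ℕ) : SExpr → Bool
  | .const _ => true
  | .var i => decide (i < k)
  | .get _ e => e.ok k
  | .add e₁ e₂ => e₁.ok k && e₂.ok k
  | .sub e₁ e₂ => e₁.ok k && e₂.ok k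
  | .sum i e => decide (i < k) && decide (i ≠ 2) && e.ok k

/-- Structured programs: all loops run as often as variable `2` says. -/
inductive SProg : Type
  | skip : SProg
  | set (i : ℕ) (e : SExpr) : SProg
  | store (a : ℕ) (j e : SExpr) : SProg
  | seq (P Q : SProg) : SProg
  | ite (e : SExpr) (P Q : SProg) : SProg
  | rep (i : ℕ) (P : SProg) : SProg

/-- Iterate `G 0`, `G 1`, …, `G (n - 1)`. -/
def iter (G : ℕ → Mem → Mem) (s : Mem) : ℕ → Mem
  | 0 => s
  | n + 1 => G n (iter G s n)

/-- The memory after running a structured program. -/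
def SProg.run : SProg → Mem → Mem
  | .skip, s => s
  | .set i e, s => s.setVar i (e.eval s)
  | .store a j e, s => s.setArr a (j.eval s) (e.eval s)
  | .seq P Q, s => Q.run (P.run s)
  | .ite e P Q, s => if e.eval s ≠ 0 then P.run s else Q.run s
  | .rep i P, s => iter (fun j s => P.run (s.setVar i j)) s (s.var 2)

/-- All variables are less than `k`, and variable `2` is never written. -/
def SProg.ok (k : ℕ) : SProg → Bool
  | .skip => true
  | .set i e => decide (i < k) && decide (i ≠ 2) && e.ok k
  | .store _ j e => j.ok k && e.ok k
  | .seq P Q => P.ok k && Q.ok k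
  | .ite e P Q => e.ok k && P.ok k && Q.ok k
  | .rep i P => decide (i < k) && decide (i ≠ 2) && P.ok k

/-- Two memories agree on the arrays and on the variables less than `k`. -/
def Agree (k : ℕ) (s s' : Mem) : Prop :=
  s.arr = s'.arr ∧ ∀ i < k, s.var i = s'.var i

@[simp] theorem Mem.setVar_var (s : Mem) (i v : ℕ) :
    (s.setVar i v).var = Function.update s.var i v := rfl
@[simp] theorem Mem.setVar_arr (s : Mem) (i v : ℕ) : (s.setVar i v).arr = s.arr := rfl
@[simp] theorem Mem.setArr_var (s : Mem) (a j v : ℕ) : (s.setArr a j v).var = s.var := rfl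
@[simp] theorem Mem.setArr_arr (s : Mem) (a j v : ℕ) :
    (s.setArr a j v).arr = Function.update s.arr a (Function.update (s.arr a) j v) := rfl

theorem Agree.setVar {k : ℕ} {s s' : Mem} (h : Agree k s s') (i v : ℕ) :
    Agree k (s.setVar i v) (s'.setVar i v) := by
  refine ⟨h.1, fun l hl => ?_⟩
  by_cases hli : l = i
  · subst hli; simp
  · simp [hli, h.2 l hl]

theorem Agree.setArr {k : ℕ} {s s' : Mem} (h : Agree k s s') (a j v : ℕ) :
    Agree k (s.setArr a j v) (s'.setArr a j v) :=
  ⟨by simp [h.1], fun l hl => h.2 l hl⟩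

theorem SExpr.eval_congr {k : ℕ} (hk : 2 < k) (e : SExpr) :
    e.ok k = true → ∀ {s s' : Mem}, Agree k s s' → e.eval s = e.eval s' := by
  induction e with
  | const c => intros; rfl
  | var i => intro h s s' hs; exact hs.2 i (by simpa [ok] using h)
  | get a e ih => intro h s s' hs; simp only [eval]; rw [ih h hs, hs.1]
  | add e₁ e₂ ih₁ ih₂ | sub e₁ e₂ ih₁ ih₂ =>
    intro h s s' hs
    simp only [ok, Bool.and_eq_true] at h
    simp only [eval]; rw [ih₁ h.1 hs, ih₂ h.2 hs]
  | sum i e ih =>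
    intro h s s' hs
    simp only [ok, Bool.and_eq_true] at h
    simp only [eval]; rw [hs.2 2 hk]
    exact Finset.sum_congr rfl fun j _ => ih h.2 (hs.setVar i j)

/-- The loop bound is constant during a run; therefore all running times can be polynomials in the
initial value of variable `2`. -/
theorem SProg.run_var_two {k : ℕ} (P : SProg) :
    P.ok k = true → ∀ s : Mem, (P.run s).var 2 = s.var 2 := by
  induction P with
  | skip => intros; rfl
  | set i e =>
    intro h s
    simp only [ok, Bool.and_eq_true, decide_eq_true_eq] at h
    simp [run, Function.update_of_ne (Ne.symm h.1.2)]
  | store a j e => intros; rfl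
  | seq P Q hP hQ =>
    intro h s
    simp only [ok, Bool.and_eq_true] at h
    simp only [run]; rw [hQ h.2, hP h.1]
  | ite e P Q hP hQ =>
    intro h s
    simp only [ok, Bool.and_eq_true] at h
    simp only [run]; split_ifs
    · exact hP h.1.2 s
    · exact hQ h.2 s
  | rep i P hP =>
    intro h s
    simp only [ok, Bool.and_eq_true, decide_eq_true_eq] at h
    suffices ∀ n, (iter (fun j s => P.run (s.setVar i j)) s n).var 2 = s.var 2 from this _
    intro n
    induction n with
    | zero => rfl
    | succ n ih =>
      simp only [iter]
      rw [hP h.2, Mem.setVar_var, Function.update_of_ne (Ne.symm h.1.2), ih]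

theorem SProg.run_congr {k : ℕ} (hk : 2 < k) (P : SProg) :
    P.ok k = true → ∀ {s s' : Mem}, Agree k s s' → Agree k (P.run s) (P.run s') := by
  induction P with
  | skip => intro _ s s' h; exact h
  | set i e =>
    intro h s s' hs
    simp only [ok, Bool.and_eq_true] at h
    simp only [run]; rw [e.eval_congr hk h.2 hs]; exact hs.setVar _ _
  | store a j e =>
    intro h s s' hs
    simp only [ok, Bool.and_eq_true] at h
    simp only [run]; rw [e.eval_congr hk h.2 hs, j.eval_congr hk h.1 hs]; exact hs.setArr _ _ _
  | seq P Q hP hQ =>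
    intro h s s' hs
    simp only [ok, Bool.and_eq_true] at h
    exact hQ h.2 (hP h.1 hs)
  | ite e P Q hP hQ =>
    intro h s s' hs
    simp only [ok, Bool.and_eq_true] at h
    simp only [run]; rw [e.eval_congr hk h.1.1 hs]
    split_ifs
    · exact hP h.1.2 hs
    · exact hQ h.2 hs
  | rep i P hP =>
    intro h s s' hs
    simp only [ok, Bool.and_eq_true] at h
    simp only [run]; rw [hs.2 2 hk]
    generalize s'.var 2 = n
    induction n with
    | zero => exact hs
    | succ n ih => exact hP h.2 (ih.setVar i n)

/-- Induction on the number `d` of rounds that remain; `I j` holds before round `j`. -/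
theorem Exec.loop_count {e : Expr} {P : Prog} (I : ℕ → Mem → Prop) {K c : ℕ}
    (hstep : ∀ j < K, ∀ s, I j s → e.eval s ≠ 0 ∧
      ∃ t s', Exec P s t s' ∧ t ≤ c ∧ I (j + 1) s')
    (hend : ∀ s, I K s → e.eval s = 0) (d : ℕ) :
    ∀ j s, j + d = K → I j s →
      ∃ t s', Exec (.loop e P) s t s' ∧ t ≤ d * (c + e.cost + 1) + e.cost + 1 ∧ I K s' := by
  induction d with
  | zero =>
    intro j s hj hI
    obtain rfl : j = K := by omega
    exact ⟨_, s, Exec.loop_stop (hend s hI), by omega, hI⟩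
  | succ d ih =>
    intro j s hj hI
    obtain ⟨he, t₁, s₁, h₁, ht₁, hI₁⟩ := hstep j (by omega) s hI
    obtain ⟨t₂, s₂, h₂, ht₂, hI₂⟩ := ih (j + 1) s₁ (by omega) hI₁
    exact ⟨_, s₂, .loop_step he h₁ h₂, by rw [Nat.succ_mul]; omega, hI₂⟩

/-- Temporaries are allocated as on a stack: code compiled at `k'` preserves everything below `k'`
and leaves its result in `k'`, so a second operand compiled at `k' + 1` does not disturb the first.
-/
theorem SExpr.exec {k : ℕ} (hk : 2 < k) (e : SExpr) : e.ok k = true → ∀ k' ≥ k,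
    ∃ (P : Prog) (p : Polynomial ℕ), ∀ s : Mem, ∃ (t : ℕ) (s' : Mem), Exec P s t s' ∧
      t ≤ p.eval (s.var 2) ∧ s'.arr = s.arr ∧ (∀ i < k', s'.var i = s.var i) ∧
      s'.var k' = e.eval s := by
  induction e with
  | const c =>
    intro _ k' _
    refine ⟨.assign k' (.const c), 2, fun s => ⟨_, _, .assign _ _ _, ?_, rfl, ?_, ?_⟩⟩
    · simp [Expr.cost]
    · intro i hi; simp [hi.ne]
    · simp [Expr.eval, eval]
  | var i =>
    intro _ k' _
    refine ⟨.assign k' (.var i), 2, fun s => ⟨_, _, .assign _ _ _, ?_, rfl, ?_, ?_⟩⟩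
    · simp [Expr.cost]
    · intro i hi; simp [hi.ne]
    · simp [Expr.eval, eval]
  | get a e ih =>
    intro h k' hk'
    obtain ⟨P, p, hP⟩ := ih h k' hk'
    refine ⟨.seq P (.assign k' (.get a (.var k'))), p + 3, fun s => ?_⟩
    obtain ⟨t, s', h₁, h₂, h₃, h₄, h₅⟩ := hP s
    refine ⟨_, _, .seq h₁ (.assign _ _ _), ?_, ?_, ?_, ?_⟩
    · simp [Expr.cost]; omega
    · simp [h₃]
    · intro i hi; simp [hi.ne, h₄ i hi]
    · simp [Expr.eval, eval, h₅, h₃]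
  | add e₁ e₂ ih₁ ih₂ =>
    intro h k' hk'
    simp only [ok, Bool.and_eq_true] at h
    obtain ⟨P, p, hP⟩ := ih₁ h.1 k' hk'
    obtain ⟨Q, q, hQ⟩ := ih₂ h.2 (k' + 1) (by omega)
    refine ⟨.seq P (.seq Q (.assign k' (.add (.var k') (.var (k' + 1))))), p + q + 4,
      fun s => ?_⟩
    obtain ⟨t, s', h₁, h₂, h₃, h₄, h₅⟩ := hP s
    obtain ⟨t', s'', g₁, g₂, g₃, g₄, g₅⟩ := hQ s'
    refine ⟨_, _, .seq h₁ (.seq g₁ (.assign _ _ _)), ?_, ?_, ?_, ?_⟩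
    · rw [h₄ 2 (by omega)] at g₂
      simp [Expr.cost]; omega
    · simp [h₃, g₃]
    · intro i hi; simp [hi.ne, h₄ i hi, g₄ i (by omega)]
    · rw [e₂.eval_congr hk h.2 (s' := s) ⟨h₃, fun i hi => h₄ i (by omega)⟩] at g₅
      simp [Expr.eval, eval, h₅, g₅, g₄ k' (by omega)]
  | sub e₁ e₂ ih₁ ih₂ =>
    intro h k' hk'
    simp only [ok, Bool.and_eq_true] at h
    obtain ⟨P, p, hP⟩ := ih₁ h.1 k' hk'
    obtain ⟨Q, q, hQ⟩ := ih₂ h.2 (k' + 1) (by omega)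
    refine ⟨.seq P (.seq Q (.assign k' (.sub (.var k') (.var (k' + 1))))), p + q + 4,
      fun s => ?_⟩
    obtain ⟨t, s', h₁, h₂, h₃, h₄, h₅⟩ := hP s
    obtain ⟨t', s'', g₁, g₂, g₃, g₄, g₅⟩ := hQ s'
    refine ⟨_, _, .seq h₁ (.seq g₁ (.assign _ _ _)), ?_, ?_, ?_, ?_⟩
    · rw [h₄ 2 (by omega)] at g₂
      simp [Expr.cost]; omega
    · simp [h₃, g₃]
    · intro i hi; simp [hi.ne, h₄ i hi, g₄ i (by omega)]
    · rw [e₂.eval_congr hk h.2 (s' := s) ⟨h₃, fun i hi => h₄ i (by omega)⟩] at g₅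
      simp [Expr.eval, eval, h₅, g₅, g₄ k' (by omega)]
  | sum i e ih =>
    intro h k' hk'
    simp only [ok, Bool.and_eq_true, decide_eq_true_eq] at h
    obtain ⟨⟨hi, hi2⟩, he⟩ := h
    -- `k'` saves the old value of `i`, `k' + 1` accumulates the sum, and the summand is evaluated
    -- into `k' + 2`.
    obtain ⟨P, p, hP⟩ := ih he (k' + 2) (by omega)
    refine ⟨.seq (.assign k' (.var i)) (.seq (.assign (k' + 1) (.const 0))
      (.seq (.assign i (.const 0)) (.seq
        (.loop (.sub (.var 2) (.var i)) (.seq P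
          (.seq (.assign (k' + 1) (.add (.var (k' + 1)) (.var (k' + 2))))
            (.assign i (.add (.var i) (.const 1))))))
        (.seq (.assign i (.var k')) (.assign k' (.var (k' + 1))))))),
      -- A round costs at most `p` for the summand, 8 for two assignments and 4 for the test; 20 is
      -- ample for the rest.
      .X * (p + 12) + 20, fun s => ?_⟩
    let I : ℕ → Mem → Prop := fun j r => r.arr = s.arr ∧
      (∀ l < k', l ≠ i → r.var l = s.var l) ∧ r.var i = j ∧ r.var k' = s.var i ∧
      r.var (k' + 1) = ∑ l ∈ Finset.range j, e.eval (s.setVar i l)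
    have hIA : ∀ j r, I j r → Agree k r (s.setVar i j) := by
      rintro j r ⟨h₁, h₂, h₃, -⟩
      refine ⟨h₁, fun l hl => ?_⟩
      by_cases hli : l = i
      · subst hli; simp [h₃]
      · simp [hli, h₂ l (by omega) hli]
    have hI2 : ∀ j r, I j r → r.var 2 = s.var 2 := fun j r hr => hr.2.1 2 (by omega) (Ne.symm hi2)
    have I0 : I 0 (((s.setVar k' (s.var i)).setVar (k' + 1) 0).setVar i 0) := by
      refine ⟨rfl, fun l hl hli => ?_, ?_, ?_, ?_⟩
      · have h1 : l ≠ k' := by omega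
        have h2 : l ≠ k' + 1 := by omega
        simp [hli, h1, h2]
      · simp
      · have h1 : k' ≠ i := by omega
        simp [h1]
      · have h1 : k' + 1 ≠ i := by omega
        simp [h1]
    obtain ⟨t, s', h₁, h₂, h₃, h₄, h₅, h₆, h₇⟩ := Exec.loop_count
      (e := .sub (.var 2) (.var i)) (P := (.seq P
          (.seq (.assign (k' + 1) (.add (.var (k' + 1)) (.var (k' + 2))))
            (.assign i (.add (.var i) (.const 1)))))) I (K := s.var 2) (c := p.eval (s.var 2) + 8)
      (by
        intro j hj r hr
        refine ⟨by simp only [Expr.eval]; rw [hI2 j r hr, hr.2.2.1]; omega, ?_⟩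
        obtain ⟨t', r', g₁, g₂, g₃, g₄, g₅⟩ := hP r
        refine ⟨_, _, .seq g₁ (.seq (.assign _ _ _) (.assign _ _ _)), ?_, ?_⟩
        · rw [hI2 j r hr] at g₂
          simp [Expr.cost]; omega
        · rw [e.eval_congr hk he (hIA j r hr)] at g₅
          obtain ⟨e₁, e₂, e₃, e₄, e₅⟩ := hr
          have h1 : k' + 1 ≠ i := by omega
          have h2 : k' ≠ i := by omega
          refine ⟨by simp [g₃, e₁], fun l hl hli => ?_, ?_, ?_, ?_⟩
          · have h3 : l ≠ k' + 1 := by omega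
            simp [hli, h3, g₄ l (by omega), e₂ l hl hli]
          · simp [Expr.eval, h1.symm, g₄ i (by omega), e₃]
          · simp [h2, g₄ k' (by omega), e₄]
          · rw [Finset.sum_range_succ]
            simp [Expr.eval, h1, g₅, g₄ (k' + 1) (by omega), e₅])
      (by
        intro r hr
        simp only [Expr.eval]; rw [hI2 _ r hr, hr.2.2.1]; omega)
      (s.var 2) 0 _ (by omega) I0
    refine ⟨_, _, .seq (.assign _ _ _) (.seq (.assign _ _ _) (.seq (.assign _ _ _)
      (.seq h₁ (.seq (.assign _ _ _) (.assign _ _ _))))), ?_, ?_, ?_, ?_⟩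
    · simp only [Expr.cost] at h₂ ⊢
      simp only [Polynomial.eval_add, Polynomial.eval_mul, Polynomial.eval_X,
        Polynomial.eval_ofNat]
      have : p.eval (s.var 2) + 8 + (1 + 1 + 1) + 1 = p.eval (s.var 2) + 12 := by omega
      rw [this] at h₂
      omega
    · simp [h₃]
    · intro l hl
      by_cases hli : l = i
      · subst hli
        have h1 : l ≠ k' := by omega
        simp [h1, Expr.eval, h₆]
      · have h1 : l ≠ k' := by omega
        simp [hli, h1, h₄ l hl hli]
    · have h1 : k' + 1 ≠ i := by omega
      simp [Expr.eval, eval, h1, h₇]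

/-- Only the variables below `k` are simulated. The last clause protects the variables from `k` to
`k' - 1`, which hold the counters of the surrounding loops. -/
theorem SProg.exec {k : ℕ} (hk : 2 < k) (P : SProg) : P.ok k = true → ∀ k' ≥ k,
    ∃ (C : Prog) (p : Polynomial ℕ), ∀ s : Mem, ∃ (t : ℕ) (s' : Mem), Exec C s t s' ∧
      t ≤ p.eval (s.var 2) ∧ Agree k s' (P.run s) ∧
      (∀ i, k ≤ i → i < k' → s'.var i = s.var i) := by
  induction P with
  | skip =>
    intro _ k' _
    refine ⟨.skip, 1, fun s => ⟨_, _, .skip s, by simp, ⟨rfl, fun _ _ => rfl⟩, fun _ _ _ => rfl⟩⟩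
  | set i e =>
    intro h k' hk'
    simp only [ok, Bool.and_eq_true, decide_eq_true_eq] at h
    obtain ⟨C, p, hC⟩ := e.exec hk h.2 k' hk'
    refine ⟨.seq C (.assign i (.var k')), p + 2, fun s => ?_⟩
    obtain ⟨t, s', h₁, h₂, h₃, h₄, h₅⟩ := hC s
    refine ⟨_, _, .seq h₁ (.assign _ _ _), ?_, ?_, ?_⟩
    · simp [Expr.cost]; omega
    · simp only [Expr.eval, run]; rw [h₅]
      exact Agree.setVar ⟨h₃, fun i hi => h₄ i (by omega)⟩ _ _
    · intro l hl hl'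
      have : l ≠ i := by omega
      simp [this, h₄ l hl']
  | store a j e =>
    intro h k' hk'
    simp only [ok, Bool.and_eq_true] at h
    obtain ⟨C, p, hC⟩ := j.exec hk h.1 k' hk'
    obtain ⟨D, q, hD⟩ := e.exec hk h.2 (k' + 1) (by omega)
    refine ⟨.seq C (.seq D (.store a (.var k') (.var (k' + 1)))), p + q + 3, fun s => ?_⟩
    obtain ⟨t, s', h₁, h₂, h₃, h₄, h₅⟩ := hC s
    obtain ⟨t', s'', g₁, g₂, g₃, g₄, g₅⟩ := hD s'
    refine ⟨_, _, .seq h₁ (.seq g₁ (.store _ _ _ _)), ?_, ?_, ?_⟩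
    · rw [h₄ 2 (by omega)] at g₂
      simp [Expr.cost]; omega
    · simp only [Expr.eval, run]
      rw [g₄ k' (by omega), h₅, g₅,
        e.eval_congr hk h.2 (s' := s) ⟨h₃, fun i hi => h₄ i (by omega)⟩]
      exact Agree.setArr ⟨g₃.trans h₃, fun i hi => by rw [g₄ i (by omega), h₄ i (by omega)]⟩ _ _ _
    · intro l hl hl'
      simp [g₄ l (by omega), h₄ l hl']
  | seq P Q hP hQ =>
    intro h k' hk'
    simp only [ok, Bool.and_eq_true] at h
    obtain ⟨C, p, hC⟩ := hP h.1 k' hk'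
    obtain ⟨D, q, hD⟩ := hQ h.2 k' hk'
    refine ⟨.seq C D, p + q, fun s => ?_⟩
    obtain ⟨t, s', h₁, h₂, h₃, h₄⟩ := hC s
    obtain ⟨t', s'', g₁, g₂, g₃, g₄⟩ := hD s'
    refine ⟨_, _, .seq h₁ g₁, ?_, ?_, fun l hl hl' => by rw [g₄ l hl hl', h₄ l hl hl']⟩
    · rw [h₃.2 2 hk, P.run_var_two h.1] at g₂
      simp; omega
    · have := Q.run_congr hk h.2 h₃
      exact ⟨g₃.1.trans this.1, fun i hi => (g₃.2 i hi).trans (this.2 i hi)⟩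
  | ite e P Q hP hQ =>
    intro h k' hk'
    simp only [ok, Bool.and_eq_true] at h
    obtain ⟨C₀, p₀, hC₀⟩ := e.exec hk h.1.1 k' hk'
    obtain ⟨C, p, hC⟩ := hP h.1.2 k' hk'
    obtain ⟨D, q, hD⟩ := hQ h.2 k' hk'
    refine ⟨.seq C₀ (.ite (.var k') C D), p₀ + p + q + 2, fun s => ?_⟩
    obtain ⟨t, s', h₁, h₂, h₃, h₄, h₅⟩ := hC₀ s
    have hA : Agree k s' s := ⟨h₃, fun i hi => h₄ i (by omega)⟩
    have h2 := h₄ 2 (by omega)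
    by_cases he : e.eval s = 0
    · obtain ⟨t', s'', g₁, g₂, g₃, g₄⟩ := hD s'
      have := Q.run_congr hk h.2 hA
      refine ⟨_, _, .seq h₁ (.ite_false (by simpa [Expr.eval, h₅] using he) g₁), ?_, ?_, ?_⟩
      · rw [h2] at g₂
        simp [Expr.cost]; omega
      · simp only [run, he]
        exact ⟨g₃.1.trans this.1, fun i hi => (g₃.2 i hi).trans (this.2 i hi)⟩
      · intro l hl hl'; rw [g₄ l hl hl', h₄ l hl']
    · obtain ⟨t', s'', g₁, g₂, g₃, g₄⟩ := hC s'
      have := P.run_congr hk h.1.2 hA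
      refine ⟨_, _, .seq h₁ (.ite_true (by simpa [Expr.eval, h₅] using he) g₁), ?_, ?_, ?_⟩
      · rw [h2] at g₂
        simp [Expr.cost]; omega
      · simp only [run, if_pos he]
        exact ⟨g₃.1.trans this.1, fun i hi => (g₃.2 i hi).trans (this.2 i hi)⟩
      · intro l hl hl'; rw [g₄ l hl hl', h₄ l hl']
  | rep i P hP =>
    intro h k' hk'
    have hok := h
    simp only [ok, Bool.and_eq_true, decide_eq_true_eq] at h
    obtain ⟨⟨hi, hi2⟩, hPok⟩ := h
    -- The counter lives in `k'` and is copied to `i` in each round, because the body may overwrite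
    -- `i`.
    obtain ⟨C, p, hC⟩ := hP hPok (k' + 1) (by omega)
    refine ⟨.seq (.assign k' (.const 0)) (.loop (.sub (.var 2) (.var k'))
      (.seq (.assign i (.var k')) (.seq C (.assign k' (.add (.var k') (.const 1)))))),
      .X * (p + 10) + 6, fun s => ?_⟩
    let I : ℕ → Mem → Prop := fun j r =>
      Agree k r (iter (fun j s => P.run (s.setVar i j)) s j) ∧
      (∀ l, k ≤ l → l < k' → r.var l = s.var l) ∧ r.var k' = j ∧ r.var 2 = s.var 2
    have I0 : I 0 (s.setVar k' 0) := by
      have h2 : 2 ≠ k' := by omega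
      refine ⟨⟨rfl, fun l hl => ?_⟩, fun l hl hl' => ?_, by simp, by simp [h2]⟩
      · have : l ≠ k' := by omega
        simp [this, iter]
      · simp [hl'.ne]
    obtain ⟨t, s', h₁, h₂, h₃, h₄, h₅, h₆⟩ := Exec.loop_count
      (e := .sub (.var 2) (.var k')) (P := .seq (.assign i (.var k'))
        (.seq C (.assign k' (.add (.var k') (.const 1))))) I (K := s.var 2)
      (c := p.eval (s.var 2) + 6)
      (by
        rintro j hj r ⟨e₁, e₂, e₃, e₄⟩
        refine ⟨by simp only [Expr.eval]; rw [e₃, e₄]; omega, ?_⟩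
        obtain ⟨t', r', g₁, g₂, g₃, g₄⟩ := hC (r.setVar i j)
        have hr2 : (r.setVar i j).var 2 = s.var 2 := by
          simp [Function.update_of_ne (Ne.symm hi2), e₄]
        refine ⟨_, _, .seq (.assign _ _ _) (.seq
          (by simpa only [Expr.eval, e₃] using g₁) (.assign _ _ _)), ?_, ?_⟩
        · rw [hr2] at g₂
          simp [Expr.cost]; omega
        · have hA := P.run_congr hk hPok (e₁.setVar i j)
          have hA' : Agree k r' (P.run ((iter (fun j s => P.run (s.setVar i j)) s j).setVar i j)) :=
            ⟨g₃.1.trans hA.1, fun i hi => (g₃.2 i hi).trans (hA.2 i hi)⟩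
          have h2 : 2 ≠ k' := by omega
          have hki : k' ≠ i := by omega
          refine ⟨⟨hA'.1, fun l hl => ?_⟩, fun l hl hl' => ?_, ?_, ?_⟩
          · have : l ≠ k' := by omega
            simp [this, iter, hA'.2 l hl]
          · have h3 : l ≠ i := by omega
            simp [hl'.ne, g₄ l hl (by omega), h3, e₂ l hl hl']
          · simp [Expr.eval, g₄ k' hk' (by omega), hki, e₃]
          · simp only [Mem.setVar_var]
            rw [Function.update_of_ne h2, g₃.2 2 hk, P.run_var_two hPok, hr2])
      (by
        rintro r ⟨-, -, h₃, h₄⟩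
        simp only [Expr.eval]; rw [h₃, h₄]; omega)
      (s.var 2) 0 _ (by omega) I0
    refine ⟨_, _, .seq (.assign _ _ _) h₁, ?_, h₃, h₄⟩
    simp only [Expr.cost] at h₂ ⊢
    simp only [Polynomial.eval_add, Polynomial.eval_mul, Polynomial.eval_X,
      Polynomial.eval_ofNat]
    have : p.eval (s.var 2) + 6 + (1 + 1 + 1) + 1 = p.eval (s.var 2) + 10 := by omega
    rw [this] at h₂
    omega

end RAM

/-! ### Values of nodes: iterated multisets, ordered colexicographically -/

/-- Level `k` of the hierarchy of iterated finite multisets, each level with the colexicographic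
order of multiplicities. -/
noncomputable def ValueBundle : ℕ → (α : Type) × LinearOrder α
  | 0 => ⟨PUnit, inferInstance⟩
  | k + 1 => ⟨Colex ((ValueBundle k).1 →₀ ℕ), letI := (ValueBundle k).2; inferInstance⟩

/-- Multisets of multisets of … of depth `k`. -/
def Value (k : ℕ) : Type := (ValueBundle k).1

noncomputable instance (k : ℕ) : LinearOrder (Value k) := (ValueBundle k).2

namespace Value

instance : Subsingleton (Value 0) := inferInstanceAs (Subsingleton PUnit)

/-- A multiset of values as a value of the next level. -/
noncomputable def mk {k : ℕ} (s : Multiset (Value k)) : Value (k + 1) :=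
  show Colex (Value k →₀ ℕ) from toColex (Multiset.toFinsupp s)

/-- The multiset that a value consists of. -/
noncomputable def out {k : ℕ} (v : Value (k + 1)) : Multiset (Value k) :=
  Finsupp.toMultiset (ofColex (show Colex (Value k →₀ ℕ) from v))

@[simp] theorem out_mk {k : ℕ} (s : Multiset (Value k)) : (mk s).out = s := by
  exact Multiset.toFinsupp_toMultiset s

theorem mk_injective {k : ℕ} : Function.Injective (mk (k := k)) :=
  Function.LeftInverse.injective out_mk

theorem mk_lt_mk {k : ℕ} {s t : Multiset (Value k)} :
    mk s < mk t ↔ ∃ u, (∀ v, u < v → s.count v = t.count v) ∧ s.count u < t.count u := by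
  have : mk s < mk t ↔ ∃ u, (∀ v, u < v → Multiset.toFinsupp s v = Multiset.toFinsupp t v) ∧
    Multiset.toFinsupp s u < Multiset.toFinsupp t u :=
    Finsupp.Colex.lt_iff (a := toColex (Multiset.toFinsupp s)) (b := toColex (Multiset.toFinsupp t))
  simpa only [Multiset.toFinsupp_apply] using this

theorem countP_eq_of_count_eq {k : ℕ} {s t : Multiset (Value k)} {u : Value k}
    (h : ∀ v, u ≤ v → s.count v = t.count v) :
    s.countP (u ≤ ·) = t.countP (u ≤ ·) := by
  rw [Multiset.countP_eq_card_filter, Multiset.countP_eq_card_filter]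
  congr 1
  ext v
  rw [Multiset.count_filter, Multiset.count_filter]
  split_ifs with hv
  · exact h v hv
  · rfl

theorem countP_lt_of_count_lt {k : ℕ} {s t : Multiset (Value k)} {u : Value k}
    (h : ∀ v, u < v → s.count v = t.count v) (hu : s.count u < t.count u) :
    s.countP (u ≤ ·) < t.countP (u ≤ ·) := by
  have key : ∀ r : Multiset (Value k),
      r.countP (u ≤ ·) = (r.filter (u < ·)).card + r.count u := by
    intro r
    induction r using Multiset.induction_on with
    | empty => simp
    | cons a r ih =>
      rw [Multiset.countP_cons, ih, Multiset.count_cons, Multiset.filter_cons]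
      rcases lt_trichotomy u a with h | h | h
      · simp [h, h.le, h.ne]; omega
      · subst h; simp; omega
      · simp [h.ne', h.not_gt, h.not_ge]
  rw [key, key]
  have : s.filter (u < ·) = t.filter (u < ·) := by
    ext v
    rw [Multiset.count_filter, Multiset.count_filter]
    split_ifs with hv
    · exact h v hv
    · rfl
  rw [this]
  omega

/-- Upper counts replace multiplicities because raising elements of a multiset can lower a
multiplicity but never an upper count. If the order were reversed, the upper counts at the deciding
value would contradict the hypothesis. -/
theorem mk_le_mk_of_countP_le {k : ℕ} {s t : Multiset (Value k)}
    (h : ∀ u, s.countP (u ≤ ·) ≤ t.countP (u ≤ ·)) : mk s ≤ mk t := by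
  by_contra hlt
  obtain ⟨u, h₁, h₂⟩ := mk_lt_mk.1 (not_le.1 hlt)
  exact absurd (countP_lt_of_count_lt h₁ h₂) (not_lt.2 (h u))

/-- The greatest value with differing multiplicities decides, so nothing below `w` matters once
there is a strict inequality at `w`. -/
theorem mk_lt_mk_of_countP {k : ℕ} {s t : Multiset (Value k)} (w : Value k)
    (h : ∀ u, w ≤ u → s.countP (u ≤ ·) ≤ t.countP (u ≤ ·))
    (hw : s.countP (w ≤ ·) < t.countP (w ≤ ·)) : mk s < mk t := by
  by_contra hlt
  rcases (not_lt.1 hlt).lt_or_eq with hlt | heq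
  · obtain ⟨u, h₁, h₂⟩ := mk_lt_mk.1 hlt
    rcases le_or_gt w u with hu | hu
    · exact absurd (countP_lt_of_count_lt h₁ h₂) (not_lt.2 (h u hu))
    · exact absurd (countP_eq_of_count_eq fun v hv => h₁ v (hu.trans_le hv)) hw.ne'
  · rw [mk_injective heq] at hw
    exact lt_irrefl _ hw

theorem mk_lt_mk_of_count {k : ℕ} {s t : Multiset (Value k)} (w : Value k)
    (h : ∀ u, w ≤ u → s.count u ≤ t.count u) (hw : s.count w < t.count w) : mk s < mk t := by
  by_contra hlt
  rcases (not_lt.1 hlt).lt_or_eq with hlt | heq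
  · obtain ⟨u, h₁, h₂⟩ := mk_lt_mk.1 hlt
    rcases le_or_gt w u with hu | hu
    · exact absurd (h u hu) (not_le.2 h₂)
    · exact absurd (h₁ w hu) hw.ne'
  · rw [mk_injective heq] at hw
    exact lt_irrefl _ hw

/-- If `a` exceeded everything in `t`, then `t` would have upper count zero from `a` on and would be
the smaller multiset. -/
theorem exists_le_of_mk_le_mk {k : ℕ} {s t : Multiset (Value k)} (h : mk s ≤ mk t)
    {a : Value k} (ha : a ∈ s) : ∃ b ∈ t, a ≤ b := by
  by_contra! hb
  refine absurd (mk_lt_mk_of_countP (s := t) (t := s) a (fun u hu => ?_) ?_) (not_lt.2 h)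
  · rw [Multiset.countP_eq_zero.2 fun b hbt hub => absurd (hb b hbt) (not_lt.2 (hu.trans hub))]
    exact Nat.zero_le _
  · rw [Multiset.countP_eq_zero.2 fun b hbt hub => absurd (hb b hbt) (not_lt.2 hub)]
    exact Multiset.countP_pos.2 ⟨a, ha, le_rfl⟩

/-- Forget the deepest level. -/
noncomputable def trunc : (k : ℕ) → Value (k + 1) → Value k
  | 0, _ => PUnit.unit
  | k + 1, v => mk (v.out.map (trunc k))

/-- The product of values, level by level. -/
noncomputable def prod : (k : ℕ) → Value k → Value k → Value k
  | 0, _, _ => PUnit.unit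
  | k + 1, v, w => mk ((v.out ×ˢ w.out).map fun p => prod k p.1 p.2)

end Value

open Value

/-- The value at level `k` of the node `x`, where `ch x` is the set of children of `x`. -/
noncomputable def val {X : Type*} (ch : X → Finset X) : (k : ℕ) → X → Value k
  | 0, _ => PUnit.unit
  | k + 1, x => Value.mk ((ch x).val.map (val ch k))

theorem val_succ {X : Type*} (ch : X → Finset X) (k : ℕ) (x : X) :
    val ch (k + 1) x = Value.mk ((ch x).val.map (val ch k)) := rfl

theorem trunc_val {X : Type*} (ch : X → Finset X) (k : ℕ) (x : X) :
    trunc k (val ch (k + 1) x) = val ch k x := by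
  induction k generalizing x with
  | zero => rfl
  | succ k ih =>
    rw [trunc, val_succ, out_mk, val_succ ch k, Multiset.map_map]
    congr 1
    exact Multiset.map_congr rfl fun y _ => ih y

theorem val_eq_of_val_succ_eq {X Y : Type*} {ch : X → Finset X} {ch' : Y → Finset Y} {k : ℕ}
    {x : X} {y : Y} (h : val ch (k + 1) x = val ch' (k + 1) y) : val ch k x = val ch' k y := by
  rw [← trunc_val, h, trunc_val]

theorem map_val_eq_of_le {X Y : Type*} {ch : X → Finset X} {ch' : Y → Finset Y} {j k : ℕ}
    (hjk : j ≤ k) {s : Multiset X} {t : Multiset Y}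
    (h : s.map (val ch k) = t.map (val ch' k)) : s.map (val ch j) = t.map (val ch' j) := by
  induction k, hjk using Nat.le_induction with
  | base => exact h
  | succ k _ ih =>
    apply ih
    have := congrArg (Multiset.map (trunc k)) h
    simpa only [Multiset.map_map, Function.comp_def, trunc_val] using this

/-- Values are preserved by maps that induce bijections between the children. -/
theorem val_map {X Y : Type*} [DecidableEq Y] {ch : X → Finset X} {ch' : Y → Finset Y}
    {φ : X → Y} (S : Set X) (hS : ∀ x ∈ S, ∀ c ∈ ch x, c ∈ S) (hφ : Set.InjOn φ S)
    (h : ∀ x ∈ S, ch' (φ x) = (ch x).image φ) (k : ℕ) :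
    ∀ x ∈ S, val ch' k (φ x) = val ch k x := by
  induction k with
  | zero => intros; rfl
  | succ k ih =>
    intro x hx
    rw [val_succ, val_succ, h x hx, Finset.image_val_of_injOn
      (hφ.mono fun c hc => hS x hx c hc), Multiset.map_map]
    congr 1
    exact Multiset.map_congr rfl fun c hc => ih c (hS x hx c hc)

/-- The children in the product of two structures. -/
def prodChildren {X Y : Type*} (ch : X → Finset X) (ch' : Y → Finset Y) (p : X × Y) :
    Finset (X × Y) :=
  ch p.1 ×ˢ ch' p.2

/-- The children of `(x, y)` are the pairs of children; hence the value of a pair depends only on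
the values of its components. -/
theorem val_prod {X Y : Type*} (ch : X → Finset X) (ch' : Y → Finset Y) (k : ℕ) (x : X) (y : Y) :
    val (prodChildren ch ch') k (x, y) = Value.prod k (val ch k x) (val ch' k y) := by
  induction k generalizing x y with
  | zero => rfl
  | succ k ih =>
    rw [val_succ, Value.prod, val_succ, val_succ, out_mk, out_mk]
    congr 1
    have : ((ch x).val.map (val ch k) ×ˢ (ch' y).val.map (val ch' k)) =
        ((ch x).val ×ˢ (ch' y).val).map (Prod.map (val ch k) (val ch' k)) := by
      simp only [SProd.sprod, Multiset.product, Multiset.bind_map, Multiset.map_bind,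
        Multiset.map_map, Function.comp_def, Prod.map]
    rw [this, Multiset.map_map]
    exact Multiset.map_congr rfl fun p _ => ih p.1 p.2

/-! ### Heights, and monotonicity of multiplication -/

/-- There is a chain of `j` children below `x`. -/
def HasHeight {X : Type*} (ch : X → Finset X) : ℕ → X → Prop
  | 0, _ => True
  | j + 1, x => ∃ c ∈ ch x, HasHeight ch j c

theorem HasHeight.of_le {X : Type*} {ch : X → Finset X} {i j : ℕ} (hij : i ≤ j) {x : X}
    (h : HasHeight ch j x) : HasHeight ch i x := by
  induction i generalizing j x with
  | zero => trivial
  | succ i ih =>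
    obtain ⟨j, rfl⟩ : ∃ l, j = l + 1 := ⟨j - 1, by omega⟩
    obtain ⟨c, hc, hc'⟩ := h
    exact ⟨c, hc, ih (by omega) hc'⟩

theorem hasHeight_prod {X Y : Type*} {ch : X → Finset X} {ch' : Y → Finset Y} {j : ℕ} {x : X}
    {y : Y} : HasHeight (prodChildren ch ch') j (x, y) ↔ HasHeight ch j x ∧ HasHeight ch' j y := by
  induction j generalizing x y with
  | zero => simp [HasHeight]
  | succ j ih =>
    constructor
    · rintro ⟨⟨a, b⟩, hc, hab⟩
      obtain ⟨ha, hb⟩ := Finset.mem_product.1 hc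
      exact ⟨⟨a, ha, (ih.1 hab).1⟩, ⟨b, hb, (ih.1 hab).2⟩⟩
    · rintro ⟨⟨a, ha, ha'⟩, ⟨b, hb, hb'⟩⟩
      exact ⟨(a, b), Finset.mem_product.2 ⟨ha, hb⟩, ih.2 ⟨ha', hb'⟩⟩

/-- A higher node has a greater value. -/
theorem HasHeight.of_val_le {X Y : Type*} {ch : X → Finset X} {ch' : Y → Finset Y} {j k : ℕ}
    (hjk : j ≤ k) {x : X} {y : Y} (h : val ch k x ≤ val ch' k y) (hx : HasHeight ch j x) :
    HasHeight ch' j y := by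
  induction j generalizing k x y with
  | zero => trivial
  | succ j ih =>
    obtain ⟨k, rfl⟩ : ∃ l, k = l + 1 := ⟨k - 1, by omega⟩
    obtain ⟨c, hc, hc'⟩ := hx
    rw [val_succ, val_succ] at h
    obtain ⟨b, hb, hb'⟩ := exists_le_of_mk_le_mk h (Multiset.mem_map_of_mem _ hc)
    obtain ⟨d, hd, rfl⟩ := Multiset.mem_map.1 hb
    exact ⟨d, hd, ih (by omega) hb' hc'⟩

theorem exists_maxHeight {X : Type*} (ch : X → Finset X) (k : ℕ) (x : X) :
    ∃ j ≤ k, HasHeight ch j x ∧ ∀ i ≤ k, HasHeight ch i x → i ≤ j := by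
  classical
  exact ⟨Nat.findGreatest (fun j => HasHeight ch j x) k, Nat.findGreatest_le k,
    Nat.findGreatest_spec (P := fun j => HasHeight ch j x) (Nat.zero_le k) trivial,
    fun i hi h => Nat.le_findGreatest hi h⟩

theorem count_map_val {X : Type*} (s : Finset X) {k : ℕ} (f : X → Value k) (u : Value k) :
    (s.val.map f).count u = (s.filter fun x => f x = u).card := by
  rw [Multiset.count_map]
  simp only [eq_comm, Finset.card_def, Finset.filter_val]

theorem countP_map_val {X : Type*} (s : Finset X) {k : ℕ} (f : X → Value k) (u : Value k) :
    (s.val.map f).countP (u ≤ ·) = (s.filter fun x => u ≤ f x).card := by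
  rw [Multiset.countP_map]
  simp only [Finset.card_def, Finset.filter_val]

/-- Multiplication by a node of sufficient height is strictly monotone. -/
theorem val_prod_lt {X Y Z : Type*} {chX : X → Finset X} {chY : Y → Finset Y}
    {chZ : Z → Finset Z} (k : ℕ) : ∀ {x : X} {y : Y} {z : Z}, val chX k x < val chY k y →
    (∀ j ≤ k, HasHeight chY j y → HasHeight chZ j z) →
    val (prodChildren chZ chX) k (z, x) < val (prodChildren chZ chY) k (z, y) := by
  induction k with
  | zero =>
    intro x y z h
    exact absurd h (by rw [Subsingleton.elim (val chX 0 x) (val chY 0 y)]; exact lt_irrefl _)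
  | succ k ih =>
    intro x y z hlt hz
    rw [val_succ, val_succ, mk_lt_mk] at hlt
    -- `t` is the greatest value with different multiplicities below `x` and `y`. It occurs below
    -- `y`, as the value of a child `y'`.
    obtain ⟨t, ht, hxy⟩ := hlt
    have hty : t ∈ (chY y).val.map (val chY k) := by
      rw [← Multiset.count_pos]; omega
    obtain ⟨y', hy', rfl⟩ := Multiset.mem_map.1 hty
    replace hy' : y' ∈ chY y := hy'
    -- a child of `z` that is at least as high as `y'`
    obtain ⟨j₀, hj₀, hj₁, hj₂⟩ := exists_maxHeight chY k y'
    obtain ⟨c₁, hc₁, hc₁'⟩ : HasHeight chZ (j₀ + 1) z := hz _ (by omega) ⟨y', hy', hj₁⟩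
    obtain ⟨c₂, hc₂, hmax⟩ := (chZ z).exists_max_image
      (fun c => val (prodChildren chZ chY) k (c, y')) ⟨c₁, hc₁⟩
    -- `w`, the greatest value of a product of a child of `z` with `y'`, is the threshold for the
    -- comparison.
    set w := val (prodChildren chZ chY) k (c₂, y') with hw
    have hsmall : ∀ x' ∈ chX x, val chX k x' < val chY k y' → ∀ c ∈ chZ z,
        val (prodChildren chZ chX) k (c, x') < w := by
      intro x' _ hx'' c hc
      -- If `c` is at least as high as `y'`, the induction hypothesis applies. Otherwise `(c, x')`
      -- is lower than `(c₁, y')`, and lower nodes have smaller values.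
      by_cases hh : HasHeight chZ j₀ c
      · exact (ih hx'' fun j hj hjy => hh.of_le (hj₂ j hj hjy)).trans_le (hmax c hc)
      · refine lt_of_lt_of_le (not_le.1 fun hle => hh ?_) (hmax c₁ hc₁)
        exact (hasHeight_prod.1 (HasHeight.of_val_le hj₀ hle
          (hasHeight_prod.2 ⟨hc₁', hj₁⟩))).1
    have hsplit : ∀ r : Multiset (Value k),
        r = r.filter (val chY k y' ≤ ·) + r.filter (¬ val chY k y' ≤ ·) :=
      fun r => (Multiset.filter_add_not _ r).symm
    set V := (chZ z).val.map (val chZ k) with hV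
    set s := (chX x).val.map (val chX k) with hs
    set r := (chY y).val.map (val chY k) with hr
    -- From the value of `y'` upwards, `y` has all the children's values that `x` has, and a surplus
    -- copy of that of `y'`.
    have hle : s.filter (val chY k y' ≤ ·) + {val chY k y'} ≤ r.filter (val chY k y' ≤ ·) := by
      rw [Multiset.le_iff_count]
      intro v
      rw [Multiset.count_add, Multiset.count_filter, Multiset.count_filter,
        Multiset.count_singleton]
      rcases lt_trichotomy v (val chY k y') with h | h | h
      · simp [h.not_ge, h.ne]
      · subst h; simpa using hxy
      · simp [h.le, h.ne', ht v h]
    have hx' : val (prodChildren chZ chX) (k + 1) (z, x) =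
        mk ((V ×ˢ s).map fun p => Value.prod k p.1 p.2) := by
      rw [val_prod, Value.prod, val_succ, val_succ, out_mk, out_mk]
    have hy'' : val (prodChildren chZ chY) (k + 1) (z, y) =
        mk ((V ×ˢ r).map fun p => Value.prod k p.1 p.2) := by
      rw [val_prod, Value.prod, val_succ, val_succ, out_mk, out_mk]
    -- By `hsmall`, factors of `s` below the value of `y'` contribute nothing from `w` on. So the
    -- surplus copy survives multiplication, and paired with `c₂` it counts at `w` itself.
    have hkey : ∀ u, w ≤ u → ((V ×ˢ s).map fun p => Value.prod k p.1 p.2).count u +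
        ((V ×ˢ {val chY k y'}).map fun p => Value.prod k p.1 p.2).count u ≤
        ((V ×ˢ r).map fun p => Value.prod k p.1 p.2).count u := by
      intro u hu
      have h0 : ((V ×ˢ s.filter (¬ val chY k y' ≤ ·)).map fun p => Value.prod k p.1 p.2).count u
          = 0 := by
        rw [Multiset.count_eq_zero]
        intro hmem
        obtain ⟨⟨a, b⟩, hab, rfl⟩ := Multiset.mem_map.1 hmem
        obtain ⟨ha, hb⟩ := Multiset.mem_product.1 hab
        obtain ⟨hb, hb'⟩ := Multiset.mem_filter.1 hb
        obtain ⟨c, hc, rfl⟩ := Multiset.mem_map.1 ha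
        obtain ⟨d, hd, rfl⟩ := Multiset.mem_map.1 hb
        have := hsmall d hd (not_le.1 hb') c hc
        rw [val_prod] at this
        exact absurd hu (not_le.2 this)
      rw [hsplit s, Multiset.product_add, Multiset.map_add, Multiset.count_add, h0, add_zero,
        ← Multiset.count_add, ← Multiset.map_add, ← Multiset.product_add]
      obtain ⟨q, hq⟩ := Multiset.le_iff_exists_add.1 (hle.trans (Multiset.filter_le _ r))
      rw [hq, Multiset.product_add (V) _ q, Multiset.map_add, Multiset.count_add]
      exact Nat.le_add_right _ _
    rw [hx', hy'']
    refine mk_lt_mk_of_count w (fun u hu => (Nat.le_add_right _ _).trans (hkey u hu))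
      (lt_of_lt_of_le ?_ (hkey w le_rfl))
    refine Nat.lt_add_of_pos_right (Multiset.count_pos.2 (Multiset.mem_map.2
      ⟨(val chZ k c₂, val chY k y'), Multiset.mem_product.2
        ⟨Multiset.mem_map_of_mem _ hc₂, Multiset.mem_singleton_self _⟩, ?_⟩))
    rw [hw, val_prod]

theorem hasHeight_iff_of_val_eq {X Y : Type*} {ch : X → Finset X} {ch' : Y → Finset Y} {j k : ℕ}
    (hjk : j ≤ k) {x : X} {y : Y} (h : val ch k x = val ch' k y) :
    HasHeight ch j x ↔ HasHeight ch' j y :=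
  ⟨.of_val_le hjk h.le, .of_val_le hjk h.ge⟩

/-- Multiplication by a node of full height reflects and preserves the order. -/
theorem val_prod_le_iff {X Y Z : Type*} {chX : X → Finset X} {chY : Y → Finset Y}
    {chZ : Z → Finset Z} {k : ℕ} {x : X} {y : Y} {z : Z} (hz : HasHeight chZ k z) :
    val (prodChildren chZ chX) k (z, x) ≤ val (prodChildren chZ chY) k (z, y) ↔
      val chX k x ≤ val chY k y := by
  constructor
  · intro h
    by_contra hlt
    exact absurd h (not_le.2 (val_prod_lt k (not_le.1 hlt) fun j hj _ => hz.of_le hj))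
  · intro h
    rcases h.lt_or_eq with h | h
    · exact (val_prod_lt k h fun j hj _ => hz.of_le hj).le
    · rw [val_prod, val_prod, h]

theorem val_eq_of_val_prod_eq {X Y Z : Type*} {chX : X → Finset X} {chY : Y → Finset Y}
    {chZ : Z → Finset Z} {k : ℕ} {x : X} {y : Y} {z : Z} (hz : HasHeight chZ k z)
    (h : val (prodChildren chZ chX) k (z, x) = val (prodChildren chZ chY) k (z, y)) :
    val chX k x = val chY k y :=
  le_antisymm ((val_prod_le_iff hz).1 h.le) ((val_prod_le_iff hz).1 h.ge)

theorem Finset.exists_matching {X Y V : Type*} [Nonempty Y] [DecidableEq X] [DecidableEq Y]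
    (f : X → V) (g : Y → V) (s : Finset X) : ∀ t : Finset Y, s.val.map f = t.val.map g →
    ∃ μ : X → Y, (∀ c ∈ s, μ c ∈ t ∧ f c = g (μ c)) ∧ Set.InjOn μ s := by
  induction s using Finset.induction_on with
  | empty => intro t _; exact ⟨fun _ => Classical.arbitrary Y, by simp, by simp⟩
  | insert a s ha ih =>
    intro t h
    rw [Finset.insert_val_of_notMem ha, Multiset.map_cons] at h
    obtain ⟨b, hb, hab⟩ := Multiset.mem_map.1 (h ▸ Multiset.mem_cons_self _ _ : f a ∈ t.val.map g)
    have hb' : b ∈ t := hb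
    obtain ⟨μ, h₁, h₂⟩ := ih (t.erase b) (by
      rw [← Finset.insert_erase hb', Finset.insert_val_of_notMem (Finset.notMem_erase b t),
        Multiset.map_cons, hab] at h
      exact (Multiset.cons_inj_right _).1 h)
    refine ⟨Function.update μ a b, fun c hc => ?_, ?_⟩
    · by_cases hca : c = a
      · subst hca; simp [hb', hab]
      · have := h₁ c ((Finset.mem_insert.1 hc).resolve_left hca)
        simpa [hca] using ⟨Finset.mem_of_mem_erase this.1, this.2⟩
    · intro c hc d hd hcd
      by_cases hca : c = a <;> by_cases hda : d = a
      · rw [hca, hda]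
      · have := h₁ d ((Finset.mem_insert.1 hd).resolve_left hda)
        rw [hca] at hcd
        simp only [Function.update_self, Function.update_of_ne hda] at hcd
        exact absurd hcd.symm (Finset.ne_of_mem_erase this.1)
      · have := h₁ c ((Finset.mem_insert.1 hc).resolve_left hca)
        rw [hda] at hcd
        simp only [Function.update_self, Function.update_of_ne hca] at hcd
        exact absurd hcd (Finset.ne_of_mem_erase this.1)
      · simp only [Function.update_of_ne hca, Function.update_of_ne hda] at hcd
        exact h₂ ((Finset.mem_insert.1 hc).resolve_left hca)
          ((Finset.mem_insert.1 hd).resolve_left hda) hcd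

/-! ### Roots of dendrons, reconstruction from values, and cancellation -/

namespace FDS

/-- The states with image `x`. -/
noncomputable def children (A : FDS) (x : A.State) : Finset A.State :=
  haveI := A.finite
  (Set.toFinite {y | A.step y = x}).toFinset

@[simp] theorem mem_children {A : FDS} {x y : A.State} : y ∈ A.children x ↔ A.step y = x := by
  simp [children]

theorem children_mul (A B : FDS) : (A * B).children = prodChildren A.children B.children := by
  funext p
  ext q
  rw [mem_children]
  change _ ↔ q ∈ A.children p.1 ×ˢ B.children p.2
  rw [Finset.mem_product, mem_children, mem_children]
  exact Prod.ext_iff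

/-- A fixpoint that is reached from everywhere. -/
structure IsRoot (A : FDS) (r : A.State) : Prop where
  step_eq : A.step r = r
  exists_iterate : ∀ x, ∃ k, A.step^[k] x = r

/-- Induction along a walk to the fixpoint: an edge along its arrow adds one iteration, an edge
against its arrow removes one, unless the fixpoint is already reached. -/
theorem IsDendron.exists_isRoot {A : FDS} (h : A.IsDendron) : ∃ r, A.IsRoot r := by
  obtain ⟨hc, r, hr⟩ := h
  refine ⟨r, hr, fun x => ?_⟩
  obtain ⟨w⟩ := hc.preconnected x r
  induction w with
  | nil => exact ⟨0, rfl⟩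
  | @cons u v r huv _ ih =>
    obtain ⟨k, hk⟩ := ih hr
    rcases ((SimpleGraph.fromRel_adj _ _ _).1 huv).2 with h | h
    · exact ⟨k + 1, by rw [Function.iterate_succ_apply, ← h, hk]⟩
    · cases k with
      | zero =>
        refine ⟨0, ?_⟩
        simp only [Function.iterate_zero, id_eq] at hk ⊢
        rw [h, hk, hr]
      | succ k => exact ⟨k, by rw [Function.iterate_succ_apply, ← h] at hk; exact hk⟩

theorem IsRoot.isDendron {A : FDS} {r : A.State} (h : A.IsRoot r) : A.IsDendron := by
  refine ⟨?_, r, h.step_eq⟩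
  have key : ∀ k x, A.step^[k] x = r → A.graph.Reachable x r := by
    intro k
    induction k with
    | zero => rintro x rfl; exact .refl _
    | succ k ih =>
      intro x hx
      by_cases hxx : x = A.step x
      · exact ih x (by rw [Function.iterate_succ_apply, ← hxx] at hx; exact hx)
      · exact (SimpleGraph.Adj.reachable ((SimpleGraph.fromRel_adj _ _ _).2 ⟨hxx, .inl rfl⟩)).trans
          (ih _ hx)
  exact
    { preconnected := fun x y =>
        ((h.exists_iterate x).elim fun k hk => key k x hk).trans
          ((h.exists_iterate y).elim fun k hk => key k y hk).symm
      nonempty := ⟨r⟩ }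

theorem IsRoot.iterate_root {A : FDS} {r : A.State} (h : A.IsRoot r) (k : ℕ) :
    A.step^[k] r = r :=
  Function.iterate_fixed h.step_eq k

theorem IsRoot.iterate_of_le {A : FDS} {r : A.State} (h : A.IsRoot r) {j k : ℕ} (hjk : j ≤ k)
    {x : A.State} (hx : A.step^[j] x = r) : A.step^[k] x = r := by
  obtain ⟨i, rfl⟩ := Nat.exists_eq_add_of_le hjk
  rw [add_comm, Function.iterate_add_apply, hx, h.iterate_root]

theorem IsRoot.eq_of_step_eq {A : FDS} {r : A.State} (h : A.IsRoot r) {x : A.State}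
    (hx : A.step x = x) : x = r := by
  obtain ⟨k, hk⟩ := h.exists_iterate x
  rw [← hk, Function.iterate_fixed hx]

theorem IsRoot.iterate_card {A : FDS} {r : A.State} (h : A.IsRoot r) {k : ℕ}
    (hk : Nat.card A.State ≤ k) (x : A.State) : A.step^[k] x = r := by
  classical
  have := A.finite
  by_contra hne
  have hinj : Function.Injective fun i : Fin (k + 1) => A.step^[i] x := by
    have key : ∀ i j : ℕ, i < j → j ≤ k → A.step^[i] x ≠ A.step^[j] x := by
      intro i j hij hj he
      -- A repetition makes the orbit periodic from time `i` on; as the orbit ends in the root, it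
      -- is there already at time `i`.
      have hper : ∀ n, A.step^[i + n * (j - i)] x = A.step^[i] x := by
        intro n
        induction n with
        | zero => simp
        | succ n ih =>
          have : i + (n + 1) * (j - i) = (j - i) + (i + n * (j - i)) := by ring
          rw [this, Function.iterate_add_apply, ih, ← Function.iterate_add_apply,
            Nat.sub_add_cancel hij.le, ← he]
      obtain ⟨l, hl⟩ := h.exists_iterate x
      have h1 := hper l
      rw [h.iterate_of_le (by nlinarith [Nat.sub_pos_of_lt hij] : l ≤ i + l * (j - i)) hl] at h1
      exact hne (h.iterate_of_le (by omega : i ≤ k) h1.symm)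
    intro i j hij
    rcases lt_trichotomy i j with h | h | h
    · exact absurd hij (key i j h (by omega))
    · exact h
    · exact absurd hij.symm (key j i h (by omega))
  have := Nat.card_le_card_of_injective _ hinj
  rw [Nat.card_eq_fintype_card, Fintype.card_fin] at this
  omega

theorem hasHeight_children {A : FDS} {j : ℕ} {x : A.State} :
    HasHeight A.children j x ↔ ∃ y, A.step^[j] y = x := by
  induction j generalizing x with
  | zero => simp [HasHeight]
  | succ j ih =>
    simp only [HasHeight, mem_children, ih, Function.iterate_succ_apply']
    constructor
    · rintro ⟨c, hc, y, rfl⟩; exact ⟨y, hc⟩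
    · rintro ⟨y, hy⟩; exact ⟨_, hy, y, rfl⟩

theorem IsRoot.hasHeight {A : FDS} {r : A.State} (h : A.IsRoot r) (j : ℕ) :
    HasHeight A.children j r :=
  hasHeight_children.2 ⟨r, h.iterate_root j⟩

/-- The root has every height, by its loop, while any other state lacks the height `Nat.card
A.State`. Thus heights single out the root, and later the unrolled loop among the branches. -/
theorem IsRoot.not_hasHeight {A : FDS} {r : A.State} (h : A.IsRoot r) {j : ℕ}
    (hj : Nat.card A.State ≤ j) {x : A.State} (hx : x ≠ r) : ¬ HasHeight A.children j x := by
  rw [hasHeight_children]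
  rintro ⟨y, rfl⟩
  exact hx (h.iterate_card hj y)

theorem IsRoot.mul {A B : FDS} {r : A.State} {q : B.State} (hA : A.IsRoot r) (hB : B.IsRoot q) :
    (A * B).IsRoot (r, q) := by
  refine ⟨Prod.ext hA.step_eq hB.step_eq, fun x => ?_⟩
  have key : ∀ k, (A * B).step^[k] x = (A.step^[k] x.1, B.step^[k] x.2) := by
    intro k
    induction k with
    | zero => rfl
    | succ k ih =>
      rw [Function.iterate_succ_apply', Function.iterate_succ_apply', Function.iterate_succ_apply',
        ih]
      rfl
  obtain ⟨i, hi⟩ := hA.exists_iterate x.1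
  obtain ⟨j, hj⟩ := hB.exists_iterate x.2
  exact ⟨max i j, by
    rw [key, hA.iterate_of_le (le_max_left i j) hi, hB.iterate_of_le (le_max_right i j) hj]⟩

theorem val_iso {A B : FDS} (e : A.State ≃ B.State) (he : ∀ x, e (A.step x) = B.step (e x))
    (k : ℕ) (x : A.State) : val B.children k (e x) = val A.children k x := by
  classical
  refine val_map (φ := e) Set.univ (fun _ _ _ _ => trivial) e.injective.injOn
    (fun x _ => ?_) k x trivial
  ext y
  rw [mem_children, Finset.mem_image]
  constructor
  · intro hy
    refine ⟨e.symm y, mem_children.2 (e.injective ?_), e.apply_symm_apply y⟩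
    rw [he, e.apply_symm_apply, hy]
  · rintro ⟨c, hc, rfl⟩
    rw [← he, mem_children.1 hc]

theorem IsRoot.iso {A B : FDS} {r : A.State} (h : A.IsRoot r) (e : A.State ≃ B.State)
    (he : ∀ x, e (A.step x) = B.step (e x)) : B.IsRoot (e r) := by
  refine ⟨by rw [← he, h.step_eq], fun x => ?_⟩
  obtain ⟨k, hk⟩ := h.exists_iterate (e.symm x)
  refine ⟨k, ?_⟩
  rw [← hk, ← e.apply_symm_apply x, e.symm_apply_apply]
  exact ((Function.Semiconj.iterate_right (fun x => he x) k) _).symm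

theorem Iso.card_eq {A B : FDS} : A.Iso B → Nat.card A.State = Nat.card B.State := by
  rintro ⟨e, -⟩
  exact Nat.card_congr e

theorem card_mul (A B : FDS) :
    Nat.card (A * B).State = Nat.card A.State * Nat.card B.State :=
  Nat.card_prod A.State B.State

theorem IsRoot.unique {A : FDS} {r q : A.State} (h : A.IsRoot r) (h' : A.IsRoot q) : q = r :=
  h.eq_of_step_eq h'.step_eq

/-- Isomorphic dendrons have roots of the same value. -/
theorem Iso.val_root {A B : FDS} {r : A.State} {q : B.State} (hA : A.IsRoot r) (hB : B.IsRoot q)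
    (h : A.Iso B) (k : ℕ) : val A.children k r = val B.children k q := by
  obtain ⟨e, he⟩ := h
  rw [hB.unique (hA.iso e he) |>.symm, val_iso e he]

/-- Matching of the children of two nodes of equal value, other than the nodes themselves. -/
theorem exists_matching_children {A B : FDS} {r : A.State} {q : B.State} (hA : A.IsRoot r)
    (hB : B.IsRoot q) {k : ℕ} {x : A.State} {y : B.State} (hxy : x = r ↔ y = q)
    (h : val A.children (k + 1) x = val B.children (k + 1) y) :
    ∃ μ : A.State → B.State, (∀ c, A.step c = x → c ≠ x → B.step (μ c) = y ∧ μ c ≠ y ∧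
      val A.children k c = val B.children k (μ c)) ∧
      ∀ c d, A.step c = x → c ≠ x → A.step d = x → d ≠ x → μ c = μ d → c = d := by
  classical
  have : Nonempty B.State := ⟨q⟩
  obtain ⟨μ, h₁, h₂⟩ := Finset.exists_matching (val A.children k) (val B.children k)
    ((A.children x).erase x) ((B.children y).erase y) (by
      have h0 := Value.mk_injective h
      by_cases hx : x = r
      · have hy := hxy.1 hx
        have hx' : x ∈ A.children x := mem_children.2 (by rw [hx, hA.step_eq])
        have hy' : y ∈ B.children y := mem_children.2 (by rw [hy, hB.step_eq])
        rw [Finset.erase_val, Finset.erase_val, Multiset.map_erase_of_mem _ _ hx',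
          Multiset.map_erase_of_mem _ _ hy', h0, val_eq_of_val_succ_eq h]
      · rw [Finset.erase_eq_of_notMem, Finset.erase_eq_of_notMem, h0]
        · exact fun hy => hx (hxy.2 (hB.eq_of_step_eq (mem_children.1 hy)))
        · exact fun hy => hx (hA.eq_of_step_eq (mem_children.1 hy)))
  have hmem : ∀ c, A.step c = x → c ≠ x → c ∈ (A.children x).erase x :=
    fun c hc hcx => Finset.mem_erase.2 ⟨hcx, mem_children.2 hc⟩
  refine ⟨μ, fun c hc hcx => ?_, fun c d hc hcx hd hdx hcd =>
    h₂ (hmem c hc hcx) (hmem d hd hdx) hcd⟩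
  obtain ⟨h₃, h₄⟩ := h₁ c (hmem c hc hcx)
  exact ⟨mem_children.1 (Finset.mem_of_mem_erase h₃), Finset.ne_of_mem_erase h₃, h₄⟩

/-- The embedding grows outwards from the root. Passing from distance `d` to `d + 1` matches the
preimages of the states already treated, which uses up one level of the values. Loops are left out
of the matching, since the root already has its image. -/
theorem exists_partial_embedding {A B : FDS} {r : A.State} {q : B.State} (hA : A.IsRoot r)
    (hB : B.IsRoot q) {N : ℕ} (h : val A.children N r = val B.children N q) (d : ℕ) :
    d ≤ N → ∃ Φ : A.State → B.State, Φ r = q ∧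
      (∀ x, A.step^[d] x = r → val A.children (N - d) x = val B.children (N - d) (Φ x)) ∧
      (∀ x, A.step^[d] x = r → Φ (A.step x) = B.step (Φ x)) ∧
      Set.InjOn Φ {x | A.step^[d] x = r} := by
  classical
  induction d with
  | zero =>
    intro _
    refine ⟨fun _ => q, rfl, ?_, ?_, ?_⟩
    · rintro x rfl; exact h
    · rintro x -; exact hB.step_eq.symm
    · rintro x rfl y hy -; exact hy.symm
  | succ d ih =>
    intro hd
    obtain ⟨Φ, h₀, h₁, h₂, h₃⟩ := ih (by omega)
    obtain ⟨k, hk⟩ : ∃ k, N - d = k + 1 := ⟨N - d - 1, by omega⟩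
    have hk' : N - (d + 1) = k := by omega
    rw [hk] at h₁
    have hroot : ∀ x, A.step^[d] x = r → (x = r ↔ Φ x = q) := fun x hx =>
      ⟨fun hxr => by rw [hxr, h₀], fun hxq => h₃ hx (hA.iterate_root d) (hxq.trans h₀.symm)⟩
    have hμ : ∀ x, ∃ μ : A.State → B.State, A.step^[d] x = r →
        (∀ c, A.step c = x → c ≠ x → B.step (μ c) = Φ x ∧ μ c ≠ Φ x ∧
        val A.children k c = val B.children k (μ c)) ∧
        ∀ c d, A.step c = x → c ≠ x → A.step d = x → d ≠ x → μ c = μ d → c = d := by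
      intro x
      by_cases hx : A.step^[d] x = r
      · obtain ⟨μ, hμ⟩ := exists_matching_children hA hB (hroot x hx) (h₁ x hx)
        exact ⟨μ, fun _ => hμ⟩
      · exact ⟨Φ, fun hx' => absurd hx' hx⟩
    choose μ hμ using hμ
    have hstep : ∀ x, A.step^[d + 1] x = r → A.step^[d] (A.step x) = r := fun x hx => hx
    have hne : ∀ x, ¬ A.step^[d] x = r → x ≠ A.step x := fun x hx hxx =>
      hx (by rw [hA.eq_of_step_eq hxx.symm, hA.iterate_root])
    refine ⟨fun x => if A.step^[d] x = r then Φ x else μ (A.step x) x, ?_, ?_, ?_, ?_⟩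
    · simp [hA.iterate_root, h₀]
    · intro x hx
      rw [hk']
      by_cases hxd : A.step^[d] x = r
      · simp only [hxd, if_true]
        exact val_eq_of_val_succ_eq (h₁ x hxd)
      · simp only [hxd, if_false]
        exact ((hμ _ (hstep x hx)).1 x rfl (hne x hxd)).2.2
    · intro x hx
      have hs : A.step^[d] (A.step x) = r := hx
      simp only [hs, if_true]
      by_cases hxd : A.step^[d] x = r
      · simp only [hxd, if_true]
        exact h₂ x hxd
      · simp only [hxd, if_false]
        exact ((hμ _ hs).1 x rfl (hne x hxd)).1.symm
    -- If a new state `x` and an old state `y` had the same image, injectivity would give `A.step x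
    -- = A.step y`. Then either `y` is the root, and the matching avoids its image, or `x` is as
    -- close to the root as `y`.
    · have mixed : ∀ x y, A.step^[d + 1] x = r → ¬ A.step^[d] x = r → A.step^[d] y = r →
          μ (A.step x) x ≠ Φ y := by
        intro x y hx hxd hyd he
        obtain ⟨g₁, g₂, -⟩ := (hμ _ (hstep x hx)).1 x rfl (hne x hxd)
        rw [he, ← h₂ y hyd] at g₁
        have hyd' : A.step^[d] (A.step y) = r :=
          (Function.iterate_succ_apply _ _ _).symm.trans (hA.iterate_of_le (Nat.le_succ d) hyd)
        have hxy := h₃ hyd' (hstep x hx) g₁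
        by_cases hyr : y = r
        · rw [he, ← hxy, hyr, hA.step_eq] at g₂
          exact g₂ rfl
        · cases d with
          | zero => exact hyr hyd
          | succ d =>
            rw [Function.iterate_succ_apply, hxy, ← Function.iterate_succ_apply] at hyd
            exact hxd hyd
      intro x hx y hy hxy
      simp only at hxy
      by_cases hxd : A.step^[d] x = r <;> by_cases hyd : A.step^[d] y = r
      · simp only [hxd, hyd, if_true] at hxy
        exact h₃ hxd hyd hxy
      · simp only [hxd, hyd, if_true, if_false] at hxy
        exact absurd hxy.symm (mixed y x hy hyd hxd)
      · simp only [hxd, hyd, if_true, if_false] at hxy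
        exact absurd hxy (mixed x y hx hxd hyd)
      · simp only [hxd, hyd, if_false] at hxy
        have g₁ := ((hμ _ (hstep x hx)).1 x rfl (hne x hxd)).1
        have g₂ := ((hμ _ (hstep y hy)).1 y rfl (hne y hyd)).1
        have : A.step x = A.step y := h₃ (hstep x hx) (hstep y hy) (by rw [← g₁, ← g₂, hxy])
        rw [← this] at hxy
        exact (hμ _ (hstep x hx)).2 x y rfl (hne x hxd) this.symm
          (by rw [this]; exact hne y hyd) hxy

/-- Dendrons are determined by the values of their roots. -/
theorem iso_of_val_eq {A B : FDS} {r : A.State} {q : B.State} (hA : A.IsRoot r)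
    (hB : B.IsRoot q) {N : ℕ} (hNA : ∀ x, A.step^[N] x = r) (hNB : ∀ x, B.step^[N] x = q)
    (h : val A.children N r = val B.children N q) : A.Iso B := by
  have := A.finite
  have := B.finite
  obtain ⟨Φ, -, -, h₂, h₃⟩ := exists_partial_embedding hA hB h N le_rfl
  obtain ⟨Ψ, -, -, -, g₃⟩ := exists_partial_embedding hB hA h.symm N le_rfl
  have hΦ : Function.Injective Φ := fun x y hxy => h₃ (hNA x) (hNA y) hxy
  have hΨ : Function.Injective Ψ := fun x y hxy => g₃ (hNB x) (hNB y) hxy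
  exact ⟨Equiv.ofBijective Φ (hΦ.bijective_of_nat_card_le (Nat.card_le_card_of_injective Ψ hΨ)),
    fun x => h₂ x (hNA x)⟩

/-- Cancellation of dendrons. -/
theorem iso_of_mul_iso_mul {A B C D : FDS} (hA : A.IsDendron) (hB : B.IsDendron)
    (hC : C.IsDendron) (hD : D.IsDendron) (h : A.Iso (B * C)) (h' : A.Iso (B * D)) : C.Iso D := by
  obtain ⟨a, ha⟩ := hA.exists_isRoot
  obtain ⟨b, hb⟩ := hB.exists_isRoot
  obtain ⟨c, hc⟩ := hC.exists_isRoot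
  obtain ⟨d, hd⟩ := hD.exists_isRoot
  have h₁ := h.val_root ha (hb.mul hc) (max (Nat.card C.State) (Nat.card D.State))
  have h₂ := h'.val_root ha (hb.mul hd) (max (Nat.card C.State) (Nat.card D.State))
  rw [children_mul] at h₁ h₂
  exact iso_of_val_eq hc hd (hc.iterate_card (le_max_left _ _))
    (hd.iterate_card (le_max_right _ _))
    (val_eq_of_val_prod_eq (hb.hasHeight _) (h₁.symm.trans h₂))

end FDS

/-! ### Trees in depth-first order -/

/-- Children in the graph on `0, …, n - 1` with an arrow from `i` to `f i` if `f i < n`. -/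
def tableChildren (n : ℕ) (f : ℕ → ℕ) (x : ℕ) : Finset ℕ :=
  (Finset.range n).filter fun i => f i = x

/-- Children in the tree on `0, …, n - 1` with root `0`, where `f i` is the parent of `i > 0`. -/
def treeChildren (n : ℕ) (f : ℕ → ℕ) (x : ℕ) : Finset ℕ :=
  (Finset.range n).filter fun i => 0 < i ∧ f i = x

theorem mem_tableChildren {n : ℕ} {f : ℕ → ℕ} {x i : ℕ} :
    i ∈ tableChildren n f x ↔ i < n ∧ f i = x := by
  simp [tableChildren]

theorem mem_treeChildren {n : ℕ} {f : ℕ → ℕ} {x i : ℕ} :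
    i ∈ treeChildren n f x ↔ i < n ∧ 0 < i ∧ f i = x := by
  simp [treeChildren]

/-- Upper counts grow when there are more children, each of no smaller value. The set `S` is there
because the inclusion will be available only on parts of a tree whose subtrees are already complete.
-/
theorem val_mono {X : Type*} {ch ch' : X → Finset X} (S : Set X)
    (hS : ∀ x ∈ S, ∀ c ∈ ch x, c ∈ S) (h : ∀ x ∈ S, ch x ⊆ ch' x) (k : ℕ) :
    ∀ x ∈ S, val ch k x ≤ val ch' k x := by
  induction k with
  | zero => intros; exact le_rfl
  | succ k ih =>
    intro x hx
    refine Value.mk_le_mk_of_countP_le fun u => ?_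
    rw [countP_map_val, countP_map_val]
    refine Finset.card_le_card fun c hc => ?_
    obtain ⟨hc, hu⟩ := Finset.mem_filter.1 hc
    exact Finset.mem_filter.2 ⟨h x hx hc, hu.trans (ih c (hS x hx c hc))⟩

/-- A tree of depth at most `N` whose nodes are listed in depth-first order, the children of each
node in decreasing order of their values. -/
structure IsDFS (N L : ℕ) (f dep : ℕ → ℕ) : Prop where
  pos : 0 < L
  lt : ∀ i, 0 < i → i < L → f i < i
  -- Together with `lt`, this says that all nodes listed between `f j` and `j` are descendants of `f
  -- j`.
  nested : ∀ i j, f j < i → i < j → j < L → f j ≤ f i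
  dep_zero : dep 0 = 0
  dep_succ : ∀ i, 0 < i → i < L → dep i = dep (f i) + 1
  dep_le : ∀ i < L, dep i ≤ N
  sorted : ∀ i j, 0 < i → i < j → j < L → f i = f j →
    val (treeChildren L f) (N - dep i) j ≤ val (treeChildren L f) (N - dep i) i

theorem val_treeChildren_mono {M L : ℕ} {f : ℕ → ℕ} (hL : L ≤ M)
    (k x : ℕ) : val (treeChildren L f) k x ≤ val (treeChildren M f) k x := by
  refine val_mono Set.univ (fun _ _ _ _ => trivial) (fun x _ c hc => ?_) k x trivial
  rw [mem_treeChildren] at hc ⊢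
  exact ⟨by omega, hc.2⟩

/-- Adding a node to an initial segment of a tree in depth-first order as a child of a later node
than the right one gives a greater tree. -/
theorem IsDFS.val_lt_extend {N M L p : ℕ} {f dep : ℕ → ℕ} (h : IsDFS N M f dep)
    (hLM : L ≤ M) (hp : p < L) (hdep : dep p < N) (hpL : L < M → f L < p) :
    val (treeChildren M f) N 0 < val (treeChildren (L + 1) (Function.update f L p)) N 0 := by
  set ch := treeChildren M f with hch
  set ch' := treeChildren (L + 1) (Function.update f L p) with hch'
  have hsub : ∀ c x, c ∈ ch x → c < L → c ∈ ch' x := by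
    intro c x hc hcL
    rw [hch, mem_treeChildren] at hc
    rw [hch', mem_treeChildren]
    exact ⟨by omega, hc.2.1, by rw [Function.update_of_ne hcL.ne, hc.2.2]⟩
  have hclosed : ∀ S : Set ℕ, (∀ x ∈ S, ∀ c ∈ ch x, c ∈ S) → (∀ x ∈ S, x < L) →
      ∀ k, ∀ x ∈ S, val ch k x ≤ val ch' k x := fun S hS hSL k =>
    val_mono S hS (fun x hx c hc => hsub c x hc (hSL c (hS x hx c hc))) k
  -- the node `p`
  have hbase : val ch (N - dep p) p < val ch' (N - dep p) p := by
    obtain ⟨k, hk⟩ : ∃ k, N - dep p = k + 1 := ⟨N - dep p - 1, by omega⟩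
    rw [hk, val_succ, val_succ]
    -- The subtree of a node between `f L` and `L` is complete before `L` is listed: a child listed
    -- after `L` would violate `nested`.
    have hS : ∀ x ∈ {z | z < L ∧ (L < M → f L < z)}, ∀ c ∈ ch x,
        c ∈ {z | z < L ∧ (L < M → f L < z)} := by
      rintro x ⟨hx, hx'⟩ c hc
      rw [hch, mem_treeChildren] at hc
      obtain ⟨hc₁, hc₂, hc₃⟩ := hc
      have h1 := h.lt c hc₂ hc₁
      have hcL : c < L := by
        by_contra hcL
        rcases (not_lt.1 hcL).lt_or_eq with h2 | h2
        · have := h.nested L c (by omega) h2 hc₁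
          have := hx' (by omega)
          omega
        · subst h2
          have := hx' hc₁
          omega
      exact ⟨hcL, fun hL => by have := hx' hL; omega⟩
    have hle := hclosed _ hS (fun x hx => hx.1) k
    have hpS : p ∈ {z | z < L ∧ (L < M → f L < z)} := ⟨hp, hpL⟩
    have hLmem : L ∈ ch' p := by
      rw [hch', mem_treeChildren]
      exact ⟨by omega, by omega, by simp⟩
    have hsubset : ∀ u, (ch p).filter (fun c => u ≤ val ch k c) ⊆
        (ch' p).filter (fun c => u ≤ val ch' k c) := by
      intro u c hc
      obtain ⟨hc, hu⟩ := Finset.mem_filter.1 hc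
      have := hS p hpS c hc
      exact Finset.mem_filter.2 ⟨hsub c p hc this.1, hu.trans (hle c this)⟩
    refine Value.mk_lt_mk_of_countP (val ch' k L) (fun u _ => ?_) ?_
    · rw [countP_map_val, countP_map_val]
      exact Finset.card_le_card (hsubset u)
    · rw [countP_map_val, countP_map_val]
      refine Finset.card_lt_card ((Finset.ssubset_iff_of_subset (hsubset _)).2
        ⟨L, Finset.mem_filter.2 ⟨hLmem, le_rfl⟩, fun hc => ?_⟩)
      exact absurd (hS p hpS L (Finset.mem_filter.1 hc).1).1 (lt_irrefl _)
  -- from a node to its parent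
  have hstep : ∀ y, 0 < y → y < L → val ch (N - dep y) y < val ch' (N - dep y) y →
      val ch (N - dep (f y)) (f y) < val ch' (N - dep (f y)) (f y) := by
    intro y hy hyL hlt
    have hyM : y < M := by omega
    have hd := h.dep_succ y hy hyM
    have hd' := h.dep_le y hyM
    obtain ⟨k, hk⟩ : ∃ k, N - dep y = k := ⟨_, rfl⟩
    have hk' : N - dep (f y) = k + 1 := by omega
    rw [hk', val_succ, val_succ]
    rw [hk] at hlt
    have hym : y ∈ ch (f y) := by
      rw [hch, mem_treeChildren]; exact ⟨hyM, hy, rfl⟩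
    -- Only thresholds from the new value of `y` upwards matter. Siblings before `y` have complete
    -- subtrees and lose nothing. Siblings after `y` have at most the old value of `y`, by
    -- sortedness, and so lie below every such threshold.
    have hsubset : ∀ u, val ch' k y ≤ u → (ch (f y)).filter (fun c => u ≤ val ch k c) ⊆
        (ch' (f y)).filter (fun c => u ≤ val ch' k c) := by
      intro u hu c hc
      obtain ⟨hc, huc⟩ := Finset.mem_filter.1 hc
      have hc' := hc
      rw [hch, mem_treeChildren] at hc'
      obtain ⟨hc₁, hc₂, hc₃⟩ := hc'
      rcases lt_trichotomy c y with hcy | hcy | hcy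
      · refine Finset.mem_filter.2 ⟨hsub c _ hc (by omega), huc.trans ?_⟩
        refine hclosed {z | c ≤ z ∧ z < y} ?_ (fun x hx => hx.2.trans hyL) k c ⟨le_rfl, hcy⟩
        rintro x ⟨hx, hxy⟩ z hz
        rw [hch, mem_treeChildren] at hz
        obtain ⟨hz₁, hz₂, hz₃⟩ := hz
        have h1 := h.lt z hz₂ hz₁
        have h2 := h.lt c hc₂ hc₁
        refine ⟨by omega, ?_⟩
        by_contra hzy
        rcases (not_lt.1 hzy).lt_or_eq with h3 | h3
        · have := h.nested y z (by omega) h3 hz₁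
          omega
        · subst h3; omega
      · subst hcy
        exact absurd (hlt.trans_le hu) (not_lt.2 huc)
      · have := h.sorted y c hy hcy hc₁ hc₃.symm
        rw [hk] at this
        exact absurd ((this.trans_lt hlt).trans_le hu) (not_lt.2 huc)
    refine Value.mk_lt_mk_of_countP (val ch' k y) (fun u hu => ?_) ?_
    · rw [countP_map_val, countP_map_val]
      exact Finset.card_le_card (hsubset u hu)
    · rw [countP_map_val, countP_map_val]
      refine Finset.card_lt_card ((Finset.ssubset_iff_of_subset (hsubset _ le_rfl)).2
        ⟨y, Finset.mem_filter.2 ⟨hsub y _ hym hyL, le_rfl⟩, fun hc => ?_⟩)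
      exact absurd (Finset.mem_filter.1 hc).2 (not_le.2 hlt)
  have hall : ∀ y, y < L → val ch (N - dep y) y < val ch' (N - dep y) y →
      val ch N 0 < val ch' N 0 := by
    intro y
    induction y using Nat.strong_induction_on with
    | _ y ih =>
      intro hyL hlt
      rcases Nat.eq_zero_or_pos y with rfl | hy
      · rwa [h.dep_zero, Nat.sub_zero] at hlt
      · have := h.lt y hy (by omega)
        exact ih (f y) this (by omega) (hstep y hy hyL hlt)
  exact hall p hp hbase

/-! ### Grafting trees, and unrolling a system into a tree -/

/-- Attach a tree as the last child of the root. -/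
def graft (L : ℕ) (f g : ℕ → ℕ) (i : ℕ) : ℕ :=
  if i < L then f i else if i = L then 0 else L + g (i - L)

/-- The depths in a grafted tree. -/
def graftDepth (L : ℕ) (d e : ℕ → ℕ) (i : ℕ) : ℕ :=
  if i < L then d i else e (i - L) + 1

section Graft

variable {N L L' : ℕ} {f g d e : ℕ → ℕ}

theorem graft_of_lt {i : ℕ} (hi : i < L) : graft L f g i = f i := by simp [graft, hi]

theorem graft_self : graft L f g L = 0 := by simp [graft]

theorem graft_add {i : ℕ} (hi : 0 < i) : graft L f g (L + i) = L + g i := by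
  simp [graft, hi.ne']

theorem graftDepth_of_lt {i : ℕ} (hi : i < L) : graftDepth L d e i = d i := by
  simp [graftDepth, hi]

theorem graftDepth_add {i : ℕ} : graftDepth L d e (L + i) = e i + 1 := by
  simp [graftDepth]

theorem IsDFS.parent_lt (hf : IsDFS N L f d) {i : ℕ} (hi : 0 < i) (hiL : i < L) : f i < L :=
  (hf.lt i hi hiL).trans hiL

theorem val_graft_old (k : ℕ) {i : ℕ}
    (hi : 0 < i) (hiL : i < L) :
    val (treeChildren (L + L') (graft L f g)) k i = val (treeChildren L f) k i := by
  refine val_map (φ := id) {z | 0 < z ∧ z < L} (fun x _ c hc => ?_) (Set.injOn_id _)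
    (fun x hx => ?_) k i ⟨hi, hiL⟩
  · rw [mem_treeChildren] at hc
    exact ⟨hc.2.1, hc.1⟩
  · obtain ⟨hx, hxL⟩ := hx
    ext c
    rw [Finset.image_id, mem_treeChildren, mem_treeChildren]
    constructor
    · rintro ⟨h₁, h₂, h₃⟩
      by_cases hcL : c < L
      · rw [graft_of_lt hcL] at h₃
        exact ⟨hcL, h₂, h₃⟩
      · exfalso
        obtain ⟨j, rfl⟩ := Nat.exists_eq_add_of_le (not_lt.1 hcL)
        rcases Nat.eq_zero_or_pos j with rfl | hj
        · rw [add_zero, graft_self] at h₃; simp at h₃; omega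
        · rw [graft_add hj] at h₃; simp at h₃; omega
    · rintro ⟨h₁, h₂, h₃⟩
      exact ⟨by omega, h₂, by rw [graft_of_lt h₁, h₃]; rfl⟩

theorem IsDFS.val_graft_new (hf : IsDFS N L f d) (k : ℕ) {i : ℕ}
    (hiL : i < L') :
    val (treeChildren (L + L') (graft L f g)) k (L + i) = val (treeChildren L' g) k i := by
  refine val_map (φ := fun i => L + i) {z | z < L'} (fun x _ c hc => ?_)
    (fun a _ b _ hab => by simpa using hab) (fun x hx => ?_) k i hiL
  · rw [mem_treeChildren] at hc
    exact hc.1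
  · ext c
    rw [Finset.mem_image, mem_treeChildren]
    have hL := hf.pos
    constructor
    · rintro ⟨h₁, h₂, h₃⟩
      by_cases hcL : c < L
      · have := hf.parent_lt h₂ hcL
        rw [graft_of_lt hcL] at h₃
        omega
      · obtain ⟨j, rfl⟩ := Nat.exists_eq_add_of_le (not_lt.1 hcL)
        rcases Nat.eq_zero_or_pos j with rfl | hj
        · rw [add_zero, graft_self] at h₃; omega
        · rw [graft_add hj] at h₃
          exact ⟨j, mem_treeChildren.2 ⟨by omega, hj, by omega⟩, rfl⟩
    · rintro ⟨j, hj, rfl⟩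
      obtain ⟨h₁, h₂, h₃⟩ := mem_treeChildren.1 hj
      exact ⟨by omega, by omega, by rw [graft_add h₂, h₃]⟩

theorem IsDFS.treeChildren_graft_zero {N' : ℕ} (hf : IsDFS N L f d) (hg : IsDFS N' L' g e) :
    treeChildren (L + L') (graft L f g) 0 = insert L (treeChildren L f 0) := by
  have hL := hf.pos
  have hL' := hg.pos
  ext c
  rw [Finset.mem_insert, mem_treeChildren, mem_treeChildren]
  constructor
  · rintro ⟨h₁, h₂, h₃⟩
    by_cases hcL : c < L
    · rw [graft_of_lt hcL] at h₃
      exact .inr ⟨hcL, h₂, h₃⟩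
    · obtain ⟨j, rfl⟩ := Nat.exists_eq_add_of_le (not_lt.1 hcL)
      rcases Nat.eq_zero_or_pos j with rfl | hj
      · exact .inl rfl
      · rw [graft_add hj] at h₃; omega
  · rintro (rfl | ⟨h₁, h₂, h₃⟩)
    · exact ⟨by omega, hL, graft_self⟩
    · exact ⟨by omega, h₂, by rw [graft_of_lt h₁, h₃]⟩

/-- The grafted branch becomes the last child of the root, so sortedness needs `hle`; everything
else is inherited from the two trees. -/
theorem IsDFS.graft (hf : IsDFS (N + 1) L f d) (hg : IsDFS N L' g e)
    (hle : ∀ i ∈ treeChildren L f 0,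
      val (treeChildren L' g) N 0 ≤ val (treeChildren L f) N i) :
    IsDFS (N + 1) (L + L') (graft L f g) (graftDepth L d e) := by
  have hL := hf.pos
  have hL' := hg.pos
  refine ⟨by omega, fun i hi hiL => ?_, fun i j h₁ h₂ h₃ => ?_, ?_, fun i hi hiL => ?_,
    fun i hi => ?_, fun i j hi hij hj hfij => ?_⟩
  · by_cases hcL : i < L
    · rw [graft_of_lt hcL]; exact hf.lt i hi hcL
    · obtain ⟨j, rfl⟩ := Nat.exists_eq_add_of_le (not_lt.1 hcL)
      rcases Nat.eq_zero_or_pos j with rfl | hj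
      · rw [add_zero, graft_self]; omega
      · have := hg.lt j hj (by omega)
        rw [graft_add hj]; omega
  · by_cases hjL : j < L
    · rw [graft_of_lt hjL] at h₁ ⊢
      rw [graft_of_lt (h₂.trans hjL)]
      exact hf.nested i j h₁ h₂ hjL
    · obtain ⟨j, rfl⟩ := Nat.exists_eq_add_of_le (not_lt.1 hjL)
      rcases Nat.eq_zero_or_pos j with rfl | hj
      · rw [add_zero, graft_self]; omega
      · rw [graft_add hj] at h₁ ⊢
        obtain ⟨i, rfl⟩ := Nat.exists_eq_add_of_le (show L ≤ i by omega)
        have := hg.nested i j (by omega) (by omega) (by omega)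
        rw [graft_add (by omega)]
        omega
  · rw [graftDepth_of_lt hL, hf.dep_zero]
  · by_cases hcL : i < L
    · rw [graft_of_lt hcL, graftDepth_of_lt hcL, graftDepth_of_lt (hf.parent_lt hi hcL)]
      exact hf.dep_succ i hi hcL
    · obtain ⟨j, rfl⟩ := Nat.exists_eq_add_of_le (not_lt.1 hcL)
      rcases Nat.eq_zero_or_pos j with rfl | hj
      · rw [graftDepth_add, add_zero, graft_self, graftDepth_of_lt hL, hf.dep_zero, hg.dep_zero]
      · rw [graft_add hj, graftDepth_add, graftDepth_add, hg.dep_succ j hj (by omega)]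
  · by_cases hcL : i < L
    · rw [graftDepth_of_lt hcL]; exact hf.dep_le i hcL
    · obtain ⟨j, rfl⟩ := Nat.exists_eq_add_of_le (not_lt.1 hcL)
      have := hg.dep_le j (by omega)
      rw [graftDepth_add]; omega
  · by_cases hjL : j < L
    · rw [graft_of_lt hjL, graft_of_lt (hij.trans hjL)] at hfij
      rw [graftDepth_of_lt (hij.trans hjL), val_graft_old _ hi (hij.trans hjL),
        val_graft_old _ (hi.trans hij) hjL]
      exact hf.sorted i j hi hij hjL hfij
    · obtain ⟨j, rfl⟩ := Nat.exists_eq_add_of_le (not_lt.1 hjL)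
      rcases Nat.eq_zero_or_pos j with rfl | hj'
      · rw [add_zero] at hij hfij
        rw [graft_self, graft_of_lt hij] at hfij
        rw [graftDepth_of_lt hij, val_graft_old _ hi hij, hf.val_graft_new _ hL',
          hf.dep_succ i hi hij, hfij, hf.dep_zero]
        exact hle i (mem_treeChildren.2 ⟨hij, hi, hfij⟩)
      · rw [graft_add hj'] at hfij
        have hiL : L < i := by
          by_contra hiL
          rcases (not_lt.1 hiL).lt_or_eq with h | h
          · rw [graft_of_lt h] at hfij
            have := hf.parent_lt hi h
            omega
          · rw [h, graft_self] at hfij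
            omega
        obtain ⟨i, rfl⟩ := Nat.exists_eq_add_of_le hiL.le
        rw [graft_add (by omega)] at hfij
        rw [graftDepth_add, hf.val_graft_new _ (by omega), hf.val_graft_new _ (by omega),
          Nat.add_sub_add_right]
        exact hg.sorted i j (by omega) (by omega) (by omega) (by omega)

end Graft

/-- The number of nodes of the tree of depth `k` below `x`. -/
def treeSize {X : Type*} (ch : X → Finset X) : ℕ → X → ℕ
  | 0, _ => 1
  | k + 1, x => 1 + ∑ c ∈ ch x, treeSize ch k c

/-- Every structure can be unrolled to a tree in depth-first order. -/
theorem exists_isDFS {X : Type*} [DecidableEq X] (ch : X → Finset X) (k : ℕ) : ∀ x : X,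
    ∃ (L : ℕ) (f dep : ℕ → ℕ), IsDFS k L f dep ∧ L = treeSize ch k x ∧
      val (treeChildren L f) k 0 = val ch k x := by
  induction k with
  | zero =>
    intro x
    exact ⟨1, fun _ => 0, fun _ => 0, ⟨by omega, fun i _ _ => by omega, fun i j _ _ _ => by omega,
      rfl, fun i _ _ => by omega, fun i _ => by omega, fun i j _ _ _ => by omega⟩, rfl, rfl⟩
  | succ k ih =>
    intro x
    suffices ∀ s : Finset X, ∃ (L : ℕ) (f dep : ℕ → ℕ), IsDFS (k + 1) L f dep ∧
        L = 1 + ∑ c ∈ s, treeSize ch k c ∧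
        (treeChildren L f 0).val.map (val (treeChildren L f) k) = s.val.map (val ch k) by
      obtain ⟨L, f, dep, h₁, h₂, h₃⟩ := this (ch x)
      exact ⟨L, f, dep, h₁, h₂, by rw [val_succ, val_succ, h₃]⟩
    intro s
    -- Children are inserted by decreasing value: `a` is at most those already present, so its tree
    -- may be grafted last.
    induction s using Finset.induction_on_min_value (val ch k) with
    | empty =>
      refine ⟨1, fun _ => 0, fun _ => 0, ⟨by omega, fun i _ _ => by omega,
        fun i j _ _ _ => by omega, rfl, fun i _ _ => by omega, fun i _ => by omega,
        fun i j _ _ _ => by omega⟩, by simp, ?_⟩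
      have : treeChildren 1 (fun _ => 0) 0 = ∅ := by
        ext i; rw [mem_treeChildren]; simp
      rw [this]; rfl
    | insert a s ha hmin hs =>
      obtain ⟨L, f, dep, h₁, h₂, h₃⟩ := hs
      obtain ⟨L', g, dep', g₁, g₂, g₃⟩ := ih a
      refine ⟨L + L', graft L f g, graftDepth L dep dep', h₁.graft g₁ ?_, ?_, ?_⟩
      · intro i hi
        rw [g₃]
        have : val (treeChildren L f) k i ∈ s.val.map (val ch k) := by
          rw [← h₃]; exact Multiset.mem_map_of_mem _ hi
        obtain ⟨c, hc, hc'⟩ := Multiset.mem_map.1 this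
        rw [← hc']
        exact hmin c hc
      · rw [Finset.sum_insert ha]; omega
      · have hL : L ∉ treeChildren L f 0 := fun h => by
          have := (mem_treeChildren.1 h).1; omega
        rw [h₁.treeChildren_graft_zero g₁, Finset.insert_val_of_notMem hL,
          Finset.insert_val_of_notMem ha, Multiset.map_cons, Multiset.map_cons, ← h₃, ← g₃]
        congr 1
        · exact h₁.val_graft_new k (i := 0) g₁.pos
        · refine Multiset.map_congr rfl fun i hi => ?_
          obtain ⟨e₁, e₂, -⟩ := mem_treeChildren.1 hi
          exact val_graft_old k e₂ e₁

/-- Each state is a child of exactly one state, so in the sum over all states every level adds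
exactly the number of states. This keeps the trees polynomial in size although the loop is unrolled.
-/
theorem FDS.sum_treeSize_le (A : FDS) (k : ℕ) (x : A.State) :
    treeSize A.children k x ≤ Nat.card A.State * (k + 1) := by
  classical
  have := A.finite
  have := Fintype.ofFinite A.State
  suffices ∑ x, treeSize A.children k x = Nat.card A.State * (k + 1) from
    this ▸ Finset.single_le_sum (f := treeSize A.children k) (fun _ _ => Nat.zero_le _)
      (Finset.mem_univ x)
  induction k with
  | zero => simp [treeSize, Nat.card_eq_fintype_card]
  | succ k ih =>
    simp only [treeSize, Finset.sum_add_distrib]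
    have hdisj : ∑ x, ∑ c ∈ A.children x, treeSize A.children k c =
        ∑ c, treeSize A.children k c := by
      rw [← Finset.sum_fiberwise (Finset.univ) A.step (treeSize A.children k)]
      refine Finset.sum_congr rfl fun x _ => Finset.sum_congr ?_ fun _ _ => rfl
      ext c
      simp
    rw [hdisj, ih]
    simp [Nat.card_eq_fintype_card]
    ring

theorem val_ofTable {n : ℕ} (f : Fin n → Fin n) (k : ℕ) (x : Fin n) :
    val (tableChildren n (RAM.table f)) k x = val (FDS.ofTable f).children k x := by
  refine val_map (ch := (FDS.ofTable f).children) (φ := fun i : Fin n => (i : ℕ)) Set.univ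
    (fun _ _ _ _ => trivial) Fin.val_injective.injOn (fun x _ => ?_) k x trivial
  ext i
  refine mem_tableChildren.trans (Iff.trans ?_ Finset.mem_image.symm)
  constructor
  · rintro ⟨hi, h⟩
    refine ⟨⟨i, hi⟩, FDS.mem_children.2 (Fin.ext ?_), rfl⟩
    rw [RAM.table, dif_pos hi] at h
    exact h
  · rintro ⟨c, hc, rfl⟩
    refine ⟨c.2, ?_⟩
    rw [RAM.table, dif_pos c.2]
    exact congrArg Fin.val (FDS.mem_children.1 hc)

/-- Cutting off the first branch, which has `s` nodes, and adding a loop at the root instead. -/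
def cutFirst (s : ℕ) (f : ℕ → ℕ) (i : ℕ) : ℕ :=
  if i = 0 then 0 else f (i + s) - s

/-- Among the children of `r`, only `r` itself has height `N`. Hence its value is strictly the
greatest and it corresponds to node `1`, whose branch is `1, …, s`. Putting a loop in place of this
branch preserves the value of the root, by induction on the level. -/
theorem IsDFS.val_cutFirst {N L s : ℕ} {f d : ℕ → ℕ} (h : IsDFS (N + 1) L f d) {C : FDS}
    {r : C.State} (hr : C.IsRoot r) (hN : Nat.card C.State ≤ N)
    (hval : val (treeChildren L f) (N + 1) 0 = val C.children (N + 1) r)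
    (hs : 0 < s) (hsL : s < L) (hs₁ : s + 1 < L → f (s + 1) = 0)
    (hs₂ : ∀ j, 2 ≤ j → j ≤ s → f j ≠ 0) :
    val (tableChildren (L - s) (cutFirst s f)) (N + 1) 0 = val C.children (N + 1) r := by
  classical
  set ch := treeChildren L f with hch
  set ch' := tableChildren (L - s) (cutFirst s f) with hch'
  set R := (ch 0).filter (s < ·) with hR
  have hmem₁ : 1 ∈ ch 0 := by
    rw [hch, mem_treeChildren]
    have := h.lt 1 one_pos (by omega)
    exact ⟨by omega, one_pos, by omega⟩
  have h0R : ch 0 = insert 1 R := by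
    ext i
    rw [Finset.mem_insert, hR, Finset.mem_filter]
    constructor
    · intro hi
      have hi' := hi
      rw [hch, mem_treeChildren] at hi'
      by_cases hi1 : i = 1
      · exact .inl hi1
      · refine .inr ⟨hi, ?_⟩
        by_contra his
        exact hs₂ i (by omega) (by omega) hi'.2.2
    · rintro (rfl | hi)
      · exact hmem₁
      · exact hi.1
  have h1R : 1 ∉ R := by
    rw [hR, Finset.mem_filter]; omega
  have hmap := Value.mk_injective hval
  have hrr : r ∈ C.children r := FDS.mem_children.2 hr.step_eq
  -- the first branch corresponds to the loop
  have hv1 : val ch N 1 = val C.children N r := by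
    have hle : val C.children N r ≤ val ch N 1 := by
      have : val C.children N r ∈ (ch 0).val.map (val ch N) := by
        rw [hmap]; exact Multiset.mem_map_of_mem _ hrr
      obtain ⟨i, hi, hi'⟩ := Multiset.mem_map.1 this
      rw [← hi']
      replace hi : i ∈ ch 0 := hi
      rw [hch, mem_treeChildren] at hi hmem₁
      rcases (Nat.succ_le_of_lt hi.2.1).lt_or_eq with h1 | h1
      · have := h.sorted 1 i one_pos h1 hi.1 (by rw [hmem₁.2.2, hi.2.2])
        rwa [h.dep_succ 1 one_pos (by omega), hmem₁.2.2, h.dep_zero] at this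
      · rw [← h1]
    have : val ch N 1 ∈ (C.children r).val.map (val C.children N) := by
      rw [← hmap]; exact Multiset.mem_map_of_mem _ hmem₁
    obtain ⟨c, hc, hc'⟩ := Multiset.mem_map.1 this
    by_cases hcr : c = r
    · rw [← hc', hcr]
    · have hlt : val C.children N c < val C.children N r := not_le.1 fun hle =>
        hr.not_hasHeight hN hcr (HasHeight.of_val_le le_rfl hle (hr.hasHeight N))
      rw [hc'] at hlt
      exact absurd hle (not_le.2 hlt)
  have hrest : R.val.map (val ch N) = ((C.children r).erase r).val.map (val C.children N) := by
    rw [h0R, Finset.insert_val_of_notMem h1R, ← Finset.insert_erase hrr,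
      Finset.insert_val_of_notMem (Finset.notMem_erase _ _), Multiset.map_cons,
      Multiset.map_cons, hv1] at hmap
    exact (Multiset.cons_inj_right _).1 hmap
  -- nodes other than the root
  have hmem' : ∀ i, 0 < i → i < L - s → ∀ c, c ∈ ch (i + s) ↔ ∃ b ∈ ch' i, b + s = c := by
    intro i hi hiL c
    rw [hch, mem_treeChildren]
    constructor
    · rintro ⟨hc, hc0, hci⟩
      have := h.lt c hc0 hc
      refine ⟨c - s, ?_, by omega⟩
      rw [hch', mem_tableChildren, cutFirst, if_neg (by omega), Nat.sub_add_cancel (by omega), hci]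
      omega
    · rintro ⟨b, hb, rfl⟩
      rw [hch', mem_tableChildren, cutFirst] at hb
      split_ifs at hb with hb0
      · omega
      · omega
  have hother : ∀ k i, 0 < i → i < L - s → val ch k (i + s) = val ch' k i := by
    intro k i hi hiL
    refine val_map (φ := (· + s)) {i | 0 < i ∧ i < L - s} (fun x hx c hc => ?_)
      (fun a _ b _ hab => by simpa using hab) (fun x hx => ?_) k i ⟨hi, hiL⟩
    · rw [hch', mem_tableChildren] at hc
      refine ⟨Nat.pos_of_ne_zero fun hc0 => ?_, hc.1⟩
      rw [hc0, cutFirst, if_pos rfl] at hc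
      exact hx.1.ne hc.2
    · ext c
      rw [Finset.mem_image]
      exact hmem' x hx.1 hx.2 c
  have hmem0 : 0 ∈ ch' 0 := by
    rw [hch', mem_tableChildren, cutFirst, if_pos rfl]; omega
  have hR' : R = ((ch' 0).erase 0).image (· + s) := by
    ext c
    rw [hR, Finset.mem_filter, Finset.mem_image, hch, mem_treeChildren]
    constructor
    · rintro ⟨⟨h₁, h₂, h₃⟩, h₄⟩
      refine ⟨c - s, Finset.mem_erase.2 ⟨by omega, ?_⟩, by omega⟩
      rw [hch', mem_tableChildren, cutFirst, if_neg (by omega), Nat.sub_add_cancel (by omega), h₃]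
      omega
    · rintro ⟨b, hb, rfl⟩
      obtain ⟨hb0, hb⟩ := Finset.mem_erase.1 hb
      rw [hch', mem_tableChildren, cutFirst, if_neg hb0] at hb
      refine ⟨⟨by omega, by omega, ?_⟩, by omega⟩
      -- Truncated subtraction also sends parents in `1, …, s` to `0`. Beyond the first branch they
      -- do not occur, by `nested` and because `s + 1` is a child of the root.
      by_contra hne
      have he := hs₁ (by omega)
      rcases (show s + 1 ≤ b + s by omega).lt_or_eq with h1 | h1
      · have := h.nested (s + 1) (b + s) (by omega) h1 (by omega)
        omega
      · rw [← h1] at hne; exact hne he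
  have hall : ∀ k ≤ N + 1, val ch' k 0 = val C.children k r := by
    intro k
    induction k with
    | zero => intro _; rfl
    | succ k ih =>
      intro hk
      have h1 := map_val_eq_of_le (show k ≤ N by omega) hrest
      rw [hR', Finset.image_val_of_injOn (fun a _ b _ hab => by simpa using hab),
        Multiset.map_map] at h1
      rw [val_succ, val_succ, ← Finset.insert_erase hrr, ← Finset.insert_erase hmem0,
        Finset.insert_val_of_notMem (Finset.notMem_erase _ _),
        Finset.insert_val_of_notMem (Finset.notMem_erase _ _), Multiset.map_cons,
        Multiset.map_cons, ih (by omega), ← h1]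
      congr 2
      refine Multiset.map_congr rfl fun i hi => ?_
      obtain ⟨hi0, hi⟩ := Finset.mem_erase.1 (show i ∈ (ch' 0).erase 0 from hi)
      rw [hch', mem_tableChildren] at hi
      exact (hother k i (Nat.pos_of_ne_zero hi0) hi.1).symm
  exact hall _ le_rfl

/-- A table whose entries are smaller than their indices is a dendron. -/
theorem isRoot_ofTable {l : ℕ} (h : Fin l → Fin l) (hl : 0 < l) (h0 : h ⟨0, hl⟩ = ⟨0, hl⟩)
    (hlt : ∀ i : Fin l, 0 < (i : ℕ) → (h i : ℕ) < i) : (FDS.ofTable h).IsRoot ⟨0, hl⟩ := by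
  refine ⟨h0, ?_⟩
  suffices ∀ (i : ℕ) (hi : i < l), ∃ k, (FDS.ofTable h).step^[k] ⟨i, hi⟩ = ⟨0, hl⟩ from
    fun x => this x.1 x.2
  intro i
  induction i using Nat.strong_induction_on with
  | _ i ih =>
    intro hi
    rcases Nat.eq_zero_or_pos i with rfl | hi0
    · exact ⟨0, rfl⟩
    · obtain ⟨k, hk⟩ := ih (h ⟨i, hi⟩) (hlt ⟨i, hi⟩ hi0) (h ⟨i, hi⟩).2
      exact ⟨k + 1, hk⟩

/-! ### One table for a system and a product, and ranks of values -/

/-- The table `Q` on `0, …, K - 1` contains the system `A` of size `n`, followed by the product of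
the system `B` of size `m` and the table `W` of size `L`. -/
structure IsCombined (K n m L : ℕ) (A B W Q : ℕ → ℕ) : Prop where
  left : ∀ z < n, Q z = A z
  right : ∀ w < L, ∀ b < m, Q (n + w * m + b) = n + W w * m + B b
  -- An entry of at least `K` points out of the table, so unused nodes are nobody's children.
  rest : ∀ z < K, n + L * m ≤ z → K ≤ Q z

section Combined

variable {K n m L : ℕ} {A B W Q : ℕ → ℕ}

theorem add_mul_add_lt {w b : ℕ} (hw : w < L) (hb : b < m) : n + w * m + b < n + L * m := by
  have : (w + 1) * m ≤ L * m := Nat.mul_le_mul_right _ hw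
  rw [Nat.succ_mul] at this
  omega

theorem exists_eq_add_mul_add {z : ℕ} (hz : n ≤ z) (hz' : z < n + L * m) :
    ∃ w < L, ∃ b < m, z = n + w * m + b := by
  have hm : 0 < m := Nat.pos_of_ne_zero fun h => by subst h; simp at hz'; omega
  refine ⟨(z - n) / m, (Nat.div_lt_iff_lt_mul hm).2 (by omega), (z - n) % m, Nat.mod_lt _ hm, ?_⟩
  have := Nat.div_add_mod' (z - n) m
  omega

theorem mul_add_inj {w b w' b' : ℕ} (hb : b < m) (hb' : b' < m) (h : w * m + b = w' * m + b') :
    w = w' ∧ b = b' := by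
  rcases lt_trichotomy w w' with hw | hw | hw
  · have := add_mul_add_lt (n := 0) hw hb
    omega
  · subst hw; exact ⟨rfl, by omega⟩
  · have := add_mul_add_lt (n := 0) hw hb'
    omega

theorem IsCombined.val_left (h : IsCombined K n m L A B W Q) (hK : n + L * m ≤ K)
    (k : ℕ) {x : ℕ} (hx : x < n) :
    val (tableChildren K Q) k x = val (tableChildren n A) k x := by
  refine val_map (φ := id) {z | z < n} (fun x _ c hc => (mem_tableChildren.1 hc).1)
    (Set.injOn_id _) (fun x hx => ?_) k x hx
  ext c
  rw [Finset.image_id, mem_tableChildren, mem_tableChildren]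
  constructor
  · rintro ⟨hc, hcx⟩
    have hx : x < n := hx
    simp only [id_eq] at hcx
    by_cases hcn : c < n
    · exact ⟨hcn, by rw [← h.left c hcn, hcx]⟩
    · exfalso
      by_cases hcL : c < n + L * m
      · obtain ⟨w, hw, b, hb, rfl⟩ := exists_eq_add_mul_add (not_lt.1 hcn) hcL
        rw [h.right w hw b hb] at hcx
        omega
      · have := h.rest c hc (not_lt.1 hcL)
        omega
  · rintro ⟨hc, rfl⟩
    exact ⟨by omega, h.left c hc⟩

theorem IsCombined.val_right (h : IsCombined K n m L A B W Q) (hK : n + L * m ≤ K)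
    (hA : ∀ z < n, A z < n) (hB : ∀ z < m, B z < m) (k : ℕ) {w b : ℕ} (hw : w < L) (hb : b < m) :
    val (tableChildren K Q) k (n + w * m + b) =
      val (prodChildren (tableChildren m B) (tableChildren L W)) k (b, w) := by
  refine val_map (φ := fun p : ℕ × ℕ => n + p.2 * m + p.1) {p | p.1 < m ∧ p.2 < L}
    (fun x _ c hc => ?_) ?_ (fun x hx => ?_) k (b, w) ⟨hb, hw⟩
  · obtain ⟨h₁, h₂⟩ := Finset.mem_product.1 hc
    exact ⟨(mem_tableChildren.1 h₁).1, (mem_tableChildren.1 h₂).1⟩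
  · rintro ⟨b, w⟩ ⟨hb, hw⟩ ⟨b', w'⟩ ⟨hb', hw'⟩ he
    simp only at he hb hw hb' hw'
    obtain ⟨h₁, h₂⟩ := mul_add_inj hb hb' (show w * m + b = w' * m + b' by omega)
    rw [h₁, h₂]
  · obtain ⟨b, w⟩ := x
    obtain ⟨hb, hw⟩ := hx
    simp only at hb hw
    have hlt := add_mul_add_lt (n := n) hw hb
    ext c
    rw [mem_tableChildren, Finset.mem_image]
    constructor
    · rintro ⟨hc, hcx⟩
      by_cases hcn : c < n
      · have := hA c hcn
        rw [h.left c hcn] at hcx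
        simp only at hcx
        omega
      · by_cases hcL : c < n + L * m
        · obtain ⟨w', hw', b', hb', rfl⟩ := exists_eq_add_mul_add (not_lt.1 hcn) hcL
          rw [h.right w' hw' b' hb'] at hcx
          simp only at hcx
          obtain ⟨h₁, h₂⟩ := mul_add_inj (hB b' hb') hb
            (show W w' * m + B b' = w * m + b by omega)
          exact ⟨(b', w'), Finset.mem_product.2
            ⟨mem_tableChildren.2 ⟨hb', h₂⟩, mem_tableChildren.2 ⟨hw', h₁⟩⟩, rfl⟩
        · have := h.rest c hc (not_lt.1 hcL)
          simp only at hcx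
          omega
    · rintro ⟨⟨b', w'⟩, hp, rfl⟩
      obtain ⟨h₁, h₂⟩ := Finset.mem_product.1 hp
      obtain ⟨hb', h₁⟩ := mem_tableChildren.1 h₁
      obtain ⟨hw', h₂⟩ := mem_tableChildren.1 h₂
      simp only at hb' hw' h₁ h₂ ⊢
      have := add_mul_add_lt (n := n) hw' hb'
      refine ⟨by omega, ?_⟩
      rw [h.right w' hw' b' hb', h₁, h₂]

end Combined

/-- The rank of the value of `x` at level `k` in the table `Q`. -/
noncomputable def rank (K : ℕ) (Q : ℕ → ℕ) (k x : ℕ) : ℕ :=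
  ((Finset.range K).filter fun y =>
    val (tableChildren K Q) k y < val (tableChildren K Q) k x).card

theorem rank_lt_rank {K : ℕ} {Q : ℕ → ℕ} {k x y : ℕ} (hx : x < K) :
    rank K Q k x < rank K Q k y ↔ val (tableChildren K Q) k x < val (tableChildren K Q) k y := by
  constructor
  · intro h
    by_contra hle
    refine absurd h (not_lt.2 (Finset.card_le_card fun z hz => ?_))
    obtain ⟨h₁, h₂⟩ := Finset.mem_filter.1 hz
    exact Finset.mem_filter.2 ⟨h₁, h₂.trans_le (not_lt.1 hle)⟩
  · intro h
    refine Finset.card_lt_card ((Finset.ssubset_iff_of_subset fun z hz => ?_).2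
      ⟨x, Finset.mem_filter.2 ⟨Finset.mem_range.2 hx, h⟩,
        fun hx' => lt_irrefl _ (Finset.mem_filter.1 hx').2⟩)
    obtain ⟨h₁, h₂⟩ := Finset.mem_filter.1 hz
    exact Finset.mem_filter.2 ⟨h₁, h₂.trans h⟩

theorem rank_eq_rank {K : ℕ} {Q : ℕ → ℕ} {k x y : ℕ} (hx : x < K) (hy : y < K) :
    rank K Q k x = rank K Q k y ↔ val (tableChildren K Q) k x = val (tableChildren K Q) k y := by
  have h₁ := rank_lt_rank (Q := Q) (k := k) (y := y) hx
  have h₂ := rank_lt_rank (Q := Q) (k := k) (y := x) hy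
  constructor
  · intro h
    exact le_antisymm (not_lt.1 fun h' => by have := h₂.2 h'; omega)
      (not_lt.1 fun h' => by have := h₁.2 h'; omega)
  · intro h
    rw [rank, rank, h]

theorem rank_lt {K : ℕ} {Q : ℕ → ℕ} {k x : ℕ} (hx : x < K) : rank K Q k x < K := by
  have : rank K Q k x < (Finset.range K).card :=
    Finset.card_lt_card ((Finset.ssubset_iff_of_subset (Finset.filter_subset _ _)).2
      ⟨x, Finset.mem_range.2 hx, fun hx' => lt_irrefl _ (Finset.mem_filter.1 hx').2⟩)
  rwa [Finset.card_range] at this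

/-- The number of children of `x` whose label is `u`. -/
def labelCount (K : ℕ) (Q R : ℕ → ℕ) (x u : ℕ) : ℕ :=
  ((Finset.range K).filter fun z => Q z = x ∧ R z = u).card

theorem labelCount_rank {K : ℕ} {Q R : ℕ → ℕ} {k : ℕ} (hR : ∀ z < K, R z = rank K Q k z)
    {x z : ℕ} (hz : z < K) : labelCount K Q R x (rank K Q k z) =
      ((tableChildren K Q x).val.map (val (tableChildren K Q) k)).count
        (val (tableChildren K Q) k z) := by
  rw [count_map_val, labelCount, tableChildren, Finset.filter_filter]
  congr 1
  refine Finset.filter_congr fun y hy => ?_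
  have hy := Finset.mem_range.1 hy
  rw [hR y hy, rank_eq_rank hy hz]

/-- One round of partition refinement: ranks at level `k` order and separate the values faithfully,
so the colexicographic comparison only needs the number of children of each rank. Ranks and values
that do not occur count zero on both sides. -/
theorem val_succ_lt_iff {K : ℕ} {Q R : ℕ → ℕ} {k : ℕ} (hR : ∀ z < K, R z = rank K Q k z)
    {x y : ℕ} : val (tableChildren K Q) (k + 1) y < val (tableChildren K Q) (k + 1) x ↔
      ∃ t < K, labelCount K Q R y t < labelCount K Q R x t ∧
        ∀ u < K, t < u → labelCount K Q R y u = labelCount K Q R x u := by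
  have hpos : ∀ x t, 0 < labelCount K Q R x t → ∃ z < K, t = rank K Q k z := by
    intro x t h
    obtain ⟨z, hz⟩ := Finset.card_pos.1 h
    obtain ⟨h₁, -, h₃⟩ := Finset.mem_filter.1 hz
    have h₁ := Finset.mem_range.1 h₁
    exact ⟨z, h₁, by rw [← h₃, hR z h₁]⟩
  have hpos' : ∀ x v, v ∈ (tableChildren K Q x).val.map (val (tableChildren K Q) k) →
      ∃ z < K, v = val (tableChildren K Q) k z := by
    intro x v h
    obtain ⟨z, hz, rfl⟩ := Multiset.mem_map.1 h
    exact ⟨z, (mem_tableChildren.1 hz).1, rfl⟩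
  rw [val_succ, val_succ, Value.mk_lt_mk]
  constructor
  · rintro ⟨v, h₁, h₂⟩
    obtain ⟨z, hz, rfl⟩ := hpos' x v (Multiset.count_pos.1 (by omega))
    refine ⟨rank K Q k z, rank_lt hz, ?_, fun u _ hu' => ?_⟩
    · rwa [labelCount_rank hR hz, labelCount_rank hR hz]
    · by_cases hu : ∃ z' < K, u = rank K Q k z'
      · obtain ⟨z', hz', rfl⟩ := hu
        rw [labelCount_rank hR hz', labelCount_rank hR hz']
        exact h₁ _ ((rank_lt_rank hz).1 hu')
      · have : ∀ x, labelCount K Q R x u = 0 := fun x =>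
          Nat.eq_zero_of_not_pos fun h => hu (hpos x u h)
        rw [this, this]
  · rintro ⟨t, -, h₂, h₃⟩
    obtain ⟨z, hz, rfl⟩ := hpos x t (by omega)
    refine ⟨val (tableChildren K Q) k z, fun v hv => ?_, ?_⟩
    · by_cases hv' : ∃ z' < K, v = val (tableChildren K Q) k z'
      · obtain ⟨z', hz', rfl⟩ := hv'
        rw [← labelCount_rank hR hz', ← labelCount_rank hR hz']
        exact h₃ _ (rank_lt hz') ((rank_lt_rank hz).2 hv)
      · have : ∀ x, ((tableChildren K Q x).val.map (val (tableChildren K Q) k)).count v = 0 :=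
          fun x => Multiset.count_eq_zero.2 fun h => hv' (hpos' x v h)
        rw [this, this]
    · rwa [labelCount_rank hR hz, labelCount_rank hR hz] at h₂

open Classical in
theorem rank_succ {K : ℕ} {Q R : ℕ → ℕ} {k : ℕ} (hR : ∀ z < K, R z = rank K Q k z) (x : ℕ) :
    rank K Q (k + 1) x = ((Finset.range K).filter fun y =>
      ∃ t < K, labelCount K Q R y t < labelCount K Q R x t ∧
        ∀ u < K, t < u → labelCount K Q R y u = labelCount K Q R x u).card := by
  rw [rank]
  congr 1
  ext y
  rw [Finset.mem_filter, Finset.mem_filter, val_succ_lt_iff hR]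

theorem rank_zero {K : ℕ} {Q : ℕ → ℕ} (x : ℕ) : rank K Q 0 x = 0 := by
  rw [rank, Finset.card_eq_zero, Finset.filter_eq_empty_iff]
  intro y _
  rw [Subsingleton.elim (val (tableChildren K Q) 0 y) (val (tableChildren K Q) 0 x)]
  exact lt_irrefl _

namespace RAM

/-! ### Frames and loops -/

/-- The variables that a structured program may change. -/
def SProg.vars : SProg → List ℕ
  | .skip => []
  | .set i _ => [i]
  | .store _ _ _ => []
  | .seq P Q => P.vars ++ Q.vars
  | .ite _ P Q => P.vars ++ Q.vars
  | .rep i P => i :: P.vars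

/-- The arrays that a structured program may change. -/
def SProg.arrs : SProg → List ℕ
  | .skip => []
  | .set _ _ => []
  | .store a _ _ => [a]
  | .seq P Q => P.arrs ++ Q.arrs
  | .ite _ P Q => P.arrs ++ Q.arrs
  | .rep _ P => P.arrs

/-- The memories `s` and `r` agree outside the variables in `V` and the arrays in `A`. -/
def SameOutside (V A : List ℕ) (s r : Mem) : Prop :=
  (∀ i, i ∉ V → r.var i = s.var i) ∧ ∀ a, a ∉ A → r.arr a = s.arr a

theorem SameOutside.refl (V A : List ℕ) (s : Mem) : SameOutside V A s s :=
  ⟨fun _ _ => rfl, fun _ _ => rfl⟩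

theorem SameOutside.trans {V A : List ℕ} {s r q : Mem} (h : SameOutside V A s r)
    (h' : SameOutside V A r q) : SameOutside V A s q :=
  ⟨fun i hi => (h'.1 i hi).trans (h.1 i hi), fun a ha => (h'.2 a ha).trans (h.2 a ha)⟩

theorem SameOutside.mono {V A V' A' : List ℕ} {s r : Mem} (h : SameOutside V A s r)
    (hV : V ⊆ V') (hA : A ⊆ A') : SameOutside V' A' s r :=
  ⟨fun i hi => h.1 i fun h => hi (hV h), fun a ha => h.2 a fun h => ha (hA h)⟩

theorem sameOutside_setVar {V A : List ℕ} (s : Mem) {i v : ℕ} (hi : i ∈ V) :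
    SameOutside V A s (s.setVar i v) :=
  ⟨fun l hl => by rw [Mem.setVar_var, Function.update_of_ne (by rintro rfl; exact hl hi)],
    fun _ _ => rfl⟩

theorem iter_induction {G : ℕ → Mem → Mem} {s : Mem} {K : ℕ} (I : ℕ → Mem → Prop) (h0 : I 0 s)
    (hs : ∀ j < K, ∀ r, I j r → I (j + 1) (G j r)) : I K (iter G s K) := by
  induction K with
  | zero => exact h0
  | succ K ih => exact hs K (by omega) _ (ih fun j hj => hs j (by omega))

/-- The frame rule. As `vars` and `arrs` are computable lists, non-interference of concrete programs
is settled by `decide`. -/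
theorem SProg.sameOutside_run (P : SProg) (s : Mem) : SameOutside P.vars P.arrs s (P.run s) := by
  induction P generalizing s with
  | skip => exact .refl _ _ _
  | set i e => exact sameOutside_setVar s (List.mem_singleton_self i)
  | store a j e =>
    refine ⟨fun _ _ => rfl, fun b hb => ?_⟩
    simp only [arrs, List.mem_singleton] at hb
    simp [run, hb]
  | seq P Q hP hQ =>
    exact ((hP s).mono (List.subset_append_left _ _) (List.subset_append_left _ _)).trans
      ((hQ _).mono (List.subset_append_right _ _) (List.subset_append_right _ _))
  | ite e P Q hP hQ =>
    simp only [run]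
    split_ifs
    · exact (hP s).mono (List.subset_append_left _ _) (List.subset_append_left _ _)
    · exact (hQ s).mono (List.subset_append_right _ _) (List.subset_append_right _ _)
  | rep i P hP =>
    refine iter_induction (fun _ r => SameOutside (i :: P.vars) P.arrs s r) (.refl _ _ _) ?_
    intro j _ r hr
    exact (hr.trans (sameOutside_setVar r List.mem_cons_self)).trans
      ((hP _).mono (List.subset_cons_self _ _) (List.Subset.refl _))

/-- Induction over the rounds of a loop. -/
theorem run_rep_induction {i : ℕ} {P : SProg} {s : Mem} (I : ℕ → Mem → Prop) (h0 : I 0 s)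
    (hs : ∀ j < s.var 2, ∀ r, SameOutside (i :: P.vars) P.arrs s r → I j r →
      I (j + 1) (P.run (r.setVar i j))) :
    I (s.var 2) ((SProg.rep i P).run s) := by
  refine (iter_induction (K := s.var 2)
    (fun j r => SameOutside (i :: P.vars) P.arrs s r ∧ I j r) ⟨.refl _ _ _, h0⟩ ?_).2
  rintro j hj r ⟨hr, hI⟩
  exact ⟨(hr.trans (sameOutside_setVar r List.mem_cons_self)).trans
    ((P.sameOutside_run _).mono (List.subset_cons_self _ _) (List.Subset.refl _)), hs j hj r hr hI⟩

/-- A loop that fills an array. -/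
theorem run_rep_store {i a : ℕ} {e : SExpr} {s : Mem} (G : ℕ → ℕ)
    (hG : ∀ j < s.var 2, ∀ r, SameOutside [i] [a] s r → e.eval (r.setVar i j) = G j) (x : ℕ) :
    ((SProg.rep i (.store a (.var i) e)).run s).arr a x =
      if x < s.var 2 then G x else s.arr a x := by
  refine run_rep_induction (fun j r => ∀ x, r.arr a x = if x < j then G x else s.arr a x)
    (by simp) ?_ x
  intro j hj r hr hI x
  simp only [SProg.run, Mem.setArr_arr, Function.update_self, SExpr.eval, Mem.setVar_var,
    Mem.setVar_arr, hG j hj r hr]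
  by_cases hx : x = j
  · subst hx; simp
  · rw [Function.update_of_ne hx, hI x]
    have : x < j + 1 ↔ x < j := by omega
    simp [this]

/-! ### Conditions as expressions -/

namespace SExpr

/-- Negation. -/
def neg (e : SExpr) : SExpr := .sub (.const 1) e
/-- `e < f`. -/
def lt (e f : SExpr) : SExpr := neg (neg (.sub f e))
/-- `e = f`. -/
def eq (e f : SExpr) : SExpr := neg (.add (.sub e f) (.sub f e))
/-- Conjunction. -/
def and (e f : SExpr) : SExpr := neg (.add (neg e) (neg f))
/-- Bounded existential quantifier. -/
def ex (i : ℕ) (e : SExpr) : SExpr := neg (neg (.sum i e))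
/-- Bounded universal quantifier. -/
def all (i : ℕ) (e : SExpr) : SExpr := neg (.sum i (neg e))
/-- The product. -/
def mul (e f : SExpr) : SExpr := .sum 20 (.sum 21 (and (lt (.var 20) e) (lt (.var 21) f)))

variable (e f : SExpr) (s : Mem)

@[simp] theorem eval_neg : (neg e).eval s = if e.eval s = 0 then 1 else 0 := by
  simp only [neg, eval]; split_ifs <;> omega

@[simp] theorem eval_lt : (lt e f).eval s = if e.eval s < f.eval s then 1 else 0 := by
  simp only [lt, eval_neg, eval]
  by_cases h : e.eval s < f.eval s
  · have : f.eval s - e.eval s ≠ 0 := by omega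
    simp [h, this]
  · have : f.eval s - e.eval s = 0 := by omega
    simp [h, this]

@[simp] theorem eval_eq : (eq e f).eval s = if e.eval s = f.eval s then 1 else 0 := by
  simp only [eq, eval_neg, eval]
  congr 1
  exact propext ⟨fun h => by omega, fun h => by omega⟩

@[simp] theorem eval_and :
    (and e f).eval s = if e.eval s ≠ 0 ∧ f.eval s ≠ 0 then 1 else 0 := by
  simp only [and, eval_neg, eval]; split_ifs <;> omega

open Classical in
@[simp] theorem eval_ex (i : ℕ) : (ex i e).eval s =
    if ∃ j < s.var 2, e.eval (s.setVar i j) ≠ 0 then 1 else 0 := by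
  simp only [ex, eval_neg, eval, Finset.sum_eq_zero_iff, Finset.mem_range]
  by_cases h : ∃ j < s.var 2, e.eval (s.setVar i j) ≠ 0
  · have h' : ¬ ∀ j < s.var 2, e.eval (s.setVar i j) = 0 := by
      rintro h'; obtain ⟨j, hj, hj'⟩ := h; exact hj' (h' j hj)
    rw [if_pos h, if_neg h', if_pos rfl]
  · have h' : ∀ j < s.var 2, e.eval (s.setVar i j) = 0 := by
      intro j hj; by_contra hj'; exact h ⟨j, hj, hj'⟩
    rw [if_neg h, if_pos h', if_neg one_ne_zero]

open Classical in
@[simp] theorem eval_all (i : ℕ) : (all i e).eval s =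
    if ∀ j < s.var 2, e.eval (s.setVar i j) ≠ 0 then 1 else 0 := by
  simp only [all, eval_neg, eval, Finset.sum_eq_zero_iff, Finset.mem_range]
  split_ifs <;> simp_all

/-- The double sum counts pairs of indices, each bounded by variable `2`; hence the minima. The
operands are evaluated with `20` and `21` bound, so they must not depend on them. -/
theorem eval_mul {x y : ℕ} (hx : ∀ i j, e.eval ((s.setVar 20 i).setVar 21 j) = x)
    (hy : ∀ i j, f.eval ((s.setVar 20 i).setVar 21 j) = y) :
    (mul e f).eval s = min x (s.var 2) * min y (s.var 2) := by
  have key : ∀ a K : ℕ, ∑ i ∈ Finset.range K, (if i < a then 1 else 0) = min a K := by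
    intro a K
    rw [← Finset.card_filter]
    have : (Finset.range K).filter (fun i => i < a) = Finset.range (min a K) := by
      ext i; simp; omega
    rw [this, Finset.card_range]
  simp only [mul, eval, eval_and, eval_lt, hx, hy, Mem.setVar_var]
  rw [← key x, ← key y, Finset.sum_mul_sum]
  refine Finset.sum_congr rfl fun i _ => Finset.sum_congr rfl fun j _ => ?_
  by_cases h₁ : i < x <;> by_cases h₂ : j < y <;> simp [h₁, h₂]

/-- The number of children of node `x` with label `u`. -/
def count (x u : ℕ) : SExpr :=
  .sum 24 (and (eq (.get 3 (.var 24)) (.var x)) (eq (.get 4 (.var 24)) (.var u)))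

theorem eval_count {x u : ℕ} (hx : x ≠ 24) (hu : u ≠ 24) :
    (count x u).eval s =
      labelCount (s.var 2) (s.arr 3) (s.arr 4) (s.var x) (s.var u) := by
  simp only [count, eval, labelCount, Finset.card_filter, eval_and, eval_eq]
  refine Finset.sum_congr rfl fun j _ => ?_
  simp [hx, hu]

/-- The number of nodes that are less than the node in variable `10` at the next level. -/
def nextRank : SExpr :=
  .sum 20 (ex 21 (and (lt (count 20 21) (count 10 21))
    (all 22 (neg (and (lt (.var 21) (.var 22)) (neg (eq (count 20 22) (count 10 22))))))))

open Classical in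
theorem eval_nextRank : nextRank.eval s = ((Finset.range (s.var 2)).filter fun y =>
    ∃ t < s.var 2, labelCount (s.var 2) (s.arr 3) (s.arr 4) y t <
        labelCount (s.var 2) (s.arr 3) (s.arr 4) (s.var 10) t ∧
      ∀ u < s.var 2, t < u → labelCount (s.var 2) (s.arr 3) (s.arr 4) y u =
        labelCount (s.var 2) (s.arr 3) (s.arr 4) (s.var 10) u).card := by
  rw [nextRank, eval, Finset.card_filter]
  refine Finset.sum_congr rfl fun y _ => ?_
  rw [eval_ex]
  congr 1
  simp [eval_count, eval]

/-- The fixpoint of the table in array `a`, whose size is in variable `i`. -/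
def fixpoint (a i : ℕ) : SExpr :=
  .sum 20 (.sum 21 (and (lt (.var 20) (.var i))
    (and (eq (.get a (.var 20)) (.var 20)) (lt (.var 21) (.var 20)))))

/-- The double sum counts the pairs of a fixpoint and a smaller number; the only fixpoint `r` yields
`r` of them. -/
theorem eval_fixpoint {a i r : ℕ} (hi : i ≠ 20) (hi' : i ≠ 21) (hr : r < s.var i)
    (hK : s.var i ≤ s.var 2) (h : ∀ x < s.var i, s.arr a x = x ↔ x = r) :
    (fixpoint a i).eval s = r := by
  have : ∀ x ∈ Finset.range (s.var 2), ∀ j, (and (lt (.var 20) (.var i))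
      (and (eq (.get a (.var 20)) (.var 20)) (lt (.var 21) (.var 20)))).eval
      ((s.setVar 20 x).setVar 21 j) = if x = r ∧ j < r then 1 else 0 := by
    intro x _ j
    simp only [eval_and, eval_lt, eval_eq, eval, Mem.setVar_var, Mem.setVar_arr,
      Function.update_apply]
    by_cases hx : x < s.var i
    · by_cases hxr : x = r
      · subst hxr
        simp [hi, hi', hx, (h x hx).2]
      · simp [hi, hi', hx, hxr, mt (h x hx).1 hxr]
    · have : x ≠ r := by rintro rfl; exact hx hr
      simp [hi, hi', hx, this]
  simp only [fixpoint, eval]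
  rw [Finset.sum_congr rfl fun x hx => Finset.sum_congr rfl fun j _ => this x hx j,
    Finset.sum_eq_single r]
  · rw [← Finset.card_filter]
    have : (Finset.range ((s.setVar 20 r).var 2)).filter (fun j => r = r ∧ j < r) =
        Finset.range r := by
      ext j; simp; omega
    rw [this, Finset.card_range]
  · intro x _ hx; simp [hx]
  · intro hr'
    exact absurd (Finset.mem_range.2 (by omega)) hr'

end SExpr

open SExpr

/-! ### Computing ranks -/

theorem SProg.run_ite_pos {e : SExpr} {P Q : SProg} {s : Mem} (h : e.eval s ≠ 0) :
    (SProg.ite e P Q).run s = P.run s := if_pos h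

theorem SProg.run_ite_neg {e : SExpr} {P Q : SProg} {s : Mem} (h : e.eval s = 0) :
    (SProg.ite e P Q).run s = Q.run s := if_neg (not_not.2 h)

/-- Set the entries of array `4` to zero. -/
def clearRanks : SProg := .rep 10 (.store 4 (.var 10) (.const 0))

/-- Compute the ranks of the next level. -/
def nextRanks : SProg := .rep 10 (.store 5 (.var 10) nextRank)

/-- Copy array `5` to array `4`. -/
def copyRanks : SProg := .rep 10 (.store 4 (.var 10) (.get 5 (.var 10)))

/-- Replace the ranks by those of the next level as long as that level is at most `var 3`. -/
def rankRound : SProg := .ite (lt (.var 9) (.var 3)) (.seq nextRanks copyRanks) .skip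

/-- Write the ranks of the values at level `var 3` in array `3` into array `4`. -/
def ranks : SProg := .seq clearRanks (.rep 9 rankRound)

/-- The loop always runs `var 2` times, so the invariant after `j` rounds concerns level `min j (var
3)`. New ranks go to array `5` first, because each of them depends on all the old ones. -/
theorem run_ranks {s : Mem} (hN : s.var 3 ≤ s.var 2) {x : ℕ} (hx : x < s.var 2) :
    (ranks.run s).arr 4 x = rank (s.var 2) (s.arr 3) (s.var 3) x := by
  have h₀ := clearRanks.sameOutside_run s
  have h2 : (clearRanks.run s).var 2 = s.var 2 := h₀.1 2 (by decide)
  have h3 : (clearRanks.run s).var 3 = s.var 3 := h₀.1 3 (by decide)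
  have hQ : (clearRanks.run s).arr 3 = s.arr 3 := h₀.2 3 (by decide)
  have key := run_rep_induction (i := 9) (P := rankRound) (s := clearRanks.run s)
    (fun j r => ∀ x < s.var 2, r.arr 4 x = rank (s.var 2) (s.arr 3) (min j (s.var 3)) x)
    (by
      intro x hx
      rw [clearRanks, run_rep_store (fun _ => 0) (fun _ _ _ _ => rfl), if_pos hx, Nat.zero_min,
        rank_zero])
    (by
      intro j hj r hr hI x hx
      have g2 : r.var 2 = s.var 2 := (hr.1 2 (by decide)).trans h2
      have g3 : r.var 3 = s.var 3 := (hr.1 3 (by decide)).trans h3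
      have gQ : r.arr 3 = s.arr 3 := (hr.2 3 (by decide)).trans hQ
      have hc : (lt (.var 9) (.var 3)).eval (r.setVar 9 j) = if j < s.var 3 then 1 else 0 := by
        simp [SExpr.eval, g3]
      by_cases hjN : j < s.var 3
      · have hmin : min (j + 1) (s.var 3) = j + 1 := by omega
        have hmin' : min j (s.var 3) = j := by omega
        rw [hmin'] at hI
        rw [hmin, rankRound, SProg.run_ite_pos (by rw [hc, if_pos hjN]; exact one_ne_zero)]
        have g₁ := nextRanks.sameOutside_run (r.setVar 9 j)
        have e2 : (nextRanks.run (r.setVar 9 j)).var 2 = s.var 2 :=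
          (g₁.1 2 (by decide)).trans (by simp [g2])
        change (copyRanks.run (nextRanks.run (r.setVar 9 j))).arr 4 x = _
        rw [copyRanks, run_rep_store ((nextRanks.run (r.setVar 9 j)).arr 5) (by
            intro j _ q hq
            simp [SExpr.eval, hq.2 5 (by decide)]) x, e2, if_pos hx, nextRanks,
          run_rep_store (rank (s.var 2) (s.arr 3) (j + 1)) _ x]
        · simp [g2, hx]
        · intro y _ q hq
          have f2 : q.var 2 = s.var 2 := (hq.1 2 (by decide)).trans (by simp [g2])
          have f3 : q.arr 3 = s.arr 3 := (hq.2 3 (by decide)).trans gQ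
          have f4 : q.arr 4 = r.arr 4 := hq.2 4 (by decide)
          have f2' : (q.setVar 10 y).var 2 = s.var 2 := by simp [f2]
          have f10 : (q.setVar 10 y).var 10 = y := by simp
          rw [eval_nextRank, rank_succ hI, f2', f10, Mem.setVar_arr, f3, f4]
      · have hmin : min (j + 1) (s.var 3) = min j (s.var 3) := by omega
        rw [hmin, rankRound, SProg.run_ite_neg (by rw [hc, if_neg hjN])]
        exact hI x hx)
  have := key x hx
  rwa [h2, min_eq_right hN] at this

/-! ### Building the combined table and comparing values in it -/

/-- Write the system in array `0` into array `3`. -/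
def combineLeft : SProg :=
  .rep 10 (.ite (lt (.var 10) (.var 0)) (.store 3 (.var 10) (.get 0 (.var 10)))
    (.store 3 (.var 10) (.var 2)))

/-- Write one entry of the product into array `3`. -/
def combineCell : SProg :=
  .ite (lt (.var 11) (.var 1))
    (.store 3 (.add (.add (.var 0) (mul (.var 10) (.var 1))) (.var 11))
      (.add (.add (.var 0) (mul (.get 2 (.var 10)) (.var 1))) (.get 1 (.var 11)))) .skip

/-- Write one row of the product into array `3`. -/
def combineRow : SProg :=
  .ite (lt (.var 10) (.var 8)) (.rep 11 combineCell) .skip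

/-- Write the combination of the system in array `0` and the product of the system in array `1` and
the table of size `var 8` in array `2` into array `3`. -/
def combine : SProg := .seq combineLeft (.rep 10 combineRow)

theorem run_combineLeft {s : Mem} {x : ℕ} (hx : x < s.var 2) :
    (combineLeft.run s).arr 3 x = if x < s.var 0 then s.arr 0 x else s.var 2 := by
  revert x
  refine run_rep_induction (s := s)
    (fun j r => ∀ {x}, x < j → r.arr 3 x = if x < s.var 0 then s.arr 0 x else s.var 2)
    (by omega) ?_
  intro j _ r hr hI x hx
  have g2 : r.var 2 = s.var 2 := hr.1 2 (by decide)
  have g0 : r.var 0 = s.var 0 := hr.1 0 (by decide)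
  have gA : r.arr 0 = s.arr 0 := hr.2 0 (by decide)
  have hc : (lt (.var 10) (.var 0)).eval (r.setVar 10 j) = if j < s.var 0 then 1 else 0 := by
    simp [SExpr.eval, g0]
  by_cases hj : j < s.var 0
  · rw [SProg.run_ite_pos (by rw [hc, if_pos hj]; exact one_ne_zero)]
    by_cases hxj : x = j
    · subst hxj; simp [SProg.run, SExpr.eval, hj, gA]
    · simpa [SProg.run, SExpr.eval, hxj] using hI (show x < j by omega)
  · rw [SProg.run_ite_neg (by rw [hc, if_neg hj])]
    by_cases hxj : x = j
    · subst hxj; simp [SProg.run, SExpr.eval, hj, g2]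
    · simpa [SProg.run, SExpr.eval, hxj] using hI (show x < j by omega)

theorem run_combineCell {n m K w j : ℕ} {B W : ℕ → ℕ} {q : Mem} (h0 : q.var 0 = n)
    (h1 : q.var 1 = m) (h2 : q.var 2 = K) (h10 : q.var 10 = w) (hB : q.arr 1 = B)
    (hW : q.arr 2 = W) (hw : w ≤ K) (hm : m ≤ K) (hWw : W w ≤ K) :
    (combineCell.run (q.setVar 11 j)).arr 3 = if j < m then
      Function.update (q.arr 3) (n + w * m + j) (n + W w * m + B j) else q.arr 3 := by
  have hc : (lt (.var 11) (.var 1)).eval (q.setVar 11 j) = if j < m then 1 else 0 := by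
    simp [SExpr.eval, h1]
  by_cases hj : j < m
  · have m1 : (mul (.var 10) (.var 1)).eval (q.setVar 11 j) = w * m := by
      rw [eval_mul (x := w) (y := m)]
      · have : (q.setVar 11 j).var 2 = K := by simp [h2]
        rw [this, min_eq_left hw, min_eq_left hm]
      · intro i j; simp [SExpr.eval, h10]
      · intro i j; simp [SExpr.eval, h1]
    have m2 : (mul (.get 2 (.var 10)) (.var 1)).eval (q.setVar 11 j) = W w * m := by
      rw [eval_mul (x := W w) (y := m)]
      · have : (q.setVar 11 j).var 2 = K := by simp [h2]
        rw [this, min_eq_left hWw, min_eq_left hm]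
      · intro i j; simp [SExpr.eval, h10, hW]
      · intro i j; simp [SExpr.eval, h1]
    rw [combineCell, SProg.run_ite_pos (by rw [hc, if_pos hj]; exact one_ne_zero), if_pos hj]
    simp only [SProg.run, SExpr.eval, m1, m2]
    simp [h0, hB]
  · rw [combineCell, SProg.run_ite_neg (by rw [hc, if_neg hj]), if_neg hj]
    rfl

/-- Distinct cells have distinct addresses (`mul_add_inj`), so a cell that is already correct
survives the writing of another row. -/
theorem run_combineRow {n m K L w : ℕ} {B W : ℕ → ℕ} {r : Mem} (h0 : r.var 0 = n)
    (h1 : r.var 1 = m) (h2 : r.var 2 = K) (h8 : r.var 8 = L) (hB : r.arr 1 = B)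
    (hW : r.arr 2 = W) (hw : w ≤ K) (hm : m ≤ K) (hWL : ∀ w < L, W w ≤ K) :
    (∀ w' < L, ∀ b < m, (w' = w ∨ r.arr 3 (n + w' * m + b) = n + W w' * m + B b) →
      (combineRow.run (r.setVar 10 w)).arr 3 (n + w' * m + b) = n + W w' * m + B b) ∧
    ∀ z, (∀ w < L, ∀ b < m, z ≠ n + w * m + b) →
      (combineRow.run (r.setVar 10 w)).arr 3 z = r.arr 3 z := by
  have hc : (lt (.var 10) (.var 8)).eval (r.setVar 10 w) = if w < L then 1 else 0 := by
    simp [SExpr.eval, h8]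
  by_cases hwL : w < L
  · rw [combineRow, SProg.run_ite_pos (by rw [hc, if_pos hwL]; exact one_ne_zero)]
    have h2' : (r.setVar 10 w).var 2 = K := by simp [h2]
    have inner := run_rep_induction (i := 11) (P := combineCell) (s := r.setVar 10 w)
      (fun j q => (∀ w' < L, ∀ b < m,
        (w' = w ∧ b < j ∨ r.arr 3 (n + w' * m + b) = n + W w' * m + B b) →
          q.arr 3 (n + w' * m + b) = n + W w' * m + B b) ∧
        ∀ z, (∀ w < L, ∀ b < m, z ≠ n + w * m + b) → q.arr 3 z = r.arr 3 z)
      ⟨fun w' _ b _ h => by simpa using h, fun _ _ => rfl⟩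
      (by
        intro j hj q hq hJ
        rw [run_combineCell (n := n) (m := m) (K := K) (w := w) (B := B) (W := W)
          ((hq.1 0 (by decide)).trans (by simp [h0])) ((hq.1 1 (by decide)).trans (by simp [h1]))
          ((hq.1 2 (by decide)).trans (by simp [h2])) ((hq.1 10 (by decide)).trans (by simp))
          ((hq.2 1 (by decide)).trans hB) ((hq.2 2 (by decide)).trans hW) hw hm (hWL w hwL)]
        by_cases hjm : j < m
        · rw [if_pos hjm]
          refine ⟨fun w' hw' b hb hv => ?_, fun z hz => ?_⟩
          · by_cases heq : n + w' * m + b = n + w * m + j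
            · obtain ⟨rfl, rfl⟩ := mul_add_inj hb hjm (show w' * m + b = w * m + j by omega)
              rw [Function.update_self]
            · rw [Function.update_of_ne heq]
              refine hJ.1 w' hw' b hb ?_
              rcases hv with ⟨rfl, hv⟩ | hv
              · refine .inl ⟨rfl, ?_⟩
                have : b ≠ j := fun h => heq (by rw [h])
                omega
              · exact .inr hv
          · rw [Function.update_of_ne (hz w hwL j hjm)]
            exact hJ.2 z hz
        · rw [if_neg hjm]
          exact ⟨fun w' hw' b hb hv => hJ.1 w' hw' b hb (hv.imp (fun h => ⟨h.1, by omega⟩) id),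
            hJ.2⟩)
    rw [h2'] at inner
    exact ⟨fun w' hw' b hb hv => inner.1 w' hw' b hb (hv.imp (fun h => ⟨h, by omega⟩) id),
      inner.2⟩
  · rw [combineRow, SProg.run_ite_neg (by rw [hc, if_neg hwL])]
    refine ⟨fun w' hw' b hb hv => ?_, fun _ _ => rfl⟩
    rcases hv with rfl | hv
    · exact absurd hw' hwL
    · exact hv

theorem run_combine {s : Mem} (hm : 0 < s.var 1) (hK : s.var 0 + s.var 8 * s.var 1 ≤ s.var 2)
    (hmK : s.var 1 ≤ s.var 2) (hW : ∀ w < s.var 8, s.arr 2 w ≤ s.var 2) :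
    IsCombined (s.var 2) (s.var 0) (s.var 1) (s.var 8) (s.arr 0) (s.arr 1) (s.arr 2)
      ((combine.run s).arr 3) := by
  have hLm : s.var 8 ≤ s.var 8 * s.var 1 := Nat.le_mul_of_pos_right _ hm
  have h₀ := combineLeft.sameOutside_run s
  have k2 : (combineLeft.run s).var 2 = s.var 2 := h₀.1 2 (by decide)
  have hsecond := run_rep_induction (i := 10) (P := combineRow) (s := combineLeft.run s)
    (fun j r => (∀ w < s.var 8, ∀ b < s.var 1, w < j →
      r.arr 3 (s.var 0 + w * s.var 1 + b) = s.var 0 + s.arr 2 w * s.var 1 + s.arr 1 b) ∧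
      ∀ z, (∀ w < s.var 8, ∀ b < s.var 1, z ≠ s.var 0 + w * s.var 1 + b) →
        r.arr 3 z = (combineLeft.run s).arr 3 z)
    ⟨fun _ _ _ _ h => absurd h (Nat.not_lt_zero _), fun _ _ => rfl⟩
    (by
      intro w hw r hr hI
      rw [k2] at hw
      obtain ⟨e₁, e₂⟩ := run_combineRow (r := r) (w := w)
        ((hr.1 0 (by decide)).trans (h₀.1 0 (by decide)))
        ((hr.1 1 (by decide)).trans (h₀.1 1 (by decide)))
        ((hr.1 2 (by decide)).trans (h₀.1 2 (by decide)))
        ((hr.1 8 (by decide)).trans (h₀.1 8 (by decide)))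
        ((hr.2 1 (by decide)).trans (h₀.2 1 (by decide)))
        ((hr.2 2 (by decide)).trans (h₀.2 2 (by decide))) hw.le hmK hW
      refine ⟨fun w' hw' b hb hv => e₁ w' hw' b hb ?_, fun z hz => (e₂ z hz).trans (hI.2 z hz)⟩
      rcases (Nat.lt_succ_iff.1 hv).lt_or_eq with hv | hv
      · exact .inr (hI.1 w' hw' b hb hv)
      · exact .inl hv)
  rw [k2] at hsecond
  refine ⟨fun z hz => ?_, fun w hw b hb => hsecond.1 w hw b hb (by omega), fun z hz hz' => ?_⟩
  · exact (hsecond.2 z fun w _ b _ => by omega).trans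
      ((run_combineLeft (by omega)).trans (if_pos hz))
  · refine ((hsecond.2 z fun w hw b hb => ?_).trans
      ((run_combineLeft hz).trans (if_neg (by omega)))).ge
    have := add_mul_add_lt (n := s.var 0) hw hb
    omega

/-- Compute the ranks in the combined table. -/
def compare : SProg := .seq combine ranks

theorem run_compare {s : Mem} (hm : 0 < s.var 1) (hK : s.var 0 + s.var 8 * s.var 1 ≤ s.var 2)
    (hmK : s.var 1 ≤ s.var 2) (hW : ∀ w < s.var 8, s.arr 2 w ≤ s.var 2)
    (hA : ∀ z < s.var 0, s.arr 0 z < s.var 0) (hB : ∀ z < s.var 1, s.arr 1 z < s.var 1)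
    (hN : s.var 3 ≤ s.var 2) {x w b : ℕ} (hx : x < s.var 0) (hw : w < s.var 8) (hb : b < s.var 1) :
    ((compare.run s).arr 4 x < (compare.run s).arr 4 (s.var 0 + w * s.var 1 + b) ↔
      val (tableChildren (s.var 0) (s.arr 0)) (s.var 3) x <
        val (prodChildren (tableChildren (s.var 1) (s.arr 1)) (tableChildren (s.var 8) (s.arr 2)))
          (s.var 3) (b, w)) ∧
    ((compare.run s).arr 4 x = (compare.run s).arr 4 (s.var 0 + w * s.var 1 + b) ↔
      val (tableChildren (s.var 0) (s.arr 0)) (s.var 3) x =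
        val (prodChildren (tableChildren (s.var 1) (s.arr 1)) (tableChildren (s.var 8) (s.arr 2)))
          (s.var 3) (b, w)) := by
  have hC := run_combine hm hK hmK hW
  have h₀ := combine.sameOutside_run s
  have h2 : (combine.run s).var 2 = s.var 2 := h₀.1 2 (by decide)
  have h3 : (combine.run s).var 3 = s.var 3 := h₀.1 3 (by decide)
  have hlt := add_mul_add_lt (n := s.var 0) hw hb
  have hrun : ∀ x < s.var 2, (compare.run s).arr 4 x =
      rank (s.var 2) ((combine.run s).arr 3) (s.var 3) x := by
    intro x hx
    have := run_ranks (s := combine.run s) (x := x) (by omega) (by omega)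
    rwa [h2, h3] at this
  rw [hrun x (by omega), hrun _ (by omega), rank_lt_rank (by omega),
    rank_eq_rank (by omega) (by omega), hC.val_left hK _ hx, hC.val_right hK hA hB _ hw hb]
  exact ⟨Iff.rfl, Iff.rfl⟩

end RAM

/-- A root entry of at least `L` makes the root nobody's child, which is the effect of the condition
`0 < i` in `treeChildren`. -/
theorem val_table_eq_val_tree {L : ℕ} {W f : ℕ → ℕ} (h0 : L ≤ W 0)
    (h : ∀ i, 0 < i → i < L → W i = f i) (k : ℕ) {x : ℕ} (hx : x < L) :
    val (tableChildren L W) k x = val (treeChildren L f) k x := by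
  refine val_map (φ := id) {x | x < L} (fun x _ c hc => (mem_treeChildren.1 hc).1)
    (Set.injOn_id _) (fun x hx => ?_) k x hx
  ext c
  rw [Finset.image_id, mem_tableChildren, mem_treeChildren, id_eq]
  have hx : x < L := hx
  constructor
  · rintro ⟨hc, rfl⟩
    have : c ≠ 0 := by rintro rfl; omega
    exact ⟨hc, by omega, (h c (by omega) hc).symm⟩
  · rintro ⟨hc, h0, rfl⟩
    exact ⟨hc, h c h0 hc⟩

/-- The product of `B` and the tree `W` of size `L`, with one more node that has the parent `p`, is
at most `A`. -/
def Fits (n m N a b : ℕ) (A B : ℕ → ℕ) (L : ℕ) (W : ℕ → ℕ) (p : ℕ) : Prop :=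
  ¬ val (tableChildren n A) N a < val (prodChildren (tableChildren m B)
    (tableChildren (L + 1) (Function.update W L p))) N (b, 0)

/-- The tree `f` of size `M` in depth-first order is a quotient of `A` by `B`. -/
structure IsTreeQuotient (n m N a b : ℕ) (A B : ℕ → ℕ) (M : ℕ) (f d : ℕ → ℕ) : Prop where
  isDFS : IsDFS N M f d
  val_eq : val (tableChildren n A) N a =
    val (prodChildren (tableChildren m B) (treeChildren M f)) N (b, 0)
  hasHeight : HasHeight (tableChildren m B) N b

/-- The root of `B` has height `N`, so it can be cancelled: a test that involves only `A`, `B` and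
the candidate compares the candidate with the unknown quotient. -/
theorem IsTreeQuotient.fits_iff {n m N a b M L p : ℕ} {A B W f d : ℕ → ℕ}
    (h : IsTreeQuotient n m N a b A B M f d) (hL : 0 < L) (h0 : L < W 0)
    (hW : ∀ i, 0 < i → i < L → W i = f i) : Fits n m N a b A B L W p ↔
      val (treeChildren (L + 1) (Function.update f L p)) N 0 ≤ val (treeChildren M f) N 0 := by
  have hval : val (tableChildren (L + 1) (Function.update W L p)) N 0 =
      val (treeChildren (L + 1) (Function.update f L p)) N 0 := by
    refine val_table_eq_val_tree ?_ (fun i hi hiL => ?_) N (by omega)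
    · rw [Function.update_of_ne hL.ne]; omega
    · by_cases hiL' : i = L
      · subst hiL'; simp
      · rw [Function.update_of_ne hiL', Function.update_of_ne hiL', hW i hi (by omega)]
  rw [Fits, h.val_eq, not_lt, val_prod_le_iff h.hasHeight, hval]

/-! ### The greedy search for the tree of the quotient -/

namespace RAM

open SExpr

/-- The input and the parameters of the search are in their places. -/
structure IsSetUp (n m K N a b : ℕ) (A B : ℕ → ℕ) (s : Mem) : Prop where
  var_zero : s.var 0 = n
  var_one : s.var 1 = m
  var_two : s.var 2 = K
  var_three : s.var 3 = N
  var_a : s.var 13 = a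
  var_b : s.var 14 = b
  arr_zero : s.arr 0 = A
  arr_one : s.arr 1 = B

theorem IsSetUp.of_sameOutside {n m K N a b : ℕ} {A B : ℕ → ℕ} {s r : Mem} {V T : List ℕ}
    (h : IsSetUp n m K N a b A B s) (hr : SameOutside V T s r)
    (hV : ∀ i ∈ [0, 1, 2, 3, 13, 14], i ∉ V) (hT : ∀ i ∈ [0, 1], i ∉ T) :
    IsSetUp n m K N a b A B r :=
  ⟨(hr.1 0 (hV 0 (by decide))).trans h.var_zero, (hr.1 1 (hV 1 (by decide))).trans h.var_one,
    (hr.1 2 (hV 2 (by decide))).trans h.var_two, (hr.1 3 (hV 3 (by decide))).trans h.var_three,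
    (hr.1 13 (hV 13 (by decide))).trans h.var_a, (hr.1 14 (hV 14 (by decide))).trans h.var_b,
    (hr.2 0 (hT 0 (by decide))).trans h.arr_zero, (hr.2 1 (hT 1 (by decide))).trans h.arr_one⟩

/-- The assumptions on the input and the parameters of the search. -/
structure IsInput (n m K N a b : ℕ) (A B : ℕ → ℕ) : Prop where
  m_le : m ≤ K
  N_le : N ≤ K
  A_lt : ∀ z < n, A z < n
  B_lt : ∀ z < m, B z < m
  a_lt : a < n
  b_lt : b < m

theorem IsSetUp.run_compare {n m K N a b L : ℕ} {A B W : ℕ → ℕ} {s : Mem}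
    (h : IsSetUp n m K N a b A B s) (hi : IsInput n m K N a b A B) (hL : s.var 8 = L)
    (hL0 : 0 < L) (hW : s.arr 2 = W) (hWK : ∀ w < L, W w ≤ K) (hK : n + L * m ≤ K) :
    ((compare.run s).arr 4 a < (compare.run s).arr 4 (n + b) ↔
      val (tableChildren n A) N a <
        val (prodChildren (tableChildren m B) (tableChildren L W)) N (b, 0)) ∧
    ((compare.run s).arr 4 a = (compare.run s).arr 4 (n + b) ↔
      val (tableChildren n A) N a =
        val (prodChildren (tableChildren m B) (tableChildren L W)) N (b, 0)) := by
  obtain ⟨rfl, rfl, rfl, rfl, -, -, rfl, rfl⟩ := h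
  subst hL hW
  have := RAM.run_compare (s := s) (x := a) (w := 0) (b := b) (by have := hi.b_lt; omega) hK
    hi.m_le hWK hi.A_lt hi.B_lt hi.N_le hi.a_lt hL0 hi.b_lt
  simpa only [zero_mul, add_zero] using this

/-- If the tree with a new node with parent `var 7` fits, write `var 7 + 1` into variable `5`. -/
def recordParent : SProg :=
  .ite (lt (.get 4 (.var 13)) (.get 4 (.add (.var 0) (.var 14)))) .skip
    (.set 5 (.add (.var 7) (.const 1)))

/-- Try `var 7` as the parent of a new node. -/
def tryParent : SProg :=
  .ite (and (lt (.var 7) (.var 4)) (lt (.get 6 (.var 7)) (.var 3)))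
    (.seq (.store 2 (.var 4) (.var 7)) (.seq (.set 8 (.add (.var 4) (.const 1)))
      (.seq compare recordParent))) .skip

/-- Add a new node whose parent is `var 5 - 1`. -/
def addNode : SProg :=
  .ite (.var 5) (.seq (.store 2 (.var 4) (.sub (.var 5) (.const 1)))
    (.seq (.store 6 (.var 4) (.add (.get 6 (.sub (.var 5) (.const 1))) (.const 1)))
      (.set 4 (.add (.var 4) (.const 1))))) .skip

/-- Find the last node that can be the parent of a new node, and add this node. -/
def greedyRound : SProg := .seq (.set 5 (.const 0)) (.seq (.rep 7 tryParent) addNode)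

/-- The greedy construction of the tree, beginning with the root. -/
def greedy : SProg :=
  .seq (.set 4 (.const 1)) (.seq (.store 2 (.const 0) (.var 2)) (.rep 6 greedyRound))

/-- The first two clauses assume no room in the table: they keep the search well-formed even if no
quotient exists and the tree grows too large. Only the last clause needs the comparison to be
meaningful. -/
theorem run_tryParent {n m K N a b L p : ℕ} {A B : ℕ → ℕ} {r : Mem}
    (h : IsSetUp n m K N a b A B r) (hi : IsInput n m K N a b A B) (hL : r.var 4 = L) :
    (∀ i ≠ L, (tryParent.run (r.setVar 7 p)).arr 2 i = r.arr 2 i) ∧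
    ((tryParent.run (r.setVar 7 p)).var 5 = r.var 5 ∨
      (tryParent.run (r.setVar 7 p)).var 5 = p + 1 ∧ p < L) ∧
    (0 < L → n + (L + 1) * m ≤ K → (∀ w < L, r.arr 2 w ≤ K) →
      ((p < L ∧ r.arr 6 p < N ∧ Fits n m N a b A B L (r.arr 2) p) →
        (tryParent.run (r.setVar 7 p)).var 5 = p + 1) ∧
      (¬ (p < L ∧ r.arr 6 p < N ∧ Fits n m N a b A B L (r.arr 2) p) →
        (tryParent.run (r.setVar 7 p)).var 5 = r.var 5)) := by
  have hc : (and (lt (.var 7) (.var 4)) (lt (.get 6 (.var 7)) (.var 3))).eval (r.setVar 7 p) =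
      if p < L ∧ r.arr 6 p < N then 1 else 0 := by
    simp [SExpr.eval, hL, h.var_three]
  by_cases hp : p < L ∧ r.arr 6 p < N
  · rw [tryParent, SProg.run_ite_pos (by rw [hc, if_pos hp]; exact one_ne_zero)]
    obtain ⟨s, hs⟩ : ∃ s, s = ((r.setVar 7 p).setArr 2 L p).setVar 8 (L + 1) := ⟨_, rfl⟩
    have hrun : ((SProg.store 2 (.var 4) (.var 7)).seq ((SProg.set 8 (.add (.var 4)
        (.const 1))).seq (compare.seq recordParent))).run (r.setVar 7 p) =
        recordParent.run (compare.run s) := by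
      simp [SProg.run, SExpr.eval, hL, hs]
    rw [hrun]
    have hsame := compare.sameOutside_run s
    have hset : IsSetUp n m K N a b A B s := by
      rw [hs]
      exact ⟨by simp [h.var_zero], by simp [h.var_one], by simp [h.var_two], by simp [h.var_three],
        by simp [h.var_a], by simp [h.var_b], by simp [h.arr_zero], by simp [h.arr_one]⟩
    have hset' := hset.of_sameOutside hsame (by decide) (by decide)
    have hc' : (lt (.get 4 (.var 13)) (.get 4 (.add (.var 0) (.var 14)))).eval (compare.run s) =
        if (compare.run s).arr 4 a < (compare.run s).arr 4 (n + b) then 1 else 0 := by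
      simp [SExpr.eval, hset'.var_a, hset'.var_b, hset'.var_zero]
    have h2 : s.arr 2 = Function.update (r.arr 2) L p := by rw [hs]; simp
    have h5 : (compare.run s).var 5 = r.var 5 := (hsame.1 5 (by decide)).trans (by rw [hs]; simp)
    have h7 : (compare.run s).var 7 = p := (hsame.1 7 (by decide)).trans (by rw [hs]; simp)
    refine ⟨fun i hiL => ?_, ?_, fun hL0 hK hW => ?_⟩
    · rw [(recordParent.sameOutside_run (compare.run s)).2 2 (by decide), hsame.2 2 (by decide), h2,
        Function.update_of_ne hiL]
    · by_cases hlt : (compare.run s).arr 4 a < (compare.run s).arr 4 (n + b)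
      · rw [recordParent, SProg.run_ite_pos (by rw [hc', if_pos hlt]; exact one_ne_zero)]
        exact .inl h5
      · rw [recordParent, SProg.run_ite_neg (by rw [hc', if_neg hlt])]
        refine .inr ⟨?_, hp.1⟩
        simp [SProg.run, SExpr.eval, h7]
    · have hm : L ≤ L * m := Nat.le_mul_of_pos_right _ (by have := hi.b_lt; omega)
      have hK' : n + L * m + m ≤ K := by rw [Nat.succ_mul] at hK; omega
      have hcmp := (hset.run_compare hi (L := L + 1) (by rw [hs]; simp) (by omega) h2
        (by
          intro w hw
          by_cases hwL : w = L
          · subst hwL; rw [Function.update_self]; omega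
          · rw [Function.update_of_ne hwL]; exact hW w (by omega)) hK).1
      constructor
      · rintro ⟨-, -, hf⟩
        rw [recordParent, SProg.run_ite_neg (by rw [hc', if_neg (fun h => hf (hcmp.1 h))])]
        simp [SProg.run, SExpr.eval, h7]
      · intro hf
        have hlt : (compare.run s).arr 4 a < (compare.run s).arr 4 (n + b) :=
          hcmp.2 (by by_contra hlt; exact hf ⟨hp.1, hp.2, hlt⟩)
        rw [recordParent, SProg.run_ite_pos (by rw [hc', if_pos hlt]; exact one_ne_zero)]
        exact h5
  · rw [tryParent, SProg.run_ite_neg (by rw [hc, if_neg hp])]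
    exact ⟨fun _ _ => rfl, .inl rfl, fun _ _ _ =>
      ⟨fun h => absurd ⟨h.1, h.2.1⟩ hp, fun _ => rfl⟩⟩

/-- Parents are tried in increasing order and each success overwrites variable `5`. With enough room
it ends as one more than the last fitting parent, or as `0` if there is none. -/
theorem run_parents {n m K N a b L : ℕ} {A B : ℕ → ℕ} {s : Mem}
    (h : IsSetUp n m K N a b A B s) (hi : IsInput n m K N a b A B) (hL : s.var 4 = L)
    (h5 : s.var 5 = 0) :
    (∀ i ≠ L, ((SProg.rep 7 tryParent).run s).arr 2 i = s.arr 2 i) ∧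
    ((SProg.rep 7 tryParent).run s).var 5 ≤ L ∧
    (0 < L → n + (L + 1) * m ≤ K → (∀ w < L, s.arr 2 w ≤ K) →
      (∀ p < L, s.arr 6 p < N → Fits n m N a b A B L (s.arr 2) p →
        p < ((SProg.rep 7 tryParent).run s).var 5) ∧
      (((SProg.rep 7 tryParent).run s).var 5 ≠ 0 →
        s.arr 6 (((SProg.rep 7 tryParent).run s).var 5 - 1) < N ∧
        Fits n m N a b A B L (s.arr 2) (((SProg.rep 7 tryParent).run s).var 5 - 1))) := by
  have key := run_rep_induction (i := 7) (P := tryParent) (s := s)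
    (fun j r => (∀ i ≠ L, r.arr 2 i = s.arr 2 i) ∧ r.var 5 ≤ L ∧ r.var 5 ≤ j ∧
      (0 < L → n + (L + 1) * m ≤ K → (∀ w < L, s.arr 2 w ≤ K) →
      (∀ p < L, p < j → s.arr 6 p < N → Fits n m N a b A B L (s.arr 2) p → p < r.var 5) ∧
      (r.var 5 ≠ 0 →
        s.arr 6 (r.var 5 - 1) < N ∧ Fits n m N a b A B L (s.arr 2) (r.var 5 - 1))))
    ⟨fun _ _ => rfl, by omega, by omega, fun _ _ _ => ⟨fun _ _ hp => absurd hp (Nat.not_lt_zero _),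
      fun hne => absurd h5 hne⟩⟩
    (by
      rintro j hj r hr ⟨e₁, e₂, e₃, e₄⟩
      have hr' := h.of_sameOutside hr (by decide) (by decide)
      obtain ⟨g₁, g₂, g₃⟩ := run_tryParent (p := j) hr' hi ((hr.1 4 (by decide)).trans hL)
      refine ⟨fun i hiL => (g₁ i hiL).trans (e₁ i hiL), by omega, by omega, fun hL0 hK hW => ?_⟩
      obtain ⟨e₅, e₆⟩ := e₄ hL0 hK hW
      obtain ⟨g₄, g₅⟩ := g₃ hL0 hK (fun w hw => by rw [e₁ w hw.ne]; exact hW w hw)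
      have hF : Fits n m N a b A B L (r.arr 2) = Fits n m N a b A B L (s.arr 2) := by
        have : ∀ p, Function.update (r.arr 2) L p = Function.update (s.arr 2) L p := by
          intro p
          funext i
          by_cases hiL : i = L
          · subst hiL; simp
          · rw [Function.update_of_ne hiL, Function.update_of_ne hiL, e₁ i hiL]
        funext p
        rw [Fits, Fits, this]
      have h6 : r.arr 6 = s.arr 6 := hr.2 6 (by decide)
      rw [hF, h6] at g₄ g₅
      by_cases hc : j < L ∧ s.arr 6 j < N ∧ Fits n m N a b A B L (s.arr 2) j
      · rw [g₄ hc]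
        exact ⟨fun p _ hp _ _ => hp, fun _ => by rw [Nat.add_sub_cancel]; exact hc.2⟩
      · rw [g₅ hc]
        refine ⟨fun p hp hpj hd hf => ?_, e₆⟩
        rcases (Nat.lt_succ_iff.1 hpj).lt_or_eq with hpj | rfl
        · exact e₅ p hp hpj hd hf
        · exact absurd ⟨hp, hd, hf⟩ hc)
  obtain ⟨e₁, e₂, -, e₄⟩ := key
  refine ⟨e₁, e₂, fun hL0 hK hW => ?_⟩
  obtain ⟨e₅, e₆⟩ := e₄ hL0 hK hW
  refine ⟨fun p hp => e₅ p hp ?_, e₆⟩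
  have hm : L ≤ L * m := Nat.le_mul_of_pos_right _ (by have := hi.b_lt; omega)
  rw [Nat.succ_mul] at hK
  have := h.var_two
  omega

/-- The state of the search: variable `4` holds the size of the tree in array `2`. -/
def SearchInvariant (n m K N a b : ℕ) (A B : ℕ → ℕ) (j : ℕ) (r : Mem) : Prop :=
  (0 < r.var 4 ∧ r.arr 2 0 = K ∧ ∀ i, 0 < i → i < r.var 4 → r.arr 2 i < i) ∧ r.var 4 ≤ j + 1 ∧
  ∀ (M : ℕ) (f d : ℕ → ℕ), IsTreeQuotient n m N a b A B M f d → n + (M + 1) * m ≤ K →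
    r.var 4 = min (j + 1) M ∧ (∀ i, 0 < i → i < r.var 4 → r.arr 2 i = f i) ∧
      ∀ i < r.var 4, r.arr 6 i = d i

/-- Given a quotient tree, the right parent `f L` fits, because the extended segment is part of the
tree. Later parents of depth less than `N` fail by `IsDFS.val_lt_extend`, so the last fitting parent
is `f L`. Once the tree is complete, the same lemma excludes all parents and the tree stays as it
is. -/
theorem run_greedyRound {n m K N a b j : ℕ} {A B : ℕ → ℕ} {r : Mem}
    (h : IsSetUp n m K N a b A B r) (hi : IsInput n m K N a b A B) (hj : j < K)
    (hI : SearchInvariant n m K N a b A B j r) :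
    SearchInvariant n m K N a b A B (j + 1) (greedyRound.run (r.setVar 6 j)) := by
  obtain ⟨⟨i₁, i₂, i₃⟩, i₄, i₅⟩ := hI
  obtain ⟨L, hL⟩ : ∃ L, L = r.var 4 := ⟨_, rfl⟩
  rw [← hL] at i₁ i₃ i₄
  obtain ⟨s, hs⟩ : ∃ s, s = (r.setVar 6 j).setVar 5 0 := ⟨_, rfl⟩
  have hset : IsSetUp n m K N a b A B s := by
    rw [hs]
    exact ⟨by simp [h.var_zero], by simp [h.var_one], by simp [h.var_two], by simp [h.var_three],
      by simp [h.var_a], by simp [h.var_b], by simp [h.arr_zero], by simp [h.arr_one]⟩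
  have hs4 : s.var 4 = L := by rw [hs, hL]; simp
  have hs2 : s.arr 2 = r.arr 2 := by rw [hs]; simp
  have hs6 : s.arr 6 = r.arr 6 := by rw [hs]; simp
  obtain ⟨g₁, g₂, g₃⟩ := run_parents hset hi hs4 (by rw [hs]; simp)
  have hsame := (SProg.rep 7 tryParent).sameOutside_run s
  have hrun : greedyRound.run (r.setVar 6 j) = addNode.run ((SProg.rep 7 tryParent).run s) := by
    rw [hs]; rfl
  rw [hrun]
  set q := (SProg.rep 7 tryParent).run s with hq
  have hq4 : q.var 4 = L := (hsame.1 4 (by decide)).trans hs4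
  have hq6 : q.arr 6 = r.arr 6 := (hsame.2 6 (by decide)).trans hs6
  rw [hs2] at g₁ g₃
  rw [hs6] at g₃
  have hWK : ∀ w < L, r.arr 2 w ≤ K := by
    intro w hw
    rcases Nat.eq_zero_or_pos w with rfl | hw0
    · exact i₂.le
    · have := i₃ w hw0 hw; omega
  -- the parent that is found
  have hfound : ∀ (M : ℕ) (f d : ℕ → ℕ), IsTreeQuotient n m N a b A B M f d →
      n + (M + 1) * m ≤ K → (L < M → q.var 5 = f L + 1) ∧ (M ≤ L → q.var 5 = 0) := by
    intro M f d hD hMK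
    obtain ⟨e₁, e₂, e₃⟩ := i₅ M f d hD hMK
    rw [← hL] at e₁ e₂ e₃
    have hLM : L ≤ M := by omega
    have hLK : n + (L + 1) * m ≤ K :=
      le_trans (by gcongr) hMK
    have hm : L + 1 ≤ (L + 1) * m := Nat.le_mul_of_pos_right _ (by have := hi.b_lt; omega)
    have hfits := fun p => hD.fits_iff (p := p) i₁ (W := r.arr 2)
      (by have := hi.a_lt; omega) e₂
    obtain ⟨k₁, k₂⟩ := g₃ i₁ hLK hWK
    have hno : ∀ p < L, r.arr 6 p < N → (L < M → f L < p) →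
        ¬ Fits n m N a b A B L (r.arr 2) p := by
      intro p hp hd hpL hf
      rw [e₃ p hp] at hd
      exact absurd ((hfits p).1 hf) (not_le.2 (hD.isDFS.val_lt_extend hLM hp hd hpL))
    constructor
    · intro hlt
      have hfL := hD.isDFS.lt L i₁ hlt
      have hdL := hD.isDFS.dep_succ L i₁ hlt
      have hdL' := hD.isDFS.dep_le L hlt
      have hpos := k₁ (f L) hfL (by rw [e₃ _ hfL]; omega) ((hfits _).2 (by
        rw [Function.update_eq_self]
        exact val_treeChildren_mono hlt N 0))
      obtain ⟨k₃, k₄⟩ := k₂ (by omega)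
      by_contra hne
      exact hno _ (by omega) k₃ (fun _ => by omega) k₄
    · intro hle
      by_contra hne
      obtain ⟨k₃, k₄⟩ := k₂ hne
      exact hno _ (by omega) k₃ (fun h => by omega) k₄
  by_cases h5 : q.var 5 = 0
  · rw [addNode, SProg.run_ite_neg (by simpa [SExpr.eval] using h5)]
    refine ⟨⟨?_, ?_, fun i hi0 hiL => ?_⟩, ?_, fun M f d hD hMK => ?_⟩
    · change 0 < q.var 4; omega
    · change q.arr 2 0 = K; rw [g₁ 0 i₁.ne, i₂]
    · change q.arr 2 i < i
      change i < q.var 4 at hiL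
      rw [g₁ i (by omega)]
      exact i₃ i hi0 (by omega)
    · change q.var 4 ≤ _; omega
    · obtain ⟨e₁, e₂, e₃⟩ := i₅ M f d hD hMK
      obtain ⟨k₁, -⟩ := hfound M f d hD hMK
      rw [← hL] at e₁ e₂ e₃
      change q.var 4 = _ ∧ (∀ i, 0 < i → i < q.var 4 → q.arr 2 i = f i) ∧
        ∀ i < q.var 4, q.arr 6 i = d i
      rw [hq4, hq6]
      refine ⟨?_, fun i hi0 hiL => by rw [g₁ i hiL.ne]; exact e₂ i hi0 hiL, e₃⟩
      by_cases hlt : L < M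
      · have := k₁ hlt; omega
      · omega
  · have hrun' : addNode.run q = ((q.setArr 2 L (q.var 5 - 1)).setArr 6 L
        (r.arr 6 (q.var 5 - 1) + 1)).setVar 4 (L + 1) := by
      rw [addNode, SProg.run_ite_pos (by simpa [SExpr.eval] using h5)]
      simp [SProg.run, SExpr.eval, hq4, hq6]
    have r4 : (addNode.run q).var 4 = L + 1 := by rw [hrun']; simp
    have r2 : (addNode.run q).arr 2 = Function.update (q.arr 2) L (q.var 5 - 1) := by
      rw [hrun']; simp
    have r6 : (addNode.run q).arr 6 = Function.update (r.arr 6) L (r.arr 6 (q.var 5 - 1) + 1) := by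
      rw [hrun']; simp [hq6]
    unfold SearchInvariant
    rw [r4, r2, r6]
    refine ⟨⟨by omega, ?_, fun i hi0 hiL => ?_⟩, by omega, fun M f d hD hMK => ?_⟩
    · rw [Function.update_of_ne i₁.ne, g₁ 0 i₁.ne, i₂]
    · by_cases hiL' : i = L
      · subst hiL'; rw [Function.update_self]; omega
      · rw [Function.update_of_ne hiL', g₁ i hiL']
        exact i₃ i hi0 (by omega)
    · obtain ⟨e₁, e₂, e₃⟩ := i₅ M f d hD hMK
      obtain ⟨k₁, k₂⟩ := hfound M f d hD hMK
      rw [← hL] at e₁ e₂ e₃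
      have hlt : L < M := by
        by_contra hle
        exact h5 (k₂ (not_lt.1 hle))
      have k₃ := k₁ hlt
      have hfL := hD.isDFS.lt L i₁ hlt
      refine ⟨by omega, fun i hi0 hiL => ?_, fun i hiL => ?_⟩
      · by_cases hiL' : i = L
        · subst hiL'; rw [Function.update_self]; omega
        · rw [Function.update_of_ne hiL', g₁ i hiL']
          exact e₂ i hi0 (by omega)
      · by_cases hiL' : i = L
        · subst hiL'
          rw [Function.update_self, k₃, Nat.add_sub_cancel, e₃ _ hfL,
            hD.isDFS.dep_succ _ i₁ hlt]
        · rw [Function.update_of_ne hiL']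
          exact e₃ i (by omega)

theorem run_greedy {n m K N a b : ℕ} {A B : ℕ → ℕ} {s : Mem}
    (h : IsSetUp n m K N a b A B s) (hi : IsInput n m K N a b A B) (h6 : s.arr 6 0 = 0) :
    SearchInvariant n m K N a b A B K (greedy.run s) := by
  obtain ⟨r, hr⟩ : ∃ r, r = (s.setVar 4 1).setArr 2 0 K := ⟨_, rfl⟩
  have hset : IsSetUp n m K N a b A B r := by
    rw [hr]
    exact ⟨by simp [h.var_zero], by simp [h.var_one], by simp [h.var_two], by simp [h.var_three],
      by simp [h.var_a], by simp [h.var_b], by simp [h.arr_zero], by simp [h.arr_one]⟩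
  have hrun : greedy.run s = (SProg.rep 6 greedyRound).run r := by
    simp only [greedy, SProg.run, SExpr.eval, hr]
    simp [h.var_two]
  have r4 : r.var 4 = 1 := by rw [hr]; simp
  have key := run_rep_induction (i := 6) (P := greedyRound) (s := r)
    (SearchInvariant n m K N a b A B)
    (by
      unfold SearchInvariant
      rw [r4]
      refine ⟨⟨one_pos, by rw [hr]; simp, fun i _ _ => by omega⟩, by omega,
        fun M f d hD _ => ⟨?_, fun i _ _ => by omega, fun i hi => ?_⟩⟩
      · have := hD.isDFS.pos; omega
      · obtain rfl : i = 0 := by omega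
        have h6' : r.arr 6 0 = s.arr 6 0 := by rw [hr]; simp
        rw [hD.isDFS.dep_zero, h6', h6])
    (by
      intro j hj q hq hI
      exact run_greedyRound (hset.of_sameOutside hq (by decide) (by decide)) hi
        (by rw [hset.var_two] at hj; exact hj) hI)
  rw [hset.var_two] at key
  rw [hrun]
  exact key

end RAM

/-! ### Quotients of dendrons -/

theorem FDS.val_mul (A B : FDS) (k : ℕ) (x : A.State) (y : B.State) :
    val (A * B).children k (x, y) = Value.prod k (val A.children k x) (val B.children k y) := by
  rw [children_mul, val_prod]

theorem FDS.IsRoot.exists_isTreeQuotient {n m N : ℕ} {f : Fin n → Fin n} {g : Fin m → Fin m}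
    {C : FDS} {a : Fin n} {b : Fin m} {c : C.State} (ha : (FDS.ofTable f).IsRoot a)
    (hb : (FDS.ofTable g).IsRoot b) (hc : C.IsRoot c)
    (h : (FDS.ofTable f).Iso (FDS.ofTable g * C)) :
    ∃ (M : ℕ) (F d : ℕ → ℕ), IsTreeQuotient n m N a b (RAM.table f) (RAM.table g) M F d ∧
      M ≤ Nat.card C.State * (N + 1) ∧ val (treeChildren M F) N 0 = val C.children N c := by
  classical
  obtain ⟨M, F, d, hF, hM, hval⟩ := exists_isDFS C.children N c
  refine ⟨M, F, d, ⟨hF, ?_, ?_⟩, hM ▸ FDS.sum_treeSize_le C N c, hval⟩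
  · rw [val_prod, hval, val_ofTable g, val_ofTable f]
    exact (h.val_root ha (hb.mul hc) N).trans (FDS.val_mul (FDS.ofTable g) C N b c)
  · exact (hasHeight_iff_of_val_eq le_rfl (val_ofTable g N b)).2 (hb.hasHeight N)

theorem IsDFS.isRoot_cutFirst {N M s : ℕ} {F d : ℕ → ℕ} (h : IsDFS N M F d) (hs : s < M)
    {e : Fin (M - s) → Fin (M - s)} (he : ∀ i, (e i : ℕ) = cutFirst s F i) :
    (FDS.ofTable e).IsRoot ⟨0, by omega⟩ := by
  refine isRoot_ofTable e (by omega) (Fin.ext (by simp [he, cutFirst])) fun i hi => ?_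
  have := h.lt (i + s) (by omega) (by omega)
  rw [he, cutFirst, if_neg hi.ne']
  omega

/-- Each step lowers the depth by one or leads to the root, so depths bound the number of steps. The
number of states would not serve as a bound, since the table is not yet known to be as small as `C`.
-/
theorem IsDFS.iterate_cutFirst {N M s : ℕ} {F d : ℕ → ℕ} (h : IsDFS N M F d) (hs : s < M)
    {e : Fin (M - s) → Fin (M - s)} (he : ∀ i, (e i : ℕ) = cutFirst s F i)
    (x : (FDS.ofTable e).State) : (FDS.ofTable e).step^[N] x = ⟨0, by omega⟩ := by
  have hr := h.isRoot_cutFirst hs he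
  suffices key : ∀ (i : ℕ) (hi : i < M - s), 0 < i →
      (FDS.ofTable e).step^[d (i + s)] ⟨i, hi⟩ = ⟨0, by omega⟩ by
    obtain ⟨i, hi⟩ := x
    rcases Nat.eq_zero_or_pos i with rfl | hi0
    · exact hr.iterate_root N
    · exact hr.iterate_of_le (h.dep_le _ (by omega)) (key i hi hi0)
  intro i
  induction i using Nat.strong_induction_on with
  | _ i ih =>
    intro hi hi0
    have hlt := h.lt (i + s) (by omega) (by omega)
    have hstep : ((FDS.ofTable e).step ⟨i, hi⟩ : Fin (M - s)).1 = F (i + s) - s := by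
      change ((e ⟨i, hi⟩ : Fin (M - s)) : ℕ) = _
      rw [he, cutFirst, if_neg hi0.ne']
    rw [h.dep_succ _ (by omega) (by omega)]
    change (FDS.ofTable e).step^[d (F (i + s))] ((FDS.ofTable e).step ⟨i, hi⟩) = _
    by_cases hle : F (i + s) ≤ s
    · have : (FDS.ofTable e).step ⟨i, hi⟩ = ⟨0, by omega⟩ := Fin.ext (by rw [hstep]; simp; omega)
      rw [this]
      exact hr.iterate_root _
    · have : (FDS.ofTable e).step ⟨i, hi⟩ = ⟨F (i + s) - s, by omega⟩ := Fin.ext hstep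
      rw [this]
      have := ih (F (i + s) - s) (by omega) (by omega) (by omega)
      rwa [Nat.sub_add_cancel (by omega)] at this

/-- A dendron is recovered from the tree of its root by cutting off the subtree of the root. -/
theorem IsDFS.iso_cutFirst {N M s : ℕ} {F d : ℕ → ℕ} (h : IsDFS (N + 1) M F d) {C : FDS}
    {c : C.State} (hc : C.IsRoot c) (hN : Nat.card C.State ≤ N)
    (hval : val (treeChildren M F) (N + 1) 0 = val C.children (N + 1) c)
    (hs : 0 < s) (hsM : s < M) (hs₁ : s + 1 < M → F (s + 1) = 0)
    (hs₂ : ∀ j, 2 ≤ j → j ≤ s → F j ≠ 0)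
    {e : Fin (M - s) → Fin (M - s)} (he : ∀ i, (e i : ℕ) = cutFirst s F i) :
    C.Iso (FDS.ofTable e) := by
  refine FDS.iso_of_val_eq hc (h.isRoot_cutFirst hsM he) (N := N + 1)
    (hc.iterate_card (by omega)) (h.iterate_cutFirst hsM he) ?_
  rw [← h.val_cutFirst hc hN hval hs hsM hs₁ hs₂, ← val_ofTable]
  symm
  refine val_map (φ := id) {x | x < M - s} (fun x _ c hc => (mem_tableChildren.1 hc).1)
    (Set.injOn_id _) (fun x _ => ?_) (N + 1) 0 (show 0 < M - s by omega)
  ext i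
  rw [Finset.image_id, mem_tableChildren, mem_tableChildren]
  refine and_congr_right fun hi => ?_
  simp [RAM.table, hi, he]

/-! ### Extraction of the dendron, verification, and the complete program -/

namespace RAM

open SExpr

/-- The number of nodes, other than the root, that come before the second child of the root. -/
def shift : SExpr :=
  .sum 20 (and (lt (.const 0) (.var 20)) (and (lt (.var 20) (.var 4))
    (all 21 (neg (and (lt (.const 1) (.var 21)) (and (lt (.var 21) (.add (.var 20) (.const 1)))
      (eq (.get 2 (.var 21)) (.const 0))))))))

theorem eval_shift (s : Mem) : shift.eval s = ((Finset.range (s.var 2)).filter fun i =>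
    0 < i ∧ i < s.var 4 ∧ ∀ j < s.var 2, 1 < j → j ≤ i → s.arr 2 j ≠ 0).card := by
  rw [shift, SExpr.eval, Finset.card_filter]
  refine Finset.sum_congr rfl fun i _ => ?_
  simp [SExpr.eval, Nat.pos_iff_ne_zero]

theorem eval_shift_lt {s : Mem} (h : 0 < s.var 4) : shift.eval s < s.var 4 := by
  rw [eval_shift]
  refine lt_of_le_of_lt (Finset.card_le_card (t := Finset.Ico 1 (s.var 4)) fun i hi => ?_) ?_
  · rw [Finset.mem_filter] at hi
    exact Finset.mem_Ico.2 ⟨hi.2.1, hi.2.2.1⟩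
  · rw [Nat.card_Ico]; omega

/-- Let `e ≥ 2` be the first position that is a child of the root or the end of the list. The first
branch is `1, …, e - 1`, and these are the indices that `shift` counts. -/
theorem eval_shift_spec {s : Mem} {L : ℕ} (h4 : s.var 4 = L) (h : 2 ≤ L) (hK : L ≤ s.var 2) :
    0 < shift.eval s ∧ (shift.eval s + 1 < L → s.arr 2 (shift.eval s + 1) = 0) ∧
      ∀ j, 2 ≤ j → j ≤ shift.eval s → s.arr 2 j ≠ 0 := by
  classical
  have hex : ∃ e, 2 ≤ e ∧ (L ≤ e ∨ s.arr 2 e = 0) := ⟨L, h, .inl le_rfl⟩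
  obtain ⟨e, he⟩ : ∃ e, e = Nat.find hex := ⟨_, rfl⟩
  have h₁ := Nat.find_spec hex
  have h₂ : ∀ j < e, 2 ≤ j → j < L ∧ s.arr 2 j ≠ 0 := fun j hj hj2 => by
    have := Nat.find_min hex (he ▸ hj)
    push Not at this
    exact this hj2
  rw [← he] at h₁
  have heL : e ≤ L := by rw [he]; exact Nat.find_min' hex ⟨h, .inl le_rfl⟩
  have hval : shift.eval s = e - 1 := by
    rw [eval_shift, ← Nat.card_Ico]
    congr 1
    ext i
    rw [Finset.mem_filter, Finset.mem_Ico, Finset.mem_range, h4]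
    constructor
    · rintro ⟨-, hi0, hiL, hi⟩
      refine ⟨hi0, ?_⟩
      by_contra hei
      rcases h₁.2 with h₃ | h₃
      · omega
      · exact hi e (by omega) (by omega) (by omega) h₃
    · rintro ⟨hi0, hie⟩
      exact ⟨by omega, hi0, by omega, fun j _ hj hji => (h₂ j (by omega) (by omega)).2⟩
  rw [hval]
  refine ⟨by omega, fun hlt => ?_, fun j hj hje => (h₂ j (by omega) hj).2⟩
  rw [Nat.sub_add_cancel (by omega)] at hlt ⊢
  rcases h₁.2 with h₃ | h₃
  · omega
  · exact h₃

/-- Cut off the first subtree of the tree in array `2`, and turn the rest into the table of a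
dendron of size `var 8`. -/
def extract : SProg :=
  .seq (.store 2 (.const 0) (.const 0)) (.seq (.set 12 shift)
    (.seq (.set 8 (.sub (.var 4) (.var 12)))
      (.seq (.rep 10 (.store 7 (.var 10) (.sub (.get 2 (.add (.var 10) (.var 12))) (.var 12))))
        (.rep 10 (.store 2 (.var 10) (.get 7 (.var 10)))))))

theorem run_extract {s : Mem} {σ : ℕ} {W : ℕ → ℕ} (hW : W = Function.update (s.arr 2) 0 0)
    (hσ : σ = shift.eval (s.setArr 2 0 0)) :
    (extract.run s).var 8 = s.var 4 - σ ∧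
      ∀ x < s.var 2, (extract.run s).arr 2 x = W (x + σ) - σ := by
  obtain ⟨r, hr⟩ : ∃ r, r = ((s.setArr 2 0 0).setVar 12 σ).setVar 8 (s.var 4 - σ) := ⟨_, rfl⟩
  obtain ⟨P, hP⟩ : ∃ P : SProg, P = .rep 10 (.store 7 (.var 10)
    (.sub (.get 2 (.add (.var 10) (.var 12))) (.var 12))) := ⟨_, rfl⟩
  have hrun : extract.run s = (SProg.rep 10 (.store 2 (.var 10) (.get 7 (.var 10)))).run
      (P.run r) := by
    simp [extract, SProg.run, SExpr.eval, hr, hP, ← hσ]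
  have h₁ := P.sameOutside_run r
  have h₂ := (SProg.rep 10 (.store 2 (.var 10) (.get 7 (.var 10)))).sameOutside_run (P.run r)
  rw [← hrun] at h₂
  have r2 : (P.run r).var 2 = s.var 2 := (h₁.1 2 (by rw [hP]; decide)).trans (by simp [hr])
  refine ⟨(h₂.1 8 (by decide)).trans ((h₁.1 8 (by rw [hP]; decide)).trans (by simp [hr])),
    fun x hx => ?_⟩
  rw [hrun, run_rep_store ((P.run r).arr 7) (fun j _ q hq => by
    simp [SExpr.eval, hq.2 7 (by decide)]), r2, if_pos hx, hP,
    run_rep_store fun x => W (x + σ) - σ]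
  · simp [hr, hx]
  · intro j _ q hq
    have h12 : q.var 12 = σ := (hq.1 12 (by decide)).trans (by simp [hr])
    have h2 : q.arr 2 = W := (hq.2 2 (by decide)).trans (by simp [hr, hW])
    simp [SExpr.eval, h12, h2]

/-- Return the table of size `var 8` in array `2` if the comparison was successful. -/
def report : SProg :=
  .ite (and (eq (.get 4 (.var 13)) (.get 4 (.add (.var 0) (.var 14))))
      (eq (mul (.var 1) (.var 8)) (.var 0)))
    (.seq (.rep 10 (.store 0 (.var 10) (.get 2 (.var 10))))
      (.seq (.set 1 (.var 8)) (.set 0 (.const 1))))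
    (.set 0 (.const 0))

theorem run_report {n m K N a b l : ℕ} {A B : ℕ → ℕ} {s : Mem} (h : IsSetUp n m K N a b A B s)
    (h8 : s.var 8 = l) (hm : 0 < m) (hmK : m ≤ K) (hnK : n < K) :
    ((s.arr 4 a = s.arr 4 (n + b) ∧ m * l = n) →
      (report.run s).var 0 = 1 ∧ (report.run s).var 1 = l ∧
      ∀ x < K, (report.run s).arr 0 x = s.arr 2 x) ∧
    (¬ (s.arr 4 a = s.arr 4 (n + b) ∧ m * l = n) → (report.run s).var 0 = 0) := by
  -- The computed product is capped; but as `n < K` and `0 < m`, neither equation holds when `l ≥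
  -- K`.
  have hl : m * min l K = n ↔ m * l = n := by
    rcases le_total l K with hlK | hlK
    · rw [min_eq_left hlK]
    · rw [min_eq_right hlK]
      have h₁ := Nat.le_mul_of_pos_left K hm
      have h₂ := Nat.mul_le_mul_left m hlK
      omega
  have hc : (and (eq (.get 4 (.var 13)) (.get 4 (.add (.var 0) (.var 14))))
      (eq (mul (.var 1) (.var 8)) (.var 0))).eval s =
      if s.arr 4 a = s.arr 4 (n + b) ∧ m * l = n then 1 else 0 := by
    have hmul := eval_mul (.var 1) (.var 8) s (x := m) (y := l)
      (by simp [SExpr.eval, h.var_one]) (by simp [SExpr.eval, h8])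
    rw [h.var_two, min_eq_left hmK] at hmul
    simp [SExpr.eval, h.var_a, h.var_b, h.var_zero, hmul, hl]
  constructor
  · intro hs
    rw [report, SProg.run_ite_pos (by rw [hc, if_pos hs]; exact one_ne_zero)]
    have h₁ := (SProg.rep 10 (.store 0 (.var 10) (.get 2 (.var 10)))).sameOutside_run s
    refine ⟨by simp [SProg.run, SExpr.eval], ?_, fun x hx => ?_⟩
    · have := (h₁.1 8 (by decide)).trans h8
      simpa [SProg.run, SExpr.eval] using this
    · change ((SProg.rep 10 (.store 0 (.var 10) (.get 2 (.var 10)))).run s).arr 0 x = _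
      rw [run_rep_store (s.arr 2) (fun j _ q hq => by simp [SExpr.eval, hq.2 2 (by decide)]),
        h.var_two, if_pos hx]
  · intro hs
    rw [report, SProg.run_ite_neg (by rw [hc, if_neg hs])]
    simp [SProg.run, SExpr.eval]

/-- Division of dendrons. -/
def divide : SProg :=
  .seq (.set 13 (fixpoint 0 0)) (.seq (.set 14 (fixpoint 1 1))
    (.seq greedy (.seq extract (.seq compare report))))

/-- The memory holds the quotient of `f` by `g`, or the report that there is none. -/
def IsQuotient {n m : ℕ} (f : Fin n → Fin n) (g : Fin m → Fin m) (s : Mem) : Prop :=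
  (∃ (l : ℕ) (h : Fin l → Fin l), s.Returns h ∧ (FDS.ofTable h).IsDendron ∧
      (FDS.ofTable f).Iso (FDS.ofTable g * FDS.ofTable h) ∧
      ∀ C : FDS, C.IsDendron → (FDS.ofTable f).Iso (FDS.ofTable g * C) →
        C.Iso (FDS.ofTable h)) ∨
    (s.ReportsNone ∧ ∀ C : FDS, C.IsDendron → ¬ (FDS.ofTable f).Iso (FDS.ofTable g * C))

theorem table_lt {n : ℕ} (f : Fin n → Fin n) : ∀ z < n, table f z < n := by
  intro z hz
  simp [table, hz]

theorem table_eq_self_iff {n : ℕ} {f : Fin n → Fin n} {r : Fin n} (hr : (FDS.ofTable f).IsRoot r) :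
    ∀ x < n, table f x = x ↔ x = r := by
  intro x hx
  rw [table, dif_pos hx]
  constructor
  · intro h
    have := hr.eq_of_step_eq (x := (⟨x, hx⟩ : Fin n)) (Fin.ext h)
    exact congrArg Fin.val this
  · rintro rfl
    exact congrArg Fin.val hr.step_eq

/-- A positive answer is correct however the table was found: equal values at level `N ≥ n` and
matching sizes give an isomorphism, and cancellation gives uniqueness. That the search finds every
existing quotient, `hex`, is used only to justify a negative answer. -/
theorem isQuotient_of_run {n m K N l : ℕ} {f : Fin n → Fin n} {g : Fin m → Fin m} {a : Fin n}
    {b : Fin m} (ha : (FDS.ofTable f).IsRoot a) (hb : (FDS.ofTable g).IsRoot b) {s : Mem}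
    (h : IsSetUp n m K N a b (table f) (table g) s) (hN : n ≤ N) (hNK : N ≤ K) (hmK : m ≤ K)
    (hK : 2 * n ≤ K) (h8 : s.var 8 = l) (hl : 0 < l) (h0 : s.arr 2 0 = 0)
    (hW : ∀ i, 0 < i → i < l → i < K → s.arr 2 i < i)
    (hex : ∀ C : FDS, C.IsDendron → (FDS.ofTable f).Iso (FDS.ofTable g * C) →
      ∀ e : Fin l → Fin l, (∀ i : Fin l, (i : ℕ) < K → (e i : ℕ) = s.arr 2 i) →
        C.Iso (FDS.ofTable e)) :
    IsQuotient f g (report.run (compare.run s)) := by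
  have hn : 0 < n := a.pos
  have hm : 0 < m := b.pos
  have hsame := compare.sameOutside_run s
  have hset := h.of_sameOutside hsame (by decide) (by decide)
  have hin : IsInput n m K N a b (table f) (table g) :=
    ⟨hmK, hNK, table_lt f, table_lt g, a.2, b.2⟩
  have c8 : (compare.run s).var 8 = l := (hsame.1 8 (by decide)).trans h8
  have c2 : (compare.run s).arr 2 = s.arr 2 := hsame.2 2 (by decide)
  obtain ⟨r₁, r₂⟩ := run_report hset c8 hm hmK (by omega)
  have hW' : ∀ i < l, i < K → s.arr 2 i < l := by
    intro i hi hiK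
    rcases Nat.eq_zero_or_pos i with rfl | hi0
    · omega
    · have := hW i hi0 hi hiK; omega
  obtain ⟨e, he⟩ : ∃ e : Fin l → Fin l, ∀ i : Fin l, (i : ℕ) < K → (e i : ℕ) = s.arr 2 i := by
    -- Entries from `K` on are not controlled and get a dummy value, which is harmless: `m * l = n`
    -- forces `l < K`.
    refine ⟨fun i => if hi : (i : ℕ) < K then ⟨s.arr 2 i, hW' i i.2 hi⟩ else i, fun i hi => ?_⟩
    simp [hi]
  -- the comparison checks the table
  have hcmp : m * l = n → (((compare.run s).arr 4 a = (compare.run s).arr 4 (n + b)) ↔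
      val (FDS.ofTable f).children N a =
        val (FDS.ofTable g * FDS.ofTable e).children N (b, ⟨0, hl⟩)) ∧
      (FDS.ofTable e).IsRoot ⟨0, hl⟩ ∧ l < K := by
    intro hml
    have hln : l ≤ n := hml ▸ Nat.le_mul_of_pos_left l hm
    have hlm : l * m = n := by rw [mul_comm, hml]
    refine ⟨(h.run_compare hin h8 hl rfl (fun w hw => (hW' w hw (by omega)).le.trans (by omega))
      (by omega)).2.trans ?_, isRoot_ofTable e hl (Fin.ext ?_) fun i hi => ?_, by omega⟩
    · have : val (tableChildren l (table e)) N 0 = val (tableChildren l (s.arr 2)) N 0 := by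
        refine val_map (φ := id) {x | x < l} (fun x _ c hc => (mem_tableChildren.1 hc).1)
          (Set.injOn_id _) (fun x _ => ?_) N 0 hl
        ext i
        rw [Finset.image_id, mem_tableChildren, mem_tableChildren]
        refine and_congr_right fun hi => ?_
        simp [table, hi, he ⟨i, hi⟩ (show i < K by omega)]
      rw [val_prod, ← this, val_ofTable f, val_ofTable g]
      exact Iff.of_eq (congrArg (_ = ·)
        ((congrArg (Value.prod N _) (val_ofTable e N ⟨0, hl⟩)).trans
          (FDS.val_mul (FDS.ofTable g) (FDS.ofTable e) N b ⟨0, hl⟩).symm))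
    · rw [he _ (show 0 < K by omega)]; exact h0
    · rw [he i (by omega)]; exact hW i hi i.2 (by omega)
  by_cases hc : (compare.run s).arr 4 a = (compare.run s).arr 4 (n + b) ∧ m * l = n
  · obtain ⟨v0, v1, v2⟩ := r₁ hc
    obtain ⟨hval, hroot, hlK⟩ := hcmp hc.2
    have hiso : (FDS.ofTable f).Iso (FDS.ofTable g * FDS.ofTable e) := by
      refine FDS.iso_of_val_eq ha (hb.mul hroot) (ha.iterate_card ?_)
        ((hb.mul hroot).iterate_card ?_) (hval.1 hc.1)
      · change Nat.card (Fin n) ≤ N; simpa using hN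
      · change Nat.card (Fin m × Fin l) ≤ N
        rw [Nat.card_prod, Nat.card_fin, Nat.card_fin, hc.2]
        exact hN
    refine .inl ⟨l, e, ⟨v0, v1, fun i => ?_⟩, hroot.isDendron, hiso, fun C hC hC' =>
      FDS.iso_of_mul_iso_mul ha.isDendron hb.isDendron hC hroot.isDendron hC' hiso⟩
    rw [v2 i (by omega), c2, he i (by omega)]
  · refine .inr ⟨r₂ hc, fun C hC hiso => hc ?_⟩
    have hCe := hex C hC hiso e he
    have hml : m * l = n := by
      have := hiso.card_eq
      rw [FDS.card_mul, hCe.card_eq] at this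
      change Nat.card (Fin n) = Nat.card (Fin m) * Nat.card (Fin l) at this
      simpa using this.symm
    obtain ⟨hval, hroot, -⟩ := hcmp hml
    refine ⟨hval.2 ?_, hml⟩
    obtain ⟨c, hc'⟩ := hC.exists_isRoot
    refine (hiso.val_root ha (hb.mul hc') N).trans ((FDS.val_mul (FDS.ofTable g) C N b c).trans
      (Eq.trans ?_ (FDS.val_mul (FDS.ofTable g) (FDS.ofTable e) N b ⟨0, hl⟩).symm))
    rw [hCe.val_root hc' hroot]

/-- The tree of a quotient has at most `n * (N + 1)` nodes; `hK'` leaves room for the product of `B`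
with a tree that is one node larger. The inequality `n < N` is strict because the unrolled loop has
to be recognised among the children of the root, one level down. -/
theorem run_divide {n m K N : ℕ} {f : Fin n → Fin n} {g : Fin m → Fin m}
    (hf : (FDS.ofTable f).IsDendron) (hg : (FDS.ofTable g).IsDendron) {s : Mem}
    (h0 : s.var 0 = n) (h1 : s.var 1 = m) (h2 : s.var 2 = K) (h3 : s.var 3 = N)
    (hA : s.arr 0 = table f) (hB : s.arr 1 = table g) (h6 : s.arr 6 0 = 0) (hN : n < N)
    (hNK : N ≤ K) (hmK : m ≤ K) (hK : 2 * n ≤ K) (hK' : n + (n * (N + 1) + 1) * m ≤ K) :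
    IsQuotient f g (divide.run s) := by
  obtain ⟨a, ha⟩ := hf.exists_isRoot
  obtain ⟨b, hb⟩ := hg.exists_isRoot
  change Fin n at a
  change Fin m at b
  obtain ⟨s₁, hs₁⟩ : ∃ s₁, s₁ = (s.setVar 13 a).setVar 14 b := ⟨_, rfl⟩
  have hrun : divide.run s = report.run (compare.run (extract.run (greedy.run s₁))) := by
    have e₁ : (fixpoint 0 0).eval s = a :=
      eval_fixpoint s (by decide) (by decide) (h0 ▸ a.2) (by omega)
        (by rw [h0, hA]; exact table_eq_self_iff ha)
    have e₂ : (fixpoint 1 1).eval (s.setVar 13 a) = b :=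
      eval_fixpoint _ (by decide) (by decide) (by simp [h1]) (by simp [h1, h2, hmK])
        (by simpa [h1, hB] using table_eq_self_iff hb)
    simp only [divide, SProg.run, e₁, e₂, hs₁]
  have hset : IsSetUp n m K N a b (table f) (table g) s₁ := by
    rw [hs₁]
    exact ⟨by simp [h0], by simp [h1], by simp [h2], by simp [h3], by simp, by simp, by simp [hA],
      by simp [hB]⟩
  have hin : IsInput n m K N a b (table f) (table g) :=
    ⟨hmK, hNK, table_lt f, table_lt g, a.2, b.2⟩
  obtain ⟨⟨i₁, i₂, i₃⟩, -, i₅⟩ := run_greedy hset hin (by rw [hs₁]; exact h6)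
  have hset₁ := hset.of_sameOutside (greedy.sameOutside_run s₁) (by decide) (by decide)
  rw [hrun]
  set r := greedy.run s₁
  have hset₂ := hset₁.of_sameOutside (extract.sameOutside_run r) (by decide) (by decide)
  obtain ⟨σ, hσ⟩ : ∃ σ, σ = shift.eval (r.setArr 2 0 0) := ⟨_, rfl⟩
  obtain ⟨W, hW⟩ : ∃ W, W = Function.update (r.arr 2) 0 0 := ⟨_, rfl⟩
  obtain ⟨x₁, x₂⟩ := run_extract hW hσ
  rw [hset₁.var_two] at x₂
  have hσL : σ < r.var 4 := by rw [hσ]; exact eval_shift_lt (s := r.setArr 2 0 0) i₁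
  have hWlt : ∀ i, 0 < i → i < r.var 4 → W i < i := by
    intro i hi hiL
    rw [hW, Function.update_of_ne hi.ne']
    exact i₃ i hi hiL
  have hW0 : W 0 = 0 := by rw [hW, Function.update_self]
  have hn : 0 < n := a.pos
  have hm : 0 < m := b.pos
  refine isQuotient_of_run ha hb hset₂ hN.le hNK hmK hK x₁ (by omega) ?_ (fun i hi hil hiK => ?_)
    (fun C hC hiso e he => ?_)
  · rw [x₂ 0 (by omega), zero_add]
    rcases Nat.eq_zero_or_pos σ with h | h
    · rw [h, hW0]
    · have := hWlt σ h hσL; omega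
  · rw [x₂ i hiK]
    have := hWlt (i + σ) (by omega) (by omega)
    omega
  · obtain ⟨c, hc⟩ := hC.exists_isRoot
    obtain ⟨M, F, d, hQ, hM, hval⟩ := ha.exists_isTreeQuotient (N := N) hb hc hiso
    have hcard : n = m * Nat.card C.State := by
      have := hiso.card_eq
      rw [FDS.card_mul] at this
      change Nat.card (Fin n) = Nat.card (Fin m) * _ at this
      simpa using this
    have hCn : Nat.card C.State ≤ n := hcard ▸ Nat.le_mul_of_pos_left _ hm
    have hMn : M ≤ n * (N + 1) := hM.trans (Nat.mul_le_mul_right _ hCn)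
    have hMK : n + (M + 1) * m ≤ K := le_trans (by gcongr) hK'
    have hMK' : M + 1 ≤ K := by
      have := Nat.le_mul_of_pos_right (M + 1) hm; omega
    obtain ⟨j₁, j₂, -⟩ := i₅ M F d hQ hMK
    have hLM : r.var 4 = M := by omega
    obtain ⟨N, rfl⟩ : ∃ N', N = N' + 1 := ⟨N - 1, by omega⟩
    have hM2 : 2 ≤ M := by
      have := (hasHeight_iff_of_val_eq (j := 1) (by omega) hval).2 (hc.hasHeight 1)
      obtain ⟨i, hi, -⟩ := this
      rw [mem_treeChildren] at hi
      omega
    obtain ⟨k₁, k₂, k₃⟩ := eval_shift_spec (s := r.setArr 2 0 0) (L := M) hLM hM2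
      (by change M ≤ r.var 2; rw [hset₁.var_two]; omega)
    rw [← hσ] at k₁ k₂ k₃
    have hWF : ∀ i, 0 < i → i < M → W i = F i := by
      intro i hi hiM
      rw [hW, Function.update_of_ne hi.ne', j₂ i hi (by omega)]
    have hWr : (r.setArr 2 0 0).arr 2 = W := by rw [hW]; simp
    rw [hWr] at k₂ k₃
    subst hLM
    refine hQ.isDFS.iso_cutFirst hc (by omega) hval k₁ hσL
      (fun h => by rw [← hWF _ (by omega) h]; exact k₂ h)
      (fun j hj hjs => by rw [← hWF _ (by omega) (by omega)]; exact k₃ j hj hjs) (e := e)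
      (fun i => ?_)
    rw [he i (by omega), x₂ i (by omega), cutFirst]
    split_ifs with hi
    · rw [hi, zero_add]
      have := hWlt σ k₁ (by omega); omega
    · rw [hWF _ (by omega) (by omega)]

/-- The fourth power of `var 2`. -/
def fourthPower : SProg := .set 15 (.sum 20 (.sum 20 (.sum 20 (.sum 20 (.const 1)))))

theorem run_fourthPower (s : Mem) : fourthPower.run s = s.setVar 15 (s.var 2 ^ 4) := by
  simp only [fourthPower, SProg.run, SExpr.eval]
  congr 1
  simp
  ring

theorem Mem.Returns.of_agree {k l : ℕ} (hk : 2 < k) {s r : Mem} (h : Agree k r s)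
    {e : Fin l → Fin l} (hs : s.Returns e) : r.Returns e :=
  ⟨(h.2 0 (by omega)).trans hs.1, (h.2 1 (by omega)).trans hs.2.1, fun i => by
    rw [h.1]; exact hs.2.2 i⟩

theorem IsQuotient.of_agree {n m k : ℕ} {f : Fin n → Fin n} {g : Fin m → Fin m} (hk : 2 < k)
    {s r : Mem} (h : Agree k r s) (hs : IsQuotient f g s) : IsQuotient f g r := by
  rcases hs with ⟨l, e, he, hs⟩ | ⟨h0, hs⟩
  · exact .inl ⟨l, e, he.of_agree hk h, hs⟩
  · exact .inr ⟨(h.2 0 (by omega)).trans h0, hs⟩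

/-- With `x = n + m + 1`, the choices `N = x` and `K = x ^ 4` meet all size requirements. In the
absence of multiplication, `K` is computed by nested sums, in a first program with loop bound `x`.
-/
theorem exists_prog_isQuotient : ∃ (P : Prog) (p : Polynomial ℕ),
    ∀ (n m : ℕ) (f : Fin n → Fin n) (g : Fin m → Fin m),
      (FDS.ofTable f).IsDendron → (FDS.ofTable g).IsDendron →
      ∃ (t : ℕ) (s : Mem), Exec P (input f g) t s ∧ t ≤ p.eval (n + m) ∧ IsQuotient f g s := by
  obtain ⟨C₁, p₁, hC₁⟩ := fourthPower.exec (k := 30) (by decide) (by decide) 30 le_rfl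
  obtain ⟨C₂, p₂, hC₂⟩ := divide.exec (k := 30) (by decide) (by decide) 30 le_rfl
  refine ⟨.seq (.assign 2 (.add (.add (.var 0) (.var 1)) (.const 1)))
    (.seq (.assign 3 (.var 2)) (.seq C₁ (.seq (.assign 2 (.var 15)) C₂))),
    -- 10 is the cost of the three assignments; the two compiled programs have loop bounds `n + m +
    -- 1` and its fourth power.
    10 + p₁.comp (Polynomial.X + 1) + p₂.comp ((Polynomial.X + 1) ^ 4), ?_⟩
  intro n m f g hf hg
  obtain ⟨x, hx⟩ : ∃ x, x = n + m + 1 := ⟨_, rfl⟩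
  obtain ⟨s, hs⟩ : ∃ s, s = ((input f g).setVar 2 x).setVar 3 x := ⟨_, rfl⟩
  obtain ⟨t₁, r, e₁, b₁, a₁, -⟩ := hC₁ s
  rw [run_fourthPower] at a₁
  have s2 : s.var 2 = x := by simp [hs]
  rw [s2] at b₁ a₁
  obtain ⟨t₂, q, e₂, b₂, a₂, -⟩ := hC₂ (r.setVar 2 (x ^ 4))
  have r15 : r.var 15 = x ^ 4 := (a₁.2 15 (by decide)).trans (by simp)
  have hvar : ∀ i < 15, r.var i = s.var i := fun i hi => by
    rw [a₁.2 i (by omega), Mem.setVar_var, Function.update_of_ne hi.ne]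
  have harr : r.arr = (input f g).arr := a₁.1.trans (by simp [hs])
  refine ⟨_, q, .seq (.assign _ _ _) (.seq (.assign _ _ _) (.seq (s₂ := r) (t₁ := t₁) ?_
    (.seq (.assign _ _ _) (t₂ := t₂) ?_))), ?_, ?_⟩
  · convert e₁ using 1
    simp [hs, Expr.eval, input, hx]
  · convert e₂ using 1
    simp [Expr.eval, r15]
  · simp only [Mem.setVar_var, Function.update_self] at b₂
    simp only [Expr.cost, Polynomial.eval_add, Polynomial.eval_comp, Polynomial.eval_pow,
      Polynomial.eval_X, Polynomial.eval_one, Polynomial.eval_ofNat]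
    rw [hx] at b₁ b₂
    omega
  · have hn : 0 < n := by obtain ⟨a, -⟩ := hf.exists_isRoot; exact Fin.pos a
    have hm : 0 < m := by obtain ⟨b, -⟩ := hg.exists_isRoot; exact Fin.pos b
    have hx3 : 3 ≤ x := by omega
    have h4 : x ^ 3 + x ^ 2 + x ≤ x ^ 4 := by nlinarith [sq_nonneg x, Nat.mul_le_mul hx3 hx3]
    have hx1 : x ≤ x ^ 2 := by nlinarith
    refine IsQuotient.of_agree (k := 30) (by decide) a₂ (run_divide hf hg (K := x ^ 4) (N := x)
      ?_ ?_ ?_ ?_ ?_ ?_ ?_ ?_ ?_ ?_ ?_ ?_)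
    · simp [hvar, hs, input]
    · simp [hvar, hs, input]
    · simp
    · simp [hvar, hs]
    · simp [harr, input]
    · simp [harr, input]
    · simp [harr, input]
    · omega
    · omega
    · omega
    · omega
    · have h₁ : n ≤ x := by omega
      have h₂ : m + 1 ≤ x := by omega
      nlinarith [Nat.mul_le_mul h₁ h₂, Nat.mul_le_mul (Nat.mul_le_mul h₁ h₂) (le_refl x)]

end RAM

theorem mainTheorem6 :
    ∃ (P : RAM.Prog) (p : Polynomial ℕ),
      ∀ (n m : ℕ) (f : Fin n → Fin n) (g : Fin m → Fin m),
        (FDS.ofTable f).IsDendron → (FDS.ofTable g).IsDendron →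
        ∃ (t : ℕ) (s : RAM.Mem),
          RAM.Exec P (RAM.input f g) t s ∧ t ≤ p.eval (n + m) ∧
          ((∃ (l : ℕ) (h : Fin l → Fin l), s.Returns h ∧ (FDS.ofTable h).IsDendron ∧
              (FDS.ofTable f).Iso (FDS.ofTable g * FDS.ofTable h) ∧
              ∀ C : FDS, C.IsDendron → (FDS.ofTable f).Iso (FDS.ofTable g * C) →
                C.Iso (FDS.ofTable h)) ∨
            (s.ReportsNone ∧
              ∀ C : FDS, C.IsDendron → ¬ (FDS.ofTable f).Iso (FDS.ofTable g * C))) :=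
  RAM.exists_prog_isQuotient
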